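/- Throughout, $n\in\mathbb{Z}_{\ge 0}$. An increasing path in $\mathbb{Z}_{\ge 0}^2$ is a finite sequence of vertices with steps $(1,0)$ or $(0,1)$, and $u\preceq v$ is the coordinatewise order. For weights $x=(x_w)_{w\in\mathbb{Z}_{\ge0}^2}$ and a path $\gamma$ put $T(\gamma)=\sum_{w\in\gamma}x_w$. For $v\in\mathbb{Z}_{\ge 0}^2$ let $T_v$ be the maximum of $T(\gamma)$ over increasing paths from $\mathbf 0=(0,0)$ to $v$; let $L^k_v$ be the maximum of $\sum_{i=1}^kT(\gamma_i)$ over $k$-tuples of mutually disjoint, possibly empty, increasing paths contained in $\{w:\mathbf 0\preceq w\preceq v\}$ (so $L^0_v=0$), and let $W^k_v=L^k_v-L^{k-1}_v$ for $k\ge1$. Let $I_n=\{(a,b,k): a,b\in\mathbb{Z}_{\ge0},\ a+b=n,\ 1\le k\le 1+\min(a,b)\}$. A real array $p=(p^k_{(a,b)})_{(a,b,k)\in I_n\cup I_{n+1}}$ is called interlacing if all its entries are non-negative and, for every $(a,b,k)\in I_n$ and each $v\in\{(a+1,b),(a,b+1)\}$, $p^k_{(a,b)}\le p^k_{v}$,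 and $p^{k+1}_{v}\le p^k_{(a,b)}$ whenever $p^{k+1}_{v}$ is an entry of the array. Put $E(p)=\sum_{(a,b,k)\in I_{n+1}}p^k_{(a,b)}-\sum_{(a,b,k)\in I_n}p^k_{(a,b)}$. Then the following hold. (1) The map sending non-negative integer weights $(x_{(a,b)})_{a,b\ge0,\ a+b\le n+1}$ to the array $(W^k_{(a,b)})_{(a,b,k)\in I_n\cup I_{n+1}}$ is a bijection onto the set of interlacing integer arrays. (2) Let $\beta\in(0,1)$ and let the weights be i.i.d. geometric, $\mathbb{P}[\hat\xi_w=j]=(1-\beta)\beta^j$ for $j\in\mathbb{Z}_{\ge0}$, with associated increments $\hat W^k_v$. Then for every interlacing integer array $p$, $$\mathbb{P}\left[\hat W^k_{(a,b)}=p^k_{(a,b)}\ \ \forall (a,b,k)\in I_n\cup I_{n+1}\right]=(1-\beta)^{(n+2)(n+3)/2}\,\beta^{E(p)} .$$ (3) Let the weights be i.i.d. exponential random variables of rate $1$. Then the random vector $(W^k_{(a,b)})_{(a,b,k)\in I_n\cup I_{n+1}}$ has a density with respect to Lebesgue measure on $\mathbb{R}^{I_n\cup I_{n+1}}$, which is $\frac1Z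 e^{-E(p)}$ if $p$ is interlacing and $0$ otherwise. Here the partition function $Z=\int_{p\text{ interlacing}}e^{-E(p)}\,dp$ satisfies $0<Z<\infty$. (4) Let the weights be i.i.d. exponential of rate $1$, and let $S(0)=0$ and $S$ be a random walk whose increments are i.i.d. Laplace with location $0$ and scale $2$ (density $\frac14e^{-|x|/2}$). For all integers $0\le l<r\le n$, almost surely, the regular conditional distribution of $\left(T_{(l+i,n-l-i)}-T_{(l,n-l)}\right)_{i=0}^{r-l}$ given $\{W^2_{(a,n+1-a)}\}_{l\le a\le r+1}$, $T_{(l,n-l)}$ and $T_{(r,n-r)}$ is the law of $(S(i))_{i=0}^{r-l}$ conditioned on $S(r-l)=T_{(r,n-r)}-T_{(l,n-l)}$ (regular conditional distribution) and then on the event $$S(i)>\max\left(W^2_{(l+i,n+1-l-i)},\,W^2_{(l+i+1,n-l-i)}\right)-T_{(l,n-l)}\qquad\text{for all }0\le i\le r-l .$$ -/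

import Mathlib

open MeasureTheory ProbabilityTheory

noncomputable section

namespace LPP

/-- A unit step to the right or up on the quadrant `ℤ_{≥0}²`. -/
def Step (p q : ℕ × ℕ) : Prop := q = p + (1, 0) ∨ q = p + (0, 1)

/-- `γ` is the vertex set of a (possibly empty) increasing lattice path. -/
def IsPath (γ : Finset (ℕ × ℕ)) : Prop :=
  ∃ s : List (ℕ × ℕ), s.IsChain Step ∧ s.toFinset = γ

/-- `γ` is the vertex set of an increasing lattice path with first vertex `u` and last vertex
`v`. -/
def IsPathFromTo (u v : ℕ × ℕ) (γ : Finset (ℕ × ℕ)) : Prop :=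
  ∃ s : List (ℕ × ℕ), s.IsChain Step ∧ s.head? = some u ∧ s.getLast? = some v ∧ s.toFinset = γ

open Classical in
/-- All `k`-tuples of mutually disjoint, possibly empty increasing paths inside the rectangle
`{w | u ≤ w ≤ v}`. -/
def disjointPaths (k : ℕ) (u v : ℕ × ℕ) : Finset (Fin k → Finset (ℕ × ℕ)) :=
  (Fintype.piFinset fun _ : Fin k => (Finset.Icc u v).powerset).filter fun γ =>
    (∀ i, IsPath (γ i)) ∧ Pairwise fun i j => Disjoint (γ i) (γ j)

theorem disjointPaths_nonempty (k : ℕ) (u v : ℕ × ℕ) : (disjointPaths k u v).Nonempty := by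
  refine ⟨fun _ => ∅, ?_⟩
  simp only [disjointPaths, Finset.mem_filter, Fintype.mem_piFinset, Finset.mem_powerset]
  exact ⟨fun _ => Finset.empty_subset _, fun _ => ⟨[], by simp, by simp⟩,
    fun _ _ _ => Finset.disjoint_empty_left _⟩

open Classical in
/-- All increasing paths from `u` to `v`. -/
def pathsFromTo (u v : ℕ × ℕ) : Finset (Finset (ℕ × ℕ)) :=
  (Finset.Icc u v).powerset.filter (IsPathFromTo u v)

theorem exists_path {u v : ℕ × ℕ} (h : u ≤ v) :
    ∃ s : List (ℕ × ℕ), s.IsChain Step ∧ s.head? = some u ∧ s.getLast? = some v ∧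
      ∀ w ∈ s, u ≤ w ∧ w ≤ v := by
  have extend : ∀ v v' : ℕ × ℕ, Step v v' →
      (∃ s : List (ℕ × ℕ), s.IsChain Step ∧ s.head? = some u ∧ s.getLast? = some v ∧
        ∀ w ∈ s, u ≤ w ∧ w ≤ v) →
      (∃ s : List (ℕ × ℕ), s.IsChain Step ∧ s.head? = some u ∧ s.getLast? = some v' ∧
        ∀ w ∈ s, u ≤ w ∧ w ≤ v') := by
    rintro v v' hs ⟨s, h1, h2, h3, h4⟩
    have hv : v ≤ v' := by
      rcases hs with rfl | rfl <;> simp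
    have huv : u ≤ v := (h4 v (List.mem_of_getLast? h3)).1
    refine ⟨s ++ [v'], ?_, ?_, by simp, ?_⟩
    · rw [List.isChain_append]
      refine ⟨h1, by simp, ?_⟩
      intro x hx y hy
      rw [h3] at hx
      simp at hx hy
      subst hx hy
      exact hs
    · simp [List.head?_append, h2]
    · intro w hw
      rcases List.mem_append.1 hw with hw | hw
      · exact ⟨(h4 w hw).1, (h4 w hw).2.trans hv⟩
      · simp at hw
        subst hw
        exact ⟨huv.trans hv, le_rfl⟩
  obtain ⟨u1, u2⟩ := u
  obtain ⟨v1, v2⟩ := v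
  obtain ⟨h1, h2⟩ := Prod.mk_le_mk.1 h
  clear h
  induction v1, h1 using Nat.le_induction with
  | base =>
    induction v2, h2 using Nat.le_induction with
    | base => exact ⟨[(u1, u2)], by simp⟩
    | succ m _ ih => exact extend _ _ (Or.inr (by simp)) ih
  | succ m _ ih => exact extend _ _ (Or.inl (by simp)) ih

theorem pathsFromTo_nonempty {u v : ℕ × ℕ} (h : u ≤ v) : (pathsFromTo u v).Nonempty := by
  obtain ⟨s, h1, h2, h3, h4⟩ := exists_path h
  refine ⟨s.toFinset, ?_⟩
  simp only [pathsFromTo, Finset.mem_filter, Finset.mem_powerset]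
  refine ⟨fun w hw => Finset.mem_Icc.2 (h4 w (by simpa using hw)), s, h1, h2, h3, rfl⟩

section Weights

variable {R : Type*} [AddCommGroup R] [LinearOrder R]

/-- The weight `T(γ)` of a path. -/
def pathWeight (x : ℕ × ℕ → R) (γ : Finset (ℕ × ℕ)) : R := ∑ w ∈ γ, x w

/-- The passage time `T_{u,v}`: the maximal weight of an increasing path from `u` to `v`. -/
def passageTime (x : ℕ × ℕ → R) (u v : ℕ × ℕ) (h : u ≤ v) : R :=
  (pathsFromTo u v).sup' (pathsFromTo_nonempty h) (pathWeight x)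

/-- `L^k_{u,v}`: the maximal total weight of `k` mutually disjoint increasing paths in the
rectangle between `u` and `v`. -/
def maxWeight (x : ℕ × ℕ → R) (k : ℕ) (u v : ℕ × ℕ) : R :=
  (disjointPaths k u v).sup' (disjointPaths_nonempty k u v) fun γ => ∑ i, pathWeight x (γ i)

/-- `W^k_v = L^k_{0,v} - L^{k-1}_{0,v}`, for `k ≥ 1`. -/
def increment (x : ℕ × ℕ → R) (k : ℕ) (v : ℕ × ℕ) : R :=
  maxWeight x k 0 v - maxWeight x (k - 1) 0 v

end Weights

/-- The index set `I_n` of all `((a, b), k)` with `a + b = n` and `1 ≤ k ≤ 1 + min a b`. -/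
def idx (n : ℕ) : Finset ((ℕ × ℕ) × ℕ) :=
  (Finset.HasAntidiagonal.antidiagonal n ×ˢ Finset.Icc 1 (n + 1)).filter fun i => i.2 ≤ 1 + min i.1.1 i.1.2

theorem mem_idx (n a b k : ℕ) : ((a, b), k) ∈ idx n ↔ a + b = n ∧ 1 ≤ k ∧ k ≤ 1 + min a b := by
  simp only [idx, Finset.mem_filter, Finset.mem_product, Finset.HasAntidiagonal.mem_antidiagonal, Finset.mem_Icc]
  omega

/-- The index set `I_n ∪ I_{n+1}`. -/
abbrev Idx (n : ℕ) : Type := ↥(idx n ∪ idx (n + 1))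

/-- Non-negative arrays on `I_n ∪ I_{n+1}` satisfying the interlacing condition. If `i` is indexed
by `((a, b), k)` and `j` sits at `(a + 1, b)` or `(a, b + 1)`, then `p i ≤ p j` when `j` has
superscript `k`, and `p j ≤ p i` when `j` has superscript `k + 1`. -/
def Interlacing {R : Type*} [Zero R] [LE R] (n : ℕ) (p : Idx n → R) : Prop :=
  (∀ i, 0 ≤ p i) ∧
  ∀ i j : Idx n, Step i.1.1 j.1.1 →
    (j.1.2 = i.1.2 → p i ≤ p j) ∧ (j.1.2 = i.1.2 + 1 → p j ≤ p i)

/-- `∑_{I_{n+1}} p - ∑_{I_n} p`. -/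
def energy {R : Type*} [AddCommGroup R] (n : ℕ) (p : Idx n → R) : R :=
  (∑ i : Idx n with i.1 ∈ idx (n + 1), p i) - ∑ i : Idx n with i.1 ∈ idx n, p i

/-- The array `(W^k_{(a,b)})` over `((a, b), k) ∈ I_n ∪ I_{n+1}`. -/
def incrementArray {R : Type*} [AddCommGroup R] [LinearOrder R] (n : ℕ) (x : ℕ × ℕ → R) :
    Idx n → R :=
  fun i => increment x i.1.2 i.1.1

/-- The triangle `{(a, b) | a + b ≤ m}`. -/
abbrev Triangle (m : ℕ) : Type := {v : ℕ × ℕ // v.1 + v.2 ≤ m}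

/-- The map `F` sending integer weights on the triangle `a + b ≤ n + 1` to the array
`(W^k_{(a,b)})`; the weights outside the triangle, which do not enter, are set to zero. -/
def rskMap (n : ℕ) (t : Triangle (n + 1) → ℤ) : Idx n → ℤ :=
  incrementArray n fun v => if h : v.1 + v.2 ≤ n + 1 then t ⟨v, h⟩ else 0

open Classical in
/-- The unnormalized density `exp(-∑_{I_{n+1}} p + ∑_{I_n} p)` on interlacing arrays, zero
elsewhere. -/
def gibbsWeight (n : ℕ) (p : Idx n → ℝ) : ENNReal :=
  if Interlacing n p then ENNReal.ofReal (Real.exp (-energy n p)) else 0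

/-- The partition function. -/
def partitionFunction (n : ℕ) : ENNReal := ∫⁻ p : Idx n → ℝ, gibbsWeight n p

/-- The Laplace distribution with location `0` and scale `2`. -/
def laplaceMeasure : Measure ℝ :=
  volume.withDensity fun x => ENNReal.ofReal (1 / 4 * Real.exp (-|x| / 2))

theorem lintegral_laplace :
    ∫⁻ x : ℝ, ENNReal.ofReal (1 / 4 * Real.exp (-|x| / 2)) = 1 := by
  have h1 : ∫⁻ x in Set.Iic (0 : ℝ), ENNReal.ofReal (1 / 4 * Real.exp (-|x| / 2)) =
      ENNReal.ofReal (1 / 2) := by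
    rw [setLIntegral_congr_fun (g := fun x => ENNReal.ofReal (1 / 4 * Real.exp (1 / 2 * x)))
      measurableSet_Iic (fun x hx => by
        simp only [abs_of_nonpos (Set.mem_Iic.1 hx)]; congr 3; ring),
      ← ofReal_integral_eq_lintegral_ofReal
        ((integrableOn_exp_mul_Iic (by norm_num) 0).const_mul _)
        (Filter.Eventually.of_forall fun x => by positivity),
      integral_const_mul, integral_exp_mul_Iic (by norm_num)]
    norm_num
  have h2 : ∫⁻ x in Set.Ioi (0 : ℝ), ENNReal.ofReal (1 / 4 * Real.exp (-|x| / 2)) =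
      ENNReal.ofReal (1 / 2) := by
    rw [setLIntegral_congr_fun (g := fun x => ENNReal.ofReal (1 / 4 * Real.exp (-1 / 2 * x)))
      measurableSet_Ioi (fun x hx => by
        simp only [abs_of_pos (Set.mem_Ioi.1 hx)]; congr 3; ring),
      ← ofReal_integral_eq_lintegral_ofReal
        ((integrableOn_exp_mul_Ioi (by norm_num) 0).const_mul _)
        (Filter.Eventually.of_forall fun x => by positivity),
      integral_const_mul, integral_exp_mul_Ioi (by norm_num)]
    norm_num
  rw [← lintegral_add_compl _ (measurableSet_Iic (a := (0 : ℝ))), Set.compl_Iic, h1, h2,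
    ← ENNReal.ofReal_add (by norm_num) (by norm_num)]
  norm_num

instance : IsProbabilityMeasure laplaceMeasure :=
  ⟨by rw [laplaceMeasure, withDensity_apply _ MeasurableSet.univ, setLIntegral_univ,
    lintegral_laplace]⟩

/-- The law of `(S(0), …, S(m))`, where `S(0) = 0` and `S` has i.i.d. Laplace increments. -/
def walkLaw (m : ℕ) : Measure (Fin (m + 1) → ℝ) :=
  (Measure.pi fun _ : Fin m => laplaceMeasure).map
    fun x i => ∑ j : Fin m with j.1 < i.1, x j

instance (m : ℕ) : IsProbabilityMeasure (walkLaw m) := by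
  refine Measure.isProbabilityMeasure_map (Measurable.aemeasurable ?_)
  fun_prop

/-- The random walk bridge: the law of `(S(0), …, S(m))` given `S(m)`, as a regular conditional
distribution. -/
def walkBridge (m : ℕ) : Kernel ℝ (Fin (m + 1) → ℝ) :=
  condDistrib id (fun s : Fin (m + 1) → ℝ => s (Fin.last m)) (walkLaw m)

end LPP

end

/-! For non-negative weights the increments are the row lengths of the Robinson-Schensted-Knuth
shapes, and everything follows from the local rule by which these shapes grow.

Greene's theorem comes first. In the plane a set without antichains of more than `k` points is
covered by `k` disjoint increasing paths, so `L^k` is the maximal weight of such a set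
(`maxWeight_eq_widthMax`). Exchanging chains between optimal sets in four neighbouring rectangles
gives the octahedron recurrence `widthMax_add_widthMax`. Subtracting it for two consecutive values
of `k` yields the local rule (`widthMax_succ_sub`): a first-row entry is the larger of its two
neighbours plus the weight, and a later entry satisfies `new = max + min - old`.

Three properties of this rule give parts (1) to (3). With the middle antidiagonal fixed, it reflects
each old entry in the interval `[max, min]` that interlacing prescribes; so it preserves interlacing
and can be undone, level by level (`levelInterlacing_succ_iff`, `exists_shape_eq`). It is a
translation or a reflection in each coordinate that it replaces, so it preserves Lebesgue measure in
spite of the maxima (`measurePreserving_levelShapes`). Finally, the rows of a shape add up to the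
weight of the rectangle, so the difference of two consecutive antidiagonals counts every weight of
the triangle once, and the energy is the sum of the weights (`energy_shapeArray`). Product laws are
thereby carried to `β ^ E` and to `exp (-E)`, and the partition function equals 1.

For part (4), the Gibbs weight is written in terms of a stretch `t` of the first row of the lower
level, the entries `u` above it, and the rest. Integrating `exp (-u)` over `u ≥ max` of two
consecutive `t` leaves `exp (-max)`. Together with the factors `exp t` this is a product of Laplace
densities of scale 2 in the increments of `t`, times a function of the end point
(`exp_sum_mul_prod_exp`). Hence the joint law of boundary data and row is a measure composed with
the walk bridge and restricted to the walks above the second row, and such a restriction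
disintegrates by conditioning the kernel (`restrict_compProd_eq`). -/

namespace LPP

/-! ### Chain decompositions as linkings, and the exchange of chains -/

section Linking

variable {P : Type*} [PartialOrder P]

/-- A set `M` of pairs in `S` which links each element of `S` to at most one larger element and to
at most one smaller element of `S`. -/
structure IsLinking (S : Finset P) (M : Finset (P × P)) : Prop where
  fst_mem : ∀ e ∈ M, e.1 ∈ S
  snd_mem : ∀ e ∈ M, e.2 ∈ S
  lt : ∀ e ∈ M, e.1 < e.2
  inj_fst : ∀ e ∈ M, ∀ e' ∈ M, e.1 = e'.1 → e = e'
  inj_snd : ∀ e ∈ M, ∀ e' ∈ M, e.2 = e'.2 → e = e'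

open Classical in
-- A linking cuts `S` into `S.card - M.card` chains, and an antichain meets each of them at most
-- once. The count is direct: links that start in the up-set of `A` end in it outside `A`, and the
-- other links are counted by their starting points outside the up-set.
theorem IsLinking.card_antichain_add_card_le {S : Finset P} {M : Finset (P × P)}
    (h : IsLinking S M) {A : Finset P} (hAS : A ⊆ S) (hA : IsAntichain (· ≤ ·) (A : Set P)) :
    A.card + M.card ≤ S.card := by
  set U := S.filter fun w => ∃ a ∈ A, a ≤ w with hU
  have hAU : A ⊆ U := fun a ha => Finset.mem_filter.2 ⟨hAS ha, a, ha, le_rfl⟩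
  have h1 : (M.filter fun e => e.1 ∈ U).card ≤ (U \ A).card := by
    refine Finset.card_le_card_of_injOn Prod.snd ?_ ?_
    · intro e he
      obtain ⟨he, heU⟩ := Finset.mem_filter.1 he
      obtain ⟨-, a, ha, hae⟩ := Finset.mem_filter.1 heU
      have hlt := h.lt e he
      refine Finset.mem_coe.2 (Finset.mem_sdiff.2 ⟨Finset.mem_filter.2
        ⟨h.snd_mem e he, a, ha, hae.trans hlt.le⟩, fun hA2 => ?_⟩)
      exact hA ha hA2 (hae.trans_lt hlt).ne (hae.trans hlt.le)
    · intro e he e' he' hee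
      exact h.inj_snd e (Finset.mem_filter.1 he).1 e' (Finset.mem_filter.1 he').1 hee
  have h2 : (M.filter fun e => ¬ e.1 ∈ U).card ≤ (S \ U).card := by
    refine Finset.card_le_card_of_injOn Prod.fst ?_ ?_
    · intro e he
      obtain ⟨he, heU⟩ := Finset.mem_filter.1 he
      exact Finset.mem_coe.2 (Finset.mem_sdiff.2 ⟨h.fst_mem e he, heU⟩)
    · intro e he e' he' hee
      exact h.inj_fst e (Finset.mem_filter.1 he).1 e' (Finset.mem_filter.1 he').1 hee
  have h3 := Finset.card_filter_add_card_filter_not (s := M) (fun e => e.1 ∈ U)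
  have h4 := Finset.card_sdiff_add_card_eq_card hAU
  have hUS : U ⊆ S := Finset.filter_subset _ _
  have h5 := Finset.card_sdiff_add_card_eq_card hUS
  omega

open Classical in
-- Each point is linked to the next point of its colour, so only the top point of each colour has no
-- outgoing link.
theorem exists_isLinking_of_coloring {S : Finset P} {k : ℕ} (r : P → ℕ) (hr : ∀ w ∈ S, r w < k)
    (hc : ∀ w ∈ S, ∀ w' ∈ S, r w = r w' → w ≤ w' ∨ w' ≤ w) :
    ∃ M, IsLinking S M ∧ S.card ≤ M.card + k := by
  set M := (S ×ˢ S).filter fun e => r e.1 = r e.2 ∧ e.1 < e.2 ∧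
    ∀ z ∈ S, r z = r e.1 → e.1 < z → e.2 ≤ z with hM
  have mem : ∀ e, e ∈ M ↔ (e.1 ∈ S ∧ e.2 ∈ S) ∧ r e.1 = r e.2 ∧ e.1 < e.2 ∧
    ∀ z ∈ S, r z = r e.1 → e.1 < z → e.2 ≤ z := fun e => by
      rw [hM, Finset.mem_filter, Finset.mem_product]
  have hfst : ∀ e ∈ M, ∀ e' ∈ M, e.1 = e'.1 → e = e' := by
    intro e he e' he' hee
    rw [mem] at he he'
    refine Prod.ext hee (le_antisymm ?_ ?_)
    · exact he.2.2.2 _ he'.1.2 (by rw [← he'.2.1, hee]) (by rw [hee]; exact he'.2.2.1)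
    · exact he'.2.2.2 _ he.1.2 (by rw [← he.2.1, hee]) (by rw [← hee]; exact he.2.2.1)
  refine ⟨M, ⟨fun e he => ((mem e).1 he).1.1, fun e he => ((mem e).1 he).1.2,
    fun e he => ((mem e).1 he).2.2.1, hfst, ?_⟩, ?_⟩
  · intro e he e' he' hee
    rw [mem] at he he'
    have hcol : r e.1 = r e'.1 := by rw [he.2.1, he'.2.1, hee]
    refine Prod.ext ?_ hee
    rcases hc _ he.1.1 _ he'.1.1 hcol with hle | hle
    · rcases hle.eq_or_lt with h | h
      · exact h
      · exact absurd (he.2.2.2 _ he'.1.1 hcol.symm h) (by rw [hee]; exact he'.2.2.1.not_ge)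
    · rcases hle.eq_or_lt with h | h
      · exact h.symm
      · exact absurd (he'.2.2.2 _ he.1.1 hcol h) (by rw [← hee]; exact he.2.2.1.not_ge)
  · have hsub : M.image Prod.fst ⊆ S := by
      intro w hw
      obtain ⟨e, he, rfl⟩ := Finset.mem_image.1 hw
      exact ((mem e).1 he).1.1
    have hcard : (M.image Prod.fst).card = M.card :=
      Finset.card_image_of_injOn fun e he e' he' => hfst e he e' he'
    have hrest : (S \ M.image Prod.fst).card ≤ (Finset.range k).card := by
      have key : ∀ w ∈ S, ∀ w' ∈ S, r w = r w' → w < w' → w ∈ M.image Prod.fst := by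
        intro w hw w' hw' hrr hlt
        obtain ⟨z, hz, hmin⟩ := (S.filter fun z => r z = r w ∧ w < z).exists_minimal
          ⟨w', Finset.mem_filter.2 ⟨hw', hrr.symm, hlt⟩⟩
        obtain ⟨hzS, hzr, hwz⟩ := Finset.mem_filter.1 hz
        refine Finset.mem_image.2 ⟨(w, z), (mem _).2 ⟨⟨hw, hzS⟩, hzr.symm, hwz, ?_⟩, rfl⟩
        intro y hy hyr hwy
        rcases hc _ hzS _ hy (hzr.trans hyr.symm) with h | h
        · exact h
        · exact hmin (Finset.mem_filter.2 ⟨hy, hyr, hwy⟩) h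
      refine Finset.card_le_card_of_injOn r ?_ ?_
      · intro w hw
        exact Finset.mem_coe.2 (Finset.mem_range.2 (hr w (Finset.mem_sdiff.1 hw).1))
      · intro w hw w' hw' hrr
        obtain ⟨hw, hwM⟩ := Finset.mem_sdiff.1 hw
        obtain ⟨hw', hwM'⟩ := Finset.mem_sdiff.1 hw'
        rcases hc _ hw _ hw' hrr with h | h
        · rcases h.eq_or_lt with h | h
          · exact h
          · exact absurd (key _ hw _ hw' hrr h) hwM
        · rcases h.eq_or_lt with h | h
          · exact h.symm
          · exact absurd (key _ hw' _ hw hrr.symm h) hwM'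
    have := Finset.card_sdiff_add_card_eq_card hsub
    rw [Finset.card_range] at hrest
    omega

/-- The points whose links are exchanged when the linked sets `S` and `S'` trade the link ending at
`a`: with `true`, points of `S` whose outgoing link is exchanged, with `false`, points of `S'` whose
incoming link is exchanged. -/
inductive Switched (S S' : Finset P) (M M' : Finset (P × P)) (a : P) : Bool → P → Prop
  | base : Switched S S' M M' a true a
  | out_double {v w : P} : Switched S S' M M' a true v → v ∈ S' → (v, w) ∈ M' →
      Switched S S' M M' a false w
  | out_simple {v w : P} : Switched S S' M M' a true w → w ∉ S' → (v, w) ∈ M →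
      Switched S S' M M' a true v
  | in_double {v w : P} : Switched S S' M M' a false w → w ∈ S → (v, w) ∈ M →
      Switched S S' M M' a true v
  | in_simple {v w : P} : Switched S S' M M' a false v → v ∉ S → (v, w) ∈ M' →
      Switched S S' M M' a false w

/-- `X` holds the points of `S` whose outgoing link changes sides, `X'` the points of `S'` whose
incoming link does. A point of only one set moves together with both its links. A point of both sets
stays in both, and there the two outgoing links are traded together, as are the two incoming ones.
`inv` and `inv'` express this consistency; the rest is propositional. -/
theorem IsLinking.redivide {S S' T T' X X' : Finset P} {M M' N N' : Finset (P × P)}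
    (hM : IsLinking S M) (hM' : IsLinking S' M')
    (memT : ∀ w, w ∈ T ↔ (w ∈ S ∧ (w ∈ S' ∨ w ∉ X)) ∨ (w ∈ S' ∧ w ∉ S ∧ w ∈ X'))
    (memT' : ∀ w, w ∈ T' ↔ (w ∈ S' ∧ (w ∈ S ∨ w ∉ X')) ∨ (w ∈ S ∧ w ∉ S' ∧ w ∈ X))
    (memN : ∀ e, e ∈ N ↔ (e ∈ M ∧ e.1 ∉ X) ∨ (e ∈ M' ∧ e.2 ∈ X'))
    (memN' : ∀ e, e ∈ N' ↔ (e ∈ M' ∧ e.2 ∉ X') ∨ (e ∈ M ∧ e.1 ∈ X))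
    (inv : ∀ e ∈ M, (e.1 ∈ X ↔ ((e.2 ∈ S' ∧ e.2 ∈ X') ∨ (e.2 ∉ S' ∧ e.2 ∈ X))))
    (inv' : ∀ e ∈ M', (e.2 ∈ X' ↔ ((e.1 ∈ S ∧ e.1 ∈ X) ∨ (e.1 ∉ S ∧ e.1 ∈ X')))) :
    IsLinking T N ∧ IsLinking T' N' := by
  have facts : ∀ e ∈ M, e.1 ∈ S ∧ e.2 ∈ S ∧ _ := fun e he =>
    ⟨hM.fst_mem e he, hM.snd_mem e he, inv e he⟩
  have facts' : ∀ e ∈ M', e.1 ∈ S' ∧ e.2 ∈ S' ∧ _ := fun e he =>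
    ⟨hM'.fst_mem e he, hM'.snd_mem e he, inv' e he⟩
  constructor
  · refine ⟨?_, ?_, ?_, ?_, ?_⟩
    · intro e he
      rw [memN] at he; rw [memT]
      rcases he with ⟨he, hx⟩ | ⟨he, hx⟩
      · exact Or.inl ⟨hM.fst_mem _ he, Or.inr hx⟩
      · have := facts' e he; clear * - this hx; tauto
    · intro e he
      rw [memN] at he; rw [memT]
      rcases he with ⟨he, hx⟩ | ⟨he, hx⟩
      · have := facts e he; clear * - this hx; tauto
      · have := facts' e he; clear * - this hx; tauto
    · intro e he
      rw [memN] at he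
      rcases he with ⟨he, hx⟩ | ⟨he, hx⟩
      · exact hM.lt e he
      · exact hM'.lt e he
    · intro e he e' he' hee
      rw [memN] at he he'
      rcases he with ⟨he, hx⟩ | ⟨he, hx⟩ <;> rcases he' with ⟨he', hx'⟩ | ⟨he', hx'⟩
      · exact hM.inj_fst _ he _ he' hee
      · have h1 := facts e he; have h2 := facts' e' he'; rw [← hee] at h2; clear * - h1 h2 hx hx'; tauto
      · have h1 := facts e' he'; have h2 := facts' e he; rw [hee] at h2; clear * - h1 h2 hx hx'; tauto
      · exact hM'.inj_fst _ he _ he' hee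
    · intro e he e' he' hee
      rw [memN] at he he'
      rcases he with ⟨he, hx⟩ | ⟨he, hx⟩ <;> rcases he' with ⟨he', hx'⟩ | ⟨he', hx'⟩
      · exact hM.inj_snd _ he _ he' hee
      · have h1 := facts e he; have h2 := facts' e' he'; rw [← hee] at h2 hx'; clear * - h1 h2 hx hx'; tauto
      · have h1 := facts e' he'; have h2 := facts' e he; rw [hee] at h2 hx; clear * - h1 h2 hx hx'; tauto
      · exact hM'.inj_snd _ he _ he' hee
  · refine ⟨?_, ?_, ?_, ?_, ?_⟩
    · intro e he
      rw [memN'] at he; rw [memT']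
      rcases he with ⟨he, hx⟩ | ⟨he, hx⟩
      · have := facts' e he; clear * - this hx; tauto
      · have := facts e he; clear * - this hx; tauto
    · intro e he
      rw [memN'] at he; rw [memT']
      rcases he with ⟨he, hx⟩ | ⟨he, hx⟩
      · have := facts' e he; clear * - this hx; tauto
      · have := facts e he; clear * - this hx; tauto
    · intro e he
      rw [memN'] at he
      rcases he with ⟨he, hx⟩ | ⟨he, hx⟩
      · exact hM'.lt e he
      · exact hM.lt e he
    · intro e he e' he' hee
      rw [memN'] at he he'
      rcases he with ⟨he, hx⟩ | ⟨he, hx⟩ <;> rcases he' with ⟨he', hx'⟩ | ⟨he', hx'⟩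
      · exact hM'.inj_fst _ he _ he' hee
      · have h1 := facts e' he'; have h2 := facts' e he; rw [hee] at h2; clear * - h1 h2 hx hx'; tauto
      · have h1 := facts e he; have h2 := facts' e' he'; rw [← hee] at h2; clear * - h1 h2 hx hx'; tauto
      · exact hM.inj_fst _ he _ he' hee
    · intro e he e' he' hee
      rw [memN'] at he he'
      rcases he with ⟨he, hx⟩ | ⟨he, hx⟩ <;> rcases he' with ⟨he', hx'⟩ | ⟨he', hx'⟩
      · exact hM'.inj_snd _ he _ he' hee
      · have h1 := facts e' he'; have h2 := facts' e he; rw [hee] at h2 hx; clear * - h1 h2 hx hx'; tauto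
      · have h1 := facts e he; have h2 := facts' e' he'; rw [← hee] at h2 hx'; clear * - h1 h2 hx hx'; tauto
      · exact hM.inj_snd _ he _ he' hee

/-- The trade follows one alternating path starting at `a`, so only its other end can alter the
number of chains. The number for the first set changes by `|X ∩ S'| - |X' ∩ S| - 1`, which is 0 or
-1, and the second set compensates because the totals of points and of links are unchanged. -/
theorem IsLinking.card_redivide [DecidableEq P] {S S' T T' X X' : Finset P} {M M' N N' : Finset (P × P)} {a : P}
    (hM : IsLinking S M) (hM' : IsLinking S' M')
    (memT : ∀ w, w ∈ T ↔ (w ∈ S ∧ (w ∈ S' ∨ w ∉ X)) ∨ (w ∈ S' ∧ w ∉ S ∧ w ∈ X'))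
    (hN : N = (M.filter fun e => e.1 ∉ X) ∪ (M'.filter fun e => e.2 ∈ X'))
    (hN' : N' = (M'.filter fun e => e.2 ∉ X') ∪ (M.filter fun e => e.1 ∈ X))
    (hunion : T ∪ T' = S ∪ S') (hinter : T ∩ T' = S ∩ S') (hXS : X ⊆ S) (hXS' : X' ⊆ S')
    (haX : a ∈ X) (hsa : ∀ e ∈ M, e.1 ≠ a)
    (genX : ∀ w ∈ X, w = a ∨ ∃ z, (w, z) ∈ M ∧ ((z ∉ S' ∧ z ∈ X) ∨ (z ∈ S ∧ z ∈ X')))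
    (genX' : ∀ w ∈ X', ∃ z, (z, w) ∈ M' ∧ ((z ∈ S' ∧ z ∈ X) ∨ (z ∉ S ∧ z ∈ X')))
    (facts : ∀ e ∈ M, e.1 ∈ S ∧ e.2 ∈ S ∧
      (e.1 ∈ X ↔ ((e.2 ∈ S' ∧ e.2 ∈ X') ∨ (e.2 ∉ S' ∧ e.2 ∈ X))))
    (facts' : ∀ e ∈ M', e.1 ∈ S' ∧ e.2 ∈ S' ∧
      (e.2 ∈ X' ↔ ((e.1 ∈ S ∧ e.1 ∈ X) ∨ (e.1 ∉ S ∧ e.1 ∈ X')))) :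
    (T.card + M.card = S.card + N.card ∧ T'.card + M'.card = S'.card + N'.card) ∨
      (T.card + M.card + 1 = S.card + N.card ∧
        T'.card + M'.card = S'.card + N'.card + 1) := by
  have sX : ∀ w, w ∈ X → w ∈ S := fun w hw => hXS hw
  have sX' : ∀ w, w ∈ X' → w ∈ S' := fun w hw => hXS' hw
  have cT : T.card + (X \ S').card = S.card + (X' \ S).card := by
    have e1 : T.card = (S \ (X \ S')).card + (X' \ S).card := by
      rw [← Finset.card_union_of_disjoint]
      · congr 1
        ext w
        have := sX w; have := sX' w
        clear facts facts' genX genX'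
        simp only [memT, Finset.mem_union, Finset.mem_sdiff]; tauto
      · rw [Finset.disjoint_left]
        intro w hw hw'
        simp only [Finset.mem_sdiff] at hw hw'
        tauto
    have e2 := Finset.card_sdiff_add_card_eq_card (Finset.sdiff_subset.trans hXS : X \ S' ⊆ S)
    omega
  have cTT : T.card + T'.card = S.card + S'.card := by
    rw [← Finset.card_union_add_card_inter, hunion, hinter, Finset.card_union_add_card_inter]
  have cX : (M.filter fun e => e.1 ∈ X).card + 1 = X.card := by
    have : (M.filter fun e => e.1 ∈ X).card = (X.erase a).card := by
      refine Finset.card_bij (fun e _ => e.1) ?_ ?_ ?_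
      · intro e he
        obtain ⟨he, hx⟩ := Finset.mem_filter.1 he
        exact Finset.mem_erase.2 ⟨hsa e he, hx⟩
      · intro e he e' he' hee
        exact hM.inj_fst _ (Finset.mem_filter.1 he).1 _ (Finset.mem_filter.1 he').1 hee
      · intro w hw
        obtain ⟨hwa, hw⟩ := Finset.mem_erase.1 hw
        rcases genX w hw with h | ⟨z, hz, -⟩
        · exact absurd h hwa
        · exact ⟨(w, z), Finset.mem_filter.2 ⟨hz, hw⟩, rfl⟩
    rw [this, Finset.card_erase_add_one haX]
  have cX' : (M'.filter fun e => e.2 ∈ X').card = X'.card := by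
    refine Finset.card_bij (fun e _ => e.2) ?_ ?_ ?_
    · intro e he
      exact (Finset.mem_filter.1 he).2
    · intro e he e' he' hee
      exact hM'.inj_snd _ (Finset.mem_filter.1 he).1 _ (Finset.mem_filter.1 he').1 hee
    · intro w hw
      obtain ⟨z, hz, -⟩ := genX' w hw
      exact ⟨(z, w), Finset.mem_filter.2 ⟨hz, hw⟩, rfl⟩
  have cN : N.card + (M.filter fun e => e.1 ∈ X).card
      = M.card + (M'.filter fun e => e.2 ∈ X').card := by
    have e1 : N.card = (M.filter fun e => e.1 ∉ X).card + (M'.filter fun e => e.2 ∈ X').card := by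
      rw [hN, Finset.card_union_of_disjoint]
      rw [Finset.disjoint_left]
      intro e he he'
      rw [Finset.mem_filter] at he he'
      have := facts e he.1; have := facts' e he'.1
      tauto
    have e2 := Finset.card_filter_add_card_filter_not (s := M) (fun e => e.1 ∈ X)
    omega
  have cN' : N'.card + (M'.filter fun e => e.2 ∈ X').card
      = M'.card + (M.filter fun e => e.1 ∈ X).card := by
    have e1 : N'.card = (M'.filter fun e => e.2 ∉ X').card + (M.filter fun e => e.1 ∈ X).card := by
      rw [hN', Finset.card_union_of_disjoint]
      rw [Finset.disjoint_left]
      intro e he he'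
      rw [Finset.mem_filter] at he he'
      have := facts e he'.1; have := facts' e he.1
      tauto
    have e2 := Finset.card_filter_add_card_filter_not (s := M') (fun e => e.2 ∈ X')
    omega
  -- Counting traded links of `M'` by their lower ends gives `|X' ∩ S| ≤ |X ∩ S'|`; counting those
  -- of `M` by their upper ends gives `|X ∩ S'| ≤ |X' ∩ S| + 1` in `b2`.
  have b1 : X'.card ≤ (X ∩ S').card + (X' \ S).card := by
    rw [← cX']
    refine le_trans (Finset.card_le_card_of_injOn (t := (X ∩ S') ∪ (X' \ S)) Prod.fst ?_ ?_)
      (Finset.card_union_le _ _)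
    · intro e he
      obtain ⟨he, hx⟩ := Finset.mem_filter.1 he
      have := facts' e he
      simp only [Finset.coe_union, Set.mem_union, Finset.mem_coe, Finset.mem_inter,
        Finset.mem_sdiff]
      tauto
    · intro e he e' he' hee
      exact hM'.inj_fst _ (Finset.mem_filter.1 he).1 _ (Finset.mem_filter.1 he').1 hee
  have b2 : (M.filter fun e => e.1 ∈ X).card ≤ (X \ S').card + (X' ∩ S).card := by
    refine le_trans (Finset.card_le_card_of_injOn (t := (X \ S') ∪ (X' ∩ S)) Prod.snd ?_ ?_)
      (Finset.card_union_le _ _)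
    · intro e he
      obtain ⟨he, hx⟩ := Finset.mem_filter.1 he
      have := facts e he
      simp only [Finset.coe_union, Set.mem_union, Finset.mem_coe, Finset.mem_inter,
        Finset.mem_sdiff]
      tauto
    · intro e he e' he' hee
      exact hM.inj_snd _ (Finset.mem_filter.1 he).1 _ (Finset.mem_filter.1 he').1 hee
  have d1 := Finset.card_sdiff_add_card_inter X S'
  have d2 := Finset.card_sdiff_add_card_inter X' S
  omega

/-- Two linked sets can be re-divided so that two final points `a`, `b` of the first one are
separated. -/
theorem exists_exchange [DecidableEq P] {S S' : Finset P} {M M' : Finset (P × P)} (hM : IsLinking S M)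
    (hM' : IsLinking S' M') {a b : P} (haS : a ∈ S) (haS' : a ∉ S') (hbS : b ∈ S) (hab : a ≠ b)
    (hsa : ∀ e ∈ M, e.1 ≠ a) (hsb : ∀ e ∈ M, e.1 ≠ b) :
    ∃ (T T' : Finset P) (N N' : Finset (P × P)), IsLinking T N ∧ IsLinking T' N' ∧
      T ∪ T' = S ∪ S' ∧ T ∩ T' = S ∩ S' ∧ a ∉ T ∧ b ∈ T ∧ (b ∉ S' → b ∉ T') ∧
      ((T.card + M.card = S.card + N.card ∧ T'.card + M'.card = S'.card + N'.card) ∨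
       (T.card + M.card + 1 = S.card + N.card ∧
        T'.card + M'.card = S'.card + N'.card + 1)) := by
  classical
  -- This records the last step by which a point was reached. As links are injective, the rules of
  -- `Switched` then become equivalences along links.
  have gen : ∀ c w, Switched S S' M M' a c w →
      (c = true → w ∈ S ∧ (w = a ∨ ∃ z, (w, z) ∈ M ∧
        ((z ∉ S' ∧ Switched S S' M M' a true z) ∨ (z ∈ S ∧ Switched S S' M M' a false z)))) ∧
      (c = false → w ∈ S' ∧ ∃ z, (z, w) ∈ M' ∧
        ((z ∈ S' ∧ z ∈ S ∧ Switched S S' M M' a true z) ∨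
          (z ∉ S ∧ Switched S S' M M' a false z))) := by
    intro c w h
    induction h with
    | base => simp [haS]
    | @out_double v w hv hvS' hvw ih =>
      simp only [Bool.false_eq_true, false_imp_iff, true_and, true_imp_iff]
      exact ⟨hM'.snd_mem _ hvw, v, hvw, Or.inl ⟨hvS', (ih.1 rfl).1, hv⟩⟩
    | @out_simple v w hw hwS' hvw ih =>
      simp only [Bool.true_eq_false, false_imp_iff, and_true, true_imp_iff]
      exact ⟨hM.fst_mem _ hvw, Or.inr ⟨w, hvw, Or.inl ⟨hwS', hw⟩⟩⟩
    | @in_double v w hw hwS hvw ih =>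
      simp only [Bool.true_eq_false, false_imp_iff, and_true, true_imp_iff]
      exact ⟨hM.fst_mem _ hvw, Or.inr ⟨w, hvw, Or.inr ⟨hwS, hw⟩⟩⟩
    | @in_simple v w hv hvS hvw ih =>
      simp only [Bool.false_eq_true, false_imp_iff, true_and, true_imp_iff]
      exact ⟨hM'.snd_mem _ hvw, v, hvw, Or.inr ⟨hvS, hv⟩⟩
  set X := S.filter (Switched S S' M M' a true) with hX
  set X' := S'.filter (Switched S S' M M' a false) with hX'
  have memX : ∀ w, w ∈ X ↔ Switched S S' M M' a true w := fun w =>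
    ⟨fun h => (Finset.mem_filter.1 h).2, fun h => Finset.mem_filter.2 ⟨((gen _ _ h).1 rfl).1, h⟩⟩
  have memX' : ∀ w, w ∈ X' ↔ Switched S S' M M' a false w := fun w =>
    ⟨fun h => (Finset.mem_filter.1 h).2, fun h => Finset.mem_filter.2 ⟨((gen _ _ h).2 rfl).1, h⟩⟩
  have hXS : X ⊆ S := Finset.filter_subset _ _
  have hXS' : X' ⊆ S' := Finset.filter_subset _ _
  have haX : a ∈ X := (memX a).2 .base
  clear_value X X'
  have genX : ∀ w ∈ X, w = a ∨ ∃ z, (w, z) ∈ M ∧ ((z ∉ S' ∧ z ∈ X) ∨ (z ∈ S ∧ z ∈ X')) := by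
    intro w hw
    simpa only [memX, memX'] using ((gen _ _ ((memX w).1 hw)).1 rfl).2
  have genX' : ∀ w ∈ X', ∃ z, (z, w) ∈ M' ∧ ((z ∈ S' ∧ z ∈ X) ∨ (z ∉ S ∧ z ∈ X')) := by
    intro w hw
    obtain ⟨z, hz, h⟩ := ((gen _ _ ((memX' w).1 hw)).2 rfl).2
    refine ⟨z, hz, ?_⟩
    rw [memX, memX']
    tauto
  -- Every point of `X` other than `a` was reached through its outgoing link in `M`, and `b` has
  -- none.
  have hbX : b ∉ X := by
    intro hb
    rcases genX b hb with h | ⟨z, hz, -⟩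
    · exact hab h.symm
    · exact hsb _ hz rfl
  have inv : ∀ e ∈ M, (e.1 ∈ X ↔ ((e.2 ∈ S' ∧ e.2 ∈ X') ∨ (e.2 ∉ S' ∧ e.2 ∈ X))) := by
    rintro ⟨v, w⟩ he
    constructor
    · intro hv
      rcases genX v hv with h | ⟨z, hz, h⟩
      · exact absurd h (hsa _ he)
      · obtain rfl : w = z := congrArg Prod.snd (hM.inj_fst _ he _ hz rfl)
        rcases h with h | h
        · exact Or.inr h
        · exact Or.inl ⟨hXS' h.2, h.2⟩
    · rintro (h | h)
      · exact (memX v).2 (.in_double ((memX' w).1 h.2) (hM.snd_mem _ he) he)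
      · exact (memX v).2 (.out_simple ((memX w).1 h.2) h.1 he)
  have inv' : ∀ e ∈ M', (e.2 ∈ X' ↔ ((e.1 ∈ S ∧ e.1 ∈ X) ∨ (e.1 ∉ S ∧ e.1 ∈ X'))) := by
    rintro ⟨v, w⟩ he
    constructor
    · intro hw
      obtain ⟨z, hz, h⟩ := genX' w hw
      obtain rfl : v = z := congrArg Prod.fst (hM'.inj_snd _ he _ hz rfl)
      rcases h with h | h
      · exact Or.inl ⟨hXS h.2, h.2⟩
      · exact Or.inr h
    · rintro (h | h)
      · exact (memX' w).2 (.out_double ((memX v).1 h.2) (hM'.fst_mem _ he) he)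
      · exact (memX' w).2 (.in_simple ((memX' v).1 h.2) h.1 he)
  obtain ⟨T, hT⟩ : ∃ U, U = (S.filter fun w => w ∈ S' ∨ w ∉ X) ∪ (S'.filter fun w => w ∉ S ∧ w ∈ X') := ⟨_, rfl⟩
  obtain ⟨T', hT'⟩ : ∃ U, U = (S'.filter fun w => w ∈ S ∨ w ∉ X') ∪ (S.filter fun w => w ∉ S' ∧ w ∈ X) := ⟨_, rfl⟩
  obtain ⟨N, hN⟩ : ∃ U, U = (M.filter fun e => e.1 ∉ X) ∪ (M'.filter fun e => e.2 ∈ X') := ⟨_, rfl⟩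
  obtain ⟨N', hN'⟩ : ∃ U, U = (M'.filter fun e => e.2 ∉ X') ∪ (M.filter fun e => e.1 ∈ X) := ⟨_, rfl⟩
  have memT : ∀ w, w ∈ T ↔ (w ∈ S ∧ (w ∈ S' ∨ w ∉ X)) ∨ (w ∈ S' ∧ w ∉ S ∧ w ∈ X') := by
    intro w; simp [hT]
  have memT' : ∀ w, w ∈ T' ↔ (w ∈ S' ∧ (w ∈ S ∨ w ∉ X')) ∨ (w ∈ S ∧ w ∉ S' ∧ w ∈ X) := by
    intro w; simp [hT']
  have memN : ∀ e, e ∈ N ↔ (e ∈ M ∧ e.1 ∉ X) ∨ (e ∈ M' ∧ e.2 ∈ X') := by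
    intro w; simp [hN]
  have memN' : ∀ e, e ∈ N' ↔ (e ∈ M' ∧ e.2 ∉ X') ∨ (e ∈ M ∧ e.1 ∈ X) := by
    intro w; simp [hN']
  have facts : ∀ e ∈ M, e.1 ∈ S ∧ e.2 ∈ S ∧ _ := fun e he =>
    ⟨hM.fst_mem e he, hM.snd_mem e he, inv e he⟩
  have facts' : ∀ e ∈ M', e.1 ∈ S' ∧ e.2 ∈ S' ∧ _ := fun e he =>
    ⟨hM'.fst_mem e he, hM'.snd_mem e he, inv' e he⟩
  have sX : ∀ w, w ∈ X → w ∈ S := fun w hw => hXS hw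
  have sX' : ∀ w, w ∈ X' → w ∈ S' := fun w hw => hXS' hw
  obtain ⟨hlN, hlN'⟩ : IsLinking T N ∧ IsLinking T' N' :=
    hM.redivide hM' memT memT' memN memN' inv inv'
  have hunion : T ∪ T' = S ∪ S' := by
    ext w
    have h1 := sX w; have h2 := sX' w
    rw [Finset.mem_union, Finset.mem_union, memT, memT']; clear * - h1 h2; tauto
  have hinter : T ∩ T' = S ∩ S' := by
    ext w
    have h1 := sX w; have h2 := sX' w
    rw [Finset.mem_inter, Finset.mem_inter, memT, memT']; clear * - h1 h2; tauto
  refine ⟨T, T', N, N', hlN, hlN', hunion, hinter, ?_, ?_, ?_, ?_⟩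
  · rw [memT]; clear * - haX haS'; tauto
  · rw [memT]; clear * - hbS hbX; tauto
  · rw [memT']; clear * - hbX; tauto
  · exact hM.card_redivide hM' memT hN hN' hunion hinter hXS hXS' haX hsa genX genX' facts facts'

end Linking

end LPP


/-! ### Sets of bounded width, and Dilworth's theorem in the quadrant -/

namespace LPP

/-- Every antichain in `S` has at most `k` elements. -/
def Width (k : ℕ) (S : Finset (ℕ × ℕ)) : Prop :=
  ∀ A ⊆ S, IsAntichain (· ≤ ·) (A : Set (ℕ × ℕ)) → A.card ≤ k

theorem Width.mono {k : ℕ} {S S' : Finset (ℕ × ℕ)} (h : Width k S) (hS : S' ⊆ S) : Width k S' :=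
  fun A hA => h A (hA.trans hS)

theorem width_empty (k : ℕ) : Width k ∅ := fun A hA _ => by
  simp [Finset.subset_empty.1 hA]

theorem width_of_coloring {S : Finset (ℕ × ℕ)} {k : ℕ} (r : ℕ × ℕ → ℕ) (hr : ∀ w ∈ S, r w < k)
    (hc : ∀ w ∈ S, ∀ w' ∈ S, r w = r w' → w ≤ w' ∨ w' ≤ w) : Width k S := by
  intro A hA hAc
  rw [← Finset.card_range k]
  refine Finset.card_le_card_of_injOn r (fun w hw => by simpa using hr w (hA hw)) ?_
  intro w hw w' hw' hrr
  by_contra hne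
  rcases hc w (hA hw) w' (hA hw') hrr with h | h
  · exact hAc hw hw' hne h
  · exact hAc hw' hw (Ne.symm hne) h

section Height

variable (T T' : Finset (ℕ × ℕ))

open Classical in
/-- The maximal size, counted with multiplicity in `T` and `T'`, of an antichain in the quadrant
above and to the left of `(c, j)`. -/
noncomputable def height (c j : ℕ) : ℕ :=
  (((T ∪ T').filter fun w => w.1 < c ∧ j ≤ w.2).powerset.filter
    fun A : Finset (ℕ × ℕ) => IsAntichain (· ≤ ·) (A : Set (ℕ × ℕ))).sup fun A => (A ∩ T).card + (A ∩ T').card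

variable {T T'}

theorem le_height {c j : ℕ} {A : Finset (ℕ × ℕ)} (hA : A ⊆ T ∪ T')
    (hc : ∀ w ∈ A, w.1 < c ∧ j ≤ w.2) (h : IsAntichain (· ≤ ·) (A : Set (ℕ × ℕ))) :
    (A ∩ T).card + (A ∩ T').card ≤ height T T' c j := by
  classical
  refine Finset.le_sup (f := fun A : Finset (ℕ × ℕ) => (A ∩ T).card + (A ∩ T').card) ?_
  simp only [Finset.mem_filter, Finset.mem_powerset]
  exact ⟨fun w hw => Finset.mem_filter.2 ⟨hA hw, hc w hw⟩, h⟩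

variable (T T') in
theorem exists_height_eq (c j : ℕ) : ∃ A ⊆ T ∪ T', (∀ w ∈ A, w.1 < c ∧ j ≤ w.2) ∧
    IsAntichain (· ≤ ·) (A : Set (ℕ × ℕ)) ∧ height T T' c j = (A ∩ T).card + (A ∩ T').card := by
  classical
  obtain ⟨A, hA, h⟩ := Finset.exists_mem_eq_sup
    (((T ∪ T').filter fun w => w.1 < c ∧ j ≤ w.2).powerset.filter
      fun A : Finset (ℕ × ℕ) => IsAntichain (· ≤ ·) (A : Set (ℕ × ℕ))) ⟨∅, by simp⟩
    fun A => (A ∩ T).card + (A ∩ T').card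
  simp only [Finset.mem_filter, Finset.mem_powerset] at hA
  refine ⟨A, fun w hw => (Finset.mem_filter.1 (hA.1 hw)).1,
    fun w hw => (Finset.mem_filter.1 (hA.1 hw)).2, hA.2, ?_⟩
  rw [← h, height]

theorem height_mono {c c' j j' : ℕ} (hc : c ≤ c') (hj : j' ≤ j) :
    height T T' c j ≤ height T T' c' j' := by
  obtain ⟨A, hA, hAc, h, e⟩ := exists_height_eq T T' c j
  rw [e]
  exact le_height hA (fun w hw => ⟨(hAc w hw).1.trans_le hc, hj.trans (hAc w hw).2⟩) h

theorem height_le {p q : ℕ} (hT : Width p T) (hT' : Width q T') (c j : ℕ) :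
    height T T' c j ≤ p + q := by
  obtain ⟨A, hA, hAc, h, e⟩ := exists_height_eq T T' c j
  rw [e]
  exact add_le_add (hT _ Finset.inter_subset_right (h.subset (by simp)))
    (hT' _ Finset.inter_subset_right (h.subset (by simp)))

theorem height_eq_zero {c j : ℕ} (h : ∀ w ∈ T ∪ T', w.1 < c → w.2 < j) : height T T' c j = 0 := by
  obtain ⟨A, hA, hAc, -, e⟩ := exists_height_eq T T' c j
  have : A = ∅ := Finset.eq_empty_of_forall_notMem fun w hw =>
    absurd (h w (hA hw) (hAc w hw).1) (hAc w hw).2.not_gt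
  rw [e, this]; simp

/-- Any antichain strictly above and to the left of `w` remains one when `w` is added, and `w`
counts with its multiplicity. -/
theorem height_add_le {w : ℕ × ℕ} (hw : w ∈ T ∪ T') :
    height T T' w.1 (w.2 + 1) + ((if w ∈ T then 1 else 0) + if w ∈ T' then 1 else 0) ≤
      height T T' (w.1 + 1) w.2 := by
  obtain ⟨A, hA, hAc, h, e⟩ := exists_height_eq T T' w.1 (w.2 + 1)
  have hwA : w ∉ A := fun hwA => absurd (hAc w hwA).1 (lt_irrefl _)
  have hle := le_height (T := T) (T' := T') (c := w.1 + 1) (j := w.2) (A := insert w A)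
    (Finset.insert_subset hw hA) ?_ ?_
  · refine le_trans ?_ hle
    rw [e]
    have hcard : ∀ U : Finset (ℕ × ℕ),
        (A ∩ U).card + (if w ∈ U then 1 else 0) = (insert w A ∩ U).card := by
      intro U
      split_ifs with hU
      · rw [Finset.insert_inter_of_mem hU, Finset.card_insert_of_notMem (by simp [hwA])]
      · rw [Finset.insert_inter_of_notMem hU, add_zero]
    have h1 := hcard T
    have h2 := hcard T'
    omega
  · intro z hz
    rcases Finset.mem_insert.1 hz with rfl | hz
    · exact ⟨by omega, le_rfl⟩
    · have := hAc z hz; omega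
  · rw [Finset.coe_insert]
    refine h.insert ?_ ?_
    · intro z hz _ hle
      have := hAc z hz
      have := Prod.le_def.1 hle
      omega
    · intro z hz _ hle
      have := hAc z hz
      have := Prod.le_def.1 hle
      omega

/-- The two quadrants differ by an L-shaped hook with corner `(c, j)`. The hook is a chain, so an
antichain has at most one point in it. -/
theorem height_succ_le (S : Finset (ℕ × ℕ)) (c j : ℕ) :
    height S ∅ (c + 1) j ≤ height S ∅ c (j + 1) + 1 := by
  obtain ⟨A, hA, hAc, h, e⟩ := exists_height_eq S ∅ (c + 1) j
  have h1 : ((A.filter fun w => w.1 < c ∧ j + 1 ≤ w.2) ∩ S).card ≤ height S ∅ c (j + 1) := by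
    refine le_trans (Nat.le_add_right _ _) (le_height (T := S) (T' := ∅)
      ((Finset.filter_subset _ _).trans hA) (fun w hw => (Finset.mem_filter.1 hw).2)
      (h.subset (Finset.coe_subset.2 (Finset.filter_subset _ _))))
  have h2 : (A.filter fun w => ¬ (w.1 < c ∧ j + 1 ≤ w.2)).card ≤ 1 := by
    refine Finset.card_le_one.2 fun w hw z hz => ?_
    obtain ⟨hw, hw'⟩ := Finset.mem_filter.1 hw
    obtain ⟨hz, hz'⟩ := Finset.mem_filter.1 hz
    by_contra hne
    have n1 := h hw hz hne
    have n2 := h hz hw (Ne.symm hne)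
    have := hAc w hw
    have := hAc z hz
    simp only [Pi.compl_apply, compl_iff_not, Prod.le_def] at n1 n2
    omega
  have h3 := Finset.card_filter_add_card_filter_not (s := A) (fun w => w.1 < c ∧ j + 1 ≤ w.2)
  have hAS : A ⊆ S := by simpa using hA
  rw [Finset.inter_eq_left.2 ((Finset.filter_subset _ _).trans hAS)] at h1
  rw [e, Finset.inter_eq_left.2 hAS]
  simp only [Finset.inter_empty, Finset.card_empty]
  omega

end Height

/-- The colouring of a set of width `k` by `k` chains. -/
theorem Width.exists_coloring {k : ℕ} {S : Finset (ℕ × ℕ)} (h : Width k S) :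
    ∃ r : ℕ × ℕ → ℕ, (∀ w ∈ S, r w < k) ∧
      ∀ w ∈ S, ∀ w' ∈ S, r w = r w' → w ≤ w' ∨ w' ≤ w := by
  have key : ∀ w ∈ S, height S ∅ w.1 (w.2 + 1) + 1 ≤ height S ∅ (w.1 + 1) w.2 := fun w hw => by
    simpa [hw] using height_add_le (T := S) (T' := ∅) (w := w) (by simpa using hw)
  -- Mirsky's argument for the order "strictly above and to the left", in which incomparable means
  -- comparable for `≤`: the colour is the size of the largest antichain beyond the point.
  refine ⟨fun w => height S ∅ w.1 (w.2 + 1), fun w hw => ?_, fun w hw w' hw' hr => ?_⟩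
  · have := height_le h (width_empty 0) (w.1 + 1) w.2
    have := key w hw
    simp only
    omega
  · simp only at hr
    by_contra hcon
    simp only [not_or, Prod.le_def, not_and_or, not_le] at hcon
    have h1 := key w hw
    have h2 := key w' hw'
    rcases (by omega : (w.1 < w'.1 ∧ w'.2 < w.2) ∨ (w'.1 < w.1 ∧ w.2 < w'.2)) with hlt | hlt
    · have := height_mono (T := S) (T' := ∅) (c := w.1 + 1) (c' := w'.1) (j := w.2)
        (j' := w'.2 + 1) (by omega) (by omega)
      omega
    · have := height_mono (T := S) (T' := ∅) (c := w'.1 + 1) (c' := w.1) (j := w'.2)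
        (j' := w.2 + 1) (by omega) (by omega)
      omega

theorem Step.lt {v w : ℕ × ℕ} (h : Step v w) : v < w := by
  rcases h with rfl | rfl
  · exact Prod.lt_iff.2 (Or.inl ⟨by simp, by simp⟩)
  · exact Prod.lt_iff.2 (Or.inr ⟨by simp, by simp⟩)

theorem Step.sum_eq {v w : ℕ × ℕ} (h : Step v w) : w.1 + w.2 = v.1 + v.2 + 1 := by
  rcases h with rfl | rfl <;> simp <;> omega

/-- A finite chain in which each non-maximal point has a successor one step away is a path. -/
theorem isPath_of_chain : ∀ (m : ℕ) (Q : Finset (ℕ × ℕ)), Q.card = m →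
    (∀ w ∈ Q, ∀ w' ∈ Q, w ≤ w' ∨ w' ≤ w) →
    (∀ w ∈ Q, (∃ w' ∈ Q, Step w w') ∨ ∀ w' ∈ Q, w' ≤ w) →
    ∃ s : List (ℕ × ℕ), s.IsChain Step ∧ s.toFinset = Q ∧ ∀ h ∈ s.head?, ∀ w ∈ Q, h ≤ w := by
  intro m
  induction m with
  | zero =>
    intro Q hQ _ _
    exact ⟨[], by simp, by simp [Finset.card_eq_zero.1 hQ], by simp⟩
  | succ m ih =>
    intro Q hQ hc hs
    obtain ⟨v, hv, hmin⟩ := Q.exists_minimal (Finset.card_pos.1 (by omega))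
    have hleast : ∀ w ∈ Q, v ≤ w := fun w hw => (hc v hv w hw).elim id fun h => hmin hw h
    obtain ⟨s, h1, h2, h3⟩ := ih (Q.erase v) (by rw [Finset.card_erase_of_mem hv]; omega)
      (fun w hw w' hw' => hc w (Finset.mem_of_mem_erase hw) w' (Finset.mem_of_mem_erase hw'))
      (by
        intro w hw
        obtain ⟨hwv, hw⟩ := Finset.mem_erase.1 hw
        rcases hs w hw with ⟨w', hw', hst⟩ | h
        · refine Or.inl ⟨w', Finset.mem_erase.2 ⟨?_, hw'⟩, hst⟩
          rintro rfl
          exact absurd (hleast w ‹_›) hst.lt.not_ge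
        · exact Or.inr fun w' hw' => h w' (Finset.mem_of_mem_erase hw'))
    refine ⟨v :: s, ?_, ?_, ?_⟩
    · rw [List.isChain_cons]
      refine ⟨fun y hy => ?_, h1⟩
      have hyQ : y ∈ Q.erase v := by
        rw [← h2, List.mem_toFinset]
        exact List.mem_of_mem_head? hy
      obtain ⟨hyv, hyQ'⟩ := Finset.mem_erase.1 hyQ
      rcases hs v hv with ⟨w, hw, hst⟩ | h
      · have hyw := h3 y hy w (Finset.mem_erase.2 ⟨hst.lt.ne', hw⟩)
        have hvy := lt_of_le_of_ne (hleast y hyQ') (Ne.symm hyv)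
        have e := hst.sum_eq
        have a1 := Prod.le_def.1 hyw
        have a2 := Prod.lt_iff.1 hvy
        have : y = w := Prod.ext (by omega) (by omega)
        rwa [this]
      · exact absurd (le_antisymm (h y hyQ') (hleast y hyQ')) hyv
    · rw [List.toFinset_cons, h2, Finset.insert_erase hv]
    · simpa using fun a b h => hleast (a, b) h

/-- A set of width `k` in a rectangle is covered by `k` disjoint increasing paths. -/
theorem Width.exists_disjointPaths {k a b : ℕ} {S : Finset (ℕ × ℕ)} (h : Width k S)
    (hS : S ⊆ Finset.range (a + 1) ×ˢ Finset.range (b + 1)) :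
    ∃ γ ∈ disjointPaths k 0 (a, b), ∀ w ∈ S, ∃ i, w ∈ γ i := by
  classical
  set H := height S ∅ with hH
  have Hmono : ∀ {c c' j j' : ℕ}, c ≤ c' → j' ≤ j → H c j ≤ H c' j' := fun hc hj =>
    height_mono hc hj
  -- The height increases by 0 or 1 across the diagonal of each cell. The cells where it passes from
  -- `i` to `i + 1` follow a level line of the height, and they form the `i`-th path.
  set γ : Fin k → Finset (ℕ × ℕ) := fun i => (Finset.Icc 0 (a, b)).filter fun w =>
    H (w.1 + 1) w.2 = i + 1 ∧ H w.1 (w.2 + 1) = i with hγ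
  have mem : ∀ i w, w ∈ γ i ↔ (w.1 ≤ a ∧ w.2 ≤ b) ∧
      H (w.1 + 1) w.2 = i + 1 ∧ H w.1 (w.2 + 1) = i := by
    intro i w
    simp [hγ, Finset.mem_Icc, Prod.le_def]
  refine ⟨γ, ?_, fun w hw => ?_⟩
  · simp only [disjointPaths, Finset.mem_filter, Fintype.mem_piFinset, Finset.mem_powerset]
    refine ⟨fun i => Finset.filter_subset _ _, fun i => ?_, fun i j hij => ?_⟩
    · have hchain : ∀ w ∈ γ i, ∀ w' ∈ γ i, w ≤ w' ∨ w' ≤ w := by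
        intro w hw w' hw'
        rw [mem] at hw hw'
        by_contra hcon
        simp only [not_or, Prod.le_def, not_and_or, not_le] at hcon
        rcases (by omega : (w.1 < w'.1 ∧ w'.2 < w.2) ∨ (w'.1 < w.1 ∧ w.2 < w'.2)) with hlt | hlt
        · have := Hmono (c := w.1 + 1) (c' := w'.1) (j := w.2) (j' := w'.2 + 1) (by omega)
            (by omega)
          omega
        · have := Hmono (c := w'.1 + 1) (c' := w.1) (j := w'.2) (j' := w.2 + 1) (by omega)
            (by omega)
          omega
      obtain ⟨s, h1, h2, -⟩ := isPath_of_chain _ (γ i) rfl hchain fun w hw => by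
        have hw0 := hw
        rw [mem] at hw
        obtain ⟨⟨ha, hb⟩, e1, e2⟩ := hw
        have m1 := Hmono (c := w.1 + 1) (c' := w.1 + 1 + 1) (j := w.2) (j' := w.2) (by omega) le_rfl
        have s1 := height_succ_le S (w.1 + 1) w.2
        have s2 := height_succ_le S w.1 (w.2 + 1)
        have m2 := Hmono (c := w.1 + 1) (c' := w.1 + 1) (j := w.2 + 1) (j' := w.2) le_rfl (by omega)
        have m3 := Hmono (c := w.1) (c' := w.1) (j := w.2 + 1 + 1) (j' := w.2 + 1) le_rfl (by omega)
        rw [← hH] at s1 s2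
        -- The height at the upper right corner is `i` or `i + 1`. The level line goes up if it is
        -- `i + 1`, and to the right if it is `i`, unless the right edge has been reached.
        by_cases hup : H (w.1 + 1) (w.2 + 1) = i + 1
        · refine Or.inl ⟨w + (0, 1), (mem _ _).2 ⟨⟨by simpa using ha, ?_⟩, ?_, ?_⟩, Or.inr rfl⟩
          · by_contra hlt
            have : H (w.1 + 1) (w.2 + 1) = 0 := height_eq_zero fun z hz _ => by
              have := hS (by simpa using hz)
              simp only [Finset.mem_product, Finset.mem_range] at this
              simp at hlt
              omega
            omega
          · simpa using hup
          · simp only [Prod.fst_add, Prod.snd_add, add_zero]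
            omega
        · by_cases hr : w.1 = a
          · refine Or.inr fun w' hw' => ?_
            rcases hchain w hw0 w' hw' with hle | hle
            · rw [mem] at hw'
              have hle' := Prod.le_def.1 hle
              by_contra hcon
              rw [Prod.le_def, not_and_or, not_le, not_le] at hcon
              have e : w'.1 = w.1 := by omega
              have := Hmono (c := w'.1 + 1) (c' := w.1 + 1) (j := w'.2) (j' := w.2 + 1)
                (by omega) (by omega)
              omega
            · exact hle
          · refine Or.inl ⟨w + (1, 0), (mem _ _).2 ⟨⟨?_, by simpa using hb⟩, ?_, ?_⟩, Or.inl rfl⟩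
            · simp; omega
            · simp only [Prod.fst_add, Prod.snd_add, add_zero]
              omega
            · simp only [Prod.fst_add, Prod.snd_add, add_zero]
              have m4 := Hmono (c := w.1) (c' := w.1 + 1) (j := w.2 + 1) (j' := w.2 + 1) (by omega)
                le_rfl
              omega
      exact ⟨s, h1, h2⟩
    · refine Finset.disjoint_left.2 fun w hi hj => hij ?_
      rw [mem] at hi hj
      exact Fin.ext (by omega)
  · have hwR := hS hw
    simp only [Finset.mem_product, Finset.mem_range] at hwR
    have h1 : H w.1 (w.2 + 1) + 1 ≤ H (w.1 + 1) w.2 := by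
      simpa [hw] using height_add_le (T := S) (T' := ∅) (w := w) (by simpa using hw)
    have h2 := height_le h (width_empty 0) (w.1 + 1) w.2
    have h3 := height_succ_le S w.1 w.2
    rw [← hH] at h2 h3
    exact ⟨⟨H w.1 (w.2 + 1), by omega⟩, (mem _ _).2 ⟨by omega, by simp only; omega, rfl⟩⟩

theorem IsPath.chain {γ : Finset (ℕ × ℕ)} (h : IsPath γ) :
    ∀ w ∈ γ, ∀ w' ∈ γ, w ≤ w' ∨ w' ≤ w := by
  obtain ⟨s, hs, rfl⟩ := h
  have hp : s.Pairwise (· < ·) := by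
    rw [← List.isChain_iff_pairwise]
    exact hs.imp fun _ _ h => h.lt
  intro w hw w' hw'
  rw [List.mem_toFinset] at hw hw'
  have : Std.Symm fun a b : ℕ × ℕ => a ≤ b ∨ b ≤ a := ⟨fun _ _ h => h.symm⟩
  exact List.Pairwise.forall_of_forall (R := fun a b : ℕ × ℕ => a ≤ b ∨ b ≤ a)
    (fun _ _ => Or.inl le_rfl) (hp.imp fun h => Or.inl h.le)
    hw hw'

section Max

variable {R : Type*} [AddCommGroup R] [LinearOrder R]

open Classical in
/-- The maximal weight of a set of width `k` in the rectangle `[0, a) × [0, b)`. -/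
noncomputable def widthMax (x : ℕ × ℕ → R) (k a b : ℕ) : R :=
  ((Finset.range a ×ˢ Finset.range b).powerset.filter (Width k)).sup'
    ⟨∅, by simp [width_empty]⟩ fun S => ∑ w ∈ S, x w

theorem le_widthMax (x : ℕ × ℕ → R) {k a b : ℕ} {S : Finset (ℕ × ℕ)}
    (hS : S ⊆ Finset.range a ×ˢ Finset.range b) (h : Width k S) :
    ∑ w ∈ S, x w ≤ widthMax x k a b := by
  classical
  exact Finset.le_sup' (fun S => ∑ w ∈ S, x w)
    (Finset.mem_filter.2 ⟨Finset.mem_powerset.2 hS, h⟩)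

theorem exists_widthMax_eq (x : ℕ × ℕ → R) (k a b : ℕ) :
    ∃ S ⊆ Finset.range a ×ˢ Finset.range b, Width k S ∧ widthMax x k a b = ∑ w ∈ S, x w := by
  classical
  obtain ⟨S, hS, e⟩ := Finset.exists_mem_eq_sup'
    (⟨∅, by simp [width_empty]⟩ :
      ((Finset.range a ×ˢ Finset.range b).powerset.filter (Width k)).Nonempty)
    fun S => ∑ w ∈ S, x w
  rw [Finset.mem_filter, Finset.mem_powerset] at hS
  exact ⟨S, hS.1, hS.2, e⟩

/-- The union of `k` disjoint paths is coloured by these paths, hence has width at most `k`.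
Conversely a set of width `k` is covered by `k` disjoint paths, and the additional points do not
lower the weight. -/
theorem maxWeight_eq_widthMax [IsOrderedAddMonoid R] {x : ℕ × ℕ → R} (hx : ∀ v, 0 ≤ x v) (k a b : ℕ) :
    maxWeight x k 0 (a, b) = widthMax x k (a + 1) (b + 1) := by
  classical
  apply le_antisymm
  · refine Finset.sup'_le _ _ fun γ hγ => ?_
    simp only [disjointPaths, Finset.mem_filter, Fintype.mem_piFinset, Finset.mem_powerset] at hγ
    obtain ⟨h1, h2, h3⟩ := hγ
    have hsum : ∑ i, pathWeight x (γ i) = ∑ w ∈ Finset.univ.biUnion γ, x w := by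
      rw [Finset.sum_biUnion fun i _ j _ hij => h3 hij]
      rfl
    rw [hsum]
    refine le_widthMax x ?_ ?_
    · intro w hw
      obtain ⟨i, -, hi⟩ := Finset.mem_biUnion.1 hw
      have := h1 i hi
      simp only [Finset.mem_Icc, Prod.le_def] at this
      simp only [Finset.mem_product, Finset.mem_range]
      omega
    · have hex : ∀ w ∈ Finset.univ.biUnion γ, ∃ i, ∃ h : i < k, w ∈ γ ⟨i, h⟩ := fun w hw => by
        obtain ⟨i, -, hi⟩ := Finset.mem_biUnion.1 hw
        exact ⟨i, i.2, hi⟩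
      choose! r hr hrm using hex
      refine width_of_coloring r hr fun w hw w' hw' hrr => ?_
      refine (h2 ⟨r w, hr w hw⟩).chain w (hrm w hw) w' ?_
      simpa only [hrr] using hrm w' hw'
  · obtain ⟨S, hS, hk, e⟩ := exists_widthMax_eq x k (a + 1) (b + 1)
    obtain ⟨γ, hγ, hcov⟩ := hk.exists_disjointPaths hS
    rw [e]
    refine le_trans ?_ (Finset.le_sup' (fun γ : Fin k → _ => ∑ i, pathWeight x (γ i)) hγ)
    have h3 := (Finset.mem_filter.1 hγ).2.2
    have hsum : ∑ i, pathWeight x (γ i) = ∑ w ∈ Finset.univ.biUnion γ, x w := by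
      rw [Finset.sum_biUnion fun i _ j _ hij => h3 hij]
      rfl
    rw [hsum]
    exact Finset.sum_le_sum_of_subset_of_nonneg (fun w hw => by simpa using hcov w hw)
      fun w _ _ => hx w

end Max

end LPP


/-! ### The octahedron recurrence -/

namespace LPP

section Exchange

variable {R : Type*} [AddCommGroup R] [LinearOrder R]

/-- Two sets of total width `2k+1` in the rectangles short of a row and of a column can be
re-divided, together with the corner, into sets of width `k+1` and `k`. -/
theorem add_sum_le_widthMax [IsOrderedAddMonoid R] (x : ℕ × ℕ → R) {p q k a b : ℕ}
    (hpq : p + q = 2 * k + 1) {T T' : Finset (ℕ × ℕ)}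
    (hT : T ⊆ Finset.range (a + 1) ×ˢ Finset.range b)
    (hT' : T' ⊆ Finset.range a ×ˢ Finset.range (b + 1)) (hp : Width p T) (hq : Width q T') :
    x (a, b) + (∑ w ∈ T, x w + ∑ w ∈ T', x w) ≤
      widthMax x (k + 1) (a + 1) (b + 1) + widthMax x k a b := by
  classical
  set h : ℕ × ℕ → ℕ := fun w => height T T' w.1 (w.2 + 1) with hh
  set m : ℕ × ℕ → ℕ := fun w => (if w ∈ T then 1 else 0) + if w ∈ T' then 1 else 0 with hm
  have hTr : ∀ w ∈ T, w.1 ≤ a ∧ w.2 < b := fun w hw => by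
    have := hT hw
    simp only [Finset.mem_product, Finset.mem_range] at this
    omega
  have hTr' : ∀ w ∈ T', w.1 < a ∧ w.2 ≤ b := fun w hw => by
    have := hT' hw
    simp only [Finset.mem_product, Finset.mem_range] at this
    omega
  have hbound : ∀ w ∈ T ∪ T', h w + m w ≤ 2 * k + 1 := fun w hw =>
    (height_add_le hw).trans ((height_le hp hq _ _).trans hpq.le)
  have hstep : ∀ w ∈ T ∪ T', ∀ w', w.1 < w'.1 → w'.2 < w.2 → h w + m w ≤ h w' :=
    fun w hw w' h1 h2 => (height_add_le hw).trans (height_mono (by omega) (by omega))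
  have hm1 : ∀ w ∈ T ∪ T', 1 ≤ m w := fun w hw => by
    rcases Finset.mem_union.1 hw with h | h <;> simp [hm, h]
  have hm2 : ∀ w, w ∈ T → w ∈ T' → m w = 2 := fun w h1 h2 => by simp [hm, h1, h2]
  have incomp : ∀ w w' : ℕ × ℕ, ¬ (w ≤ w' ∨ w' ≤ w) →
      (w.1 < w'.1 ∧ w'.2 < w.2) ∨ (w'.1 < w.1 ∧ w.2 < w'.2) := by
    intro w w' hcon
    simp only [not_or, Prod.le_def, not_and_or, not_le] at hcon
    omega
  set D := (T ∪ T') \ (T ∩ T') with hD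
  have memD : ∀ w ∈ D, w ∈ T ∪ T' := fun w hw => (Finset.mem_sdiff.1 hw).1
  -- Common points go to both sets; the others are sorted by the parity of the height, except that
  -- column `a` is forced into `S₀`. Heights with multiplicity run over `0, …, 2k`, so the even ones
  -- provide `k + 1` chains and the odd ones `k`.
  set S₀ := T ∩ T' ∪ D.filter (fun w => w.1 = a ∨ Even (h w)) with hS₀
  set S' := T ∩ T' ∪ D.filter (fun w => ¬ (w.1 = a ∨ Even (h w))) with hS'
  have hS₀T : ∀ w ∈ S₀, w ∈ T ∪ T' ∧ (w ∈ T ∧ w ∈ T' ∨ w.1 = a ∨ Even (h w)) := by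
    intro w hw
    rcases Finset.mem_union.1 hw with hw | hw
    · rw [Finset.mem_inter] at hw
      exact ⟨Finset.mem_union_left _ hw.1, Or.inl hw⟩
    · obtain ⟨h1, h2⟩ := Finset.mem_filter.1 hw
      exact ⟨memD w h1, Or.inr h2⟩
  have hST' : ∀ w ∈ S', w ∈ T ∪ T' ∧ (w ∈ T ∧ w ∈ T' ∨ ¬ w.1 = a ∧ ¬ Even (h w)) := by
    intro w hw
    rcases Finset.mem_union.1 hw with hw | hw
    · rw [Finset.mem_inter] at hw
      exact ⟨Finset.mem_union_left _ hw.1, Or.inl hw⟩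
    · obtain ⟨h1, h2⟩ := Finset.mem_filter.1 hw
      exact ⟨memD w h1, Or.inr (not_or.1 h2)⟩
  have hcorner : (a, b) ∉ S₀ := by
    intro hc
    rcases Finset.mem_union.1 (hS₀T _ hc).1 with h | h
    · exact absurd (hTr _ h).2 (lt_irrefl _)
    · exact absurd (hTr' _ h).1 (lt_irrefl _)
  have hsum : ∑ w ∈ S₀, x w + ∑ w ∈ S', x w = ∑ w ∈ T, x w + ∑ w ∈ T', x w := by
    have hdisj : ∀ (q : ℕ × ℕ → Prop) [DecidablePred q], Disjoint (T ∩ T') (D.filter q) := fun q _ =>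
      Finset.disjoint_left.2 fun w hw hw' =>
        (Finset.mem_sdiff.1 (Finset.mem_filter.1 hw').1).2 hw
    have e1 := Finset.sum_filter_add_sum_filter_not D (fun w => w.1 = a ∨ Even (h w)) x
    have e2 := Finset.sum_union_inter (s₁ := T) (s₂ := T') (f := x)
    have e3 := Finset.sum_sdiff (f := x)
      (Finset.inter_subset_union : T ∩ T' ⊆ T ∪ T')
    rw [hS₀, hS', Finset.sum_union (hdisj _), Finset.sum_union (hdisj _), ← e2, ← e3, ← e1]
    abel
  have hle1 : ∑ w ∈ insert (a, b) S₀, x w ≤ widthMax x (k + 1) (a + 1) (b + 1) := by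
    -- The whole column `a`, with the corner, takes the last colour `k`. By `last` below, the
    -- remaining points of that colour lie below it, since a point of that colour strictly above and
    -- to the left would push the height past `2k`.
    refine le_widthMax x ?_ (width_of_coloring
      (fun w => if w.1 = a then k else (h w + 1) / 2) ?_ ?_)
    · intro w hw
      rw [Finset.mem_product, Finset.mem_range, Finset.mem_range]
      rcases Finset.mem_insert.1 hw with rfl | hw
      · exact ⟨Nat.lt_succ_self _, Nat.lt_succ_self _⟩
      · rcases Finset.mem_union.1 (hS₀T _ hw).1 with h | h
        · have := hTr _ h; omega
        · have := hTr' _ h; omega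
    · intro w hw
      split_ifs with hwa
      · omega
      · rcases Finset.mem_insert.1 hw with rfl | hw
        · exact absurd rfl hwa
        · obtain ⟨h1, h2⟩ := hS₀T w hw
          have b1 := hbound w h1
          rcases h2 with h2 | h2 | h2
          · have := hm2 w h2.1 h2.2; omega
          · exact absurd h2 hwa
          · have := hm1 w h1
            obtain ⟨c, hc⟩ := h2
            omega
    · have last : ∀ w ∈ insert (a, b) S₀, ∀ w' ∈ insert (a, b) S₀, w.1 = a → w'.1 ≠ a →
          k = (h w' + 1) / 2 → w' ≤ w := by
        intro w hw w' hw' hwa hwa' hr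
        rcases Finset.mem_insert.1 hw' with rfl | hw'
        · exact absurd rfl hwa'
        obtain ⟨h1', h2'⟩ := hS₀T w' hw'
        have hr' : w'.1 < a ∧ w'.2 ≤ b := by
          rcases Finset.mem_union.1 h1' with h | h
          · have := hTr _ h; omega
          · exact hTr' _ h
        by_contra hcon
        rw [Prod.le_def, not_and_or, not_le, not_le] at hcon
        rcases Finset.mem_insert.1 hw with rfl | hw
        · simp at hcon; omega
        obtain ⟨h1, -⟩ := hS₀T w hw
        have := hstep w' h1' w (by omega) (by omega)
        have := hbound w h1
        have := hm1 w h1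
        have := hm1 w' h1'
        rcases h2' with h2' | h2' | h2'
        · have := hm2 w' h2'.1 h2'.2; omega
        · exact hwa' h2'
        · obtain ⟨c, hc⟩ := h2'; omega
      have low : ∀ w ∈ S₀, ∀ w' ∈ S₀, w.1 ≠ a → w'.1 ≠ a → (h w + 1) / 2 = (h w' + 1) / 2 →
          ¬ (w.1 < w'.1 ∧ w'.2 < w.2) := by
        intro w hw w' hw' hwa hwa' hr hlt
        obtain ⟨h1, h2⟩ := hS₀T w hw
        have := hstep w h1 w' hlt.1 hlt.2
        have := hm1 w h1
        rcases h2 with h2 | h2 | h2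
        · have := hm2 w h2.1 h2.2; omega
        · exact hwa h2
        · obtain ⟨c, hc⟩ := h2; omega
      intro w hw w' hw' hr
      split_ifs at hr with hwa hwa' hwa'
      · rcases le_total w.2 w'.2 with hle | hle
        · exact Or.inl (Prod.le_def.2 ⟨by omega, hle⟩)
        · exact Or.inr (Prod.le_def.2 ⟨by omega, hle⟩)
      · exact Or.inr (last w hw w' hw' hwa hwa' hr)
      · exact Or.inl (last w' hw' w hw hwa' hwa hr.symm)
      · rcases Finset.mem_insert.1 hw with rfl | hw
        · exact absurd rfl hwa
        rcases Finset.mem_insert.1 hw' with rfl | hw'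
        · exact absurd rfl hwa'
        by_contra hcon
        rcases incomp w w' hcon with hlt | hlt
        · exact low w hw w' hw' hwa hwa' hr hlt
        · exact low w' hw' w hw hwa' hwa hr.symm hlt
  have hle2 : ∑ w ∈ S', x w ≤ widthMax x k a b := by
    refine le_widthMax x ?_ (width_of_coloring (fun w => h w / 2) ?_ ?_)
    · intro w hw
      rw [Finset.mem_product, Finset.mem_range, Finset.mem_range]
      obtain ⟨h1, h2⟩ := hST' w hw
      rcases h2 with h2 | h2
      · exact ⟨(hTr' _ h2.2).1, (hTr _ h2.1).2⟩
      · rcases Finset.mem_union.1 h1 with hw | hw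
        · have := hTr _ hw; omega
        · have := hTr' _ hw
          refine ⟨this.1, lt_of_le_of_ne this.2 fun hb => h2.2 ?_⟩
          -- Nothing lies above row `b`, so its points have the even height 0 and belong to `S₀`
          -- only.
          have : h w = 0 := height_eq_zero fun z hz _ => by
            rcases Finset.mem_union.1 hz with hz | hz
            · have := hTr _ hz; omega
            · have := hTr' _ hz; omega
          simp [this]
    · intro w hw
      obtain ⟨h1, h2⟩ := hST' w hw
      have := hbound w h1
      have := hm1 w h1
      rcases h2 with h2 | h2
      · have := hm2 w h2.1 h2.2; omega
      · have := Nat.not_even_iff.1 h2.2; omega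
    · have low : ∀ w ∈ S', ∀ w' ∈ S', h w / 2 = h w' / 2 → ¬ (w.1 < w'.1 ∧ w'.2 < w.2) := by
        intro w hw w' hw' hr hlt
        obtain ⟨h1, h2⟩ := hST' w hw
        have := hstep w h1 w' hlt.1 hlt.2
        have := hm1 w h1
        rcases h2 with h2 | h2
        · have := hm2 w h2.1 h2.2; omega
        · have := Nat.not_even_iff.1 h2.2; omega
      intro w hw w' hw' hr
      by_contra hcon
      rcases incomp w w' hcon with hlt | hlt
      · exact low w hw w' hw' hr hlt
      · exact low w' hw' w hw hr.symm hlt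
  rw [← hsum, ← add_assoc, ← Finset.sum_insert hcorner]
  exact add_le_add hle1 hle2

/-- An antichain contains at most one new point, and its other points lie strictly to the left of
and above that one; so the new point can be replaced by `u`, which is lower in the same column. -/
theorem Width.union_column {k : ℕ} {T B : Finset (ℕ × ℕ)} {u : ℕ × ℕ} (h : Width k T) (hu : u ∈ T)
    (hB : ∀ z ∈ B, z.1 = u.1 ∧ u.2 ≤ z.2) (hT : ∀ w ∈ T, w.1 ≤ u.1) : Width k (T ∪ B) := by
  classical
  intro A hA hAc
  by_cases hAT : A ⊆ T
  · exact h A hAT hAc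
  obtain ⟨z, hz, hzT⟩ := Finset.not_subset.1 hAT
  have hzB : z ∈ B := (Finset.mem_union.1 (hA hz)).resolve_left hzT
  have hzu := hB z hzB
  have key : ∀ w ∈ A, w ≠ z → w ∈ T ∧ w.1 < z.1 ∧ z.2 < w.2 := by
    intro w hw hwz
    have n1 := hAc hw hz hwz
    have n2 := hAc hz hw (Ne.symm hwz)
    simp only [Pi.compl_apply, compl_iff_not, Prod.le_def] at n1 n2
    rcases Finset.mem_union.1 (hA hw) with hwT | hwB
    · have := hT w hwT
      exact ⟨hwT, by omega, by omega⟩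
    · have := hB w hwB
      omega
  have huA : u ∉ A.erase z := by
    intro huA
    obtain ⟨h1, h2⟩ := Finset.mem_erase.1 huA
    have := key u h2 h1
    omega
  have := h (insert u (A.erase z)) ?_ ?_
  · rwa [Finset.card_insert_of_notMem huA, Finset.card_erase_add_one hz] at this
  · intro w hw
    rcases Finset.mem_insert.1 hw with rfl | hw
    · exact hu
    · obtain ⟨h1, h2⟩ := Finset.mem_erase.1 hw
      exact (key w h2 h1).1
  · rw [Finset.coe_insert]
    refine (hAc.subset (Finset.coe_subset.2 (Finset.erase_subset _ _))).insert ?_ ?_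
    · intro w hw _ hle
      obtain ⟨h1, h2⟩ := Finset.mem_erase.1 hw
      have := key w h2 h1
      have := Prod.le_def.1 hle
      omega
    · intro w hw _ hle
      obtain ⟨h1, h2⟩ := Finset.mem_erase.1 hw
      have := key w h2 h1
      have := Prod.le_def.1 hle
      omega

theorem Width.image_swap {k : ℕ} {S : Finset (ℕ × ℕ)} (h : Width k S) :
    Width k (S.image Prod.swap) := by
  classical
  intro A hA hAc
  have hcard : (A.image Prod.swap).card = A.card :=
    Finset.card_image_of_injective _ Prod.swap_injective
  rw [← hcard]
  refine h _ ?_ ?_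
  · intro w hw
    obtain ⟨z, hz, rfl⟩ := Finset.mem_image.1 hw
    obtain ⟨y, hy, rfl⟩ := Finset.mem_image.1 (hA hz)
    simpa using hy
  · rintro w hw w' hw' hne hle
    obtain ⟨z, hz, rfl⟩ := Finset.mem_image.1 hw
    obtain ⟨z', hz', rfl⟩ := Finset.mem_image.1 hw'
    exact hAc hz hz' (fun h => hne (by rw [h])) (Prod.swap_le_swap.1 hle)

theorem Width.union_row {k : ℕ} {T B : Finset (ℕ × ℕ)} {u : ℕ × ℕ} (h : Width k T) (hu : u ∈ T)
    (hB : ∀ z ∈ B, z.2 = u.2 ∧ u.1 ≤ z.1) (hT : ∀ w ∈ T, w.2 ≤ u.2) : Width k (T ∪ B) := by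
  classical
  have := (h.image_swap.union_column (B := B.image Prod.swap) (u := u.swap)
    (Finset.mem_image_of_mem _ hu) (by
      intro z hz
      obtain ⟨y, hy, rfl⟩ := Finset.mem_image.1 hz
      exact hB y hy) (by
      intro z hz
      obtain ⟨y, hy, rfl⟩ := Finset.mem_image.1 hz
      exact hT y hy)).image_swap
  rw [← Finset.image_union, Finset.image_image] at this
  simpa using this

set_option maxHeartbeats 800000 in
/-- A set of width `k+1` without the corner and a set of width `k` in the smaller rectangle can be
re-divided into sets which avoid the last row and the last column, respectively. -/
theorem exists_redivision {k a b : ℕ} {S S' : Finset (ℕ × ℕ)}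
    (hS : S ⊆ Finset.range (a + 1) ×ˢ Finset.range (b + 1)) (hab : (a, b) ∉ S)
    (hS' : S' ⊆ Finset.range a ×ˢ Finset.range b) (hk : Width (k + 1) S) (hk' : Width k S') :
    ∃ T ⊆ Finset.range (a + 1) ×ˢ Finset.range b, ∃ T' ⊆ Finset.range a ×ˢ Finset.range (b + 1),
      T ∪ T' = S ∪ S' ∧ T ∩ T' = S ∩ S' ∧
      ((Width (k + 1) T ∧ Width k T') ∨ (Width k T ∧ Width (k + 1) T')) := by
  classical
  have hSr : ∀ w ∈ S, w.1 ≤ a ∧ w.2 ≤ b ∧ ¬ (w.1 = a ∧ w.2 = b) := fun w hw => by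
    have := hS hw
    simp only [Finset.mem_product, Finset.mem_range] at this
    refine ⟨by omega, by omega, fun h => hab ?_⟩
    rwa [← h.1, ← h.2]
  have hSr' : ∀ w ∈ S', w.1 < a ∧ w.2 < b := fun w hw => by
    have := hS' hw
    simpa only [Finset.mem_product, Finset.mem_range] using this
  set A := S.filter fun w => w.2 = b with hA
  set B := S.filter fun w => w.1 = a with hB
  rcases A.eq_empty_or_nonempty with hAe | hAn
  · refine ⟨S, fun w hw => ?_, S', fun w hw => ?_, rfl, rfl, Or.inl ⟨hk, hk'⟩⟩
    · have := hSr w hw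
      rw [Finset.mem_product, Finset.mem_range, Finset.mem_range]
      refine ⟨by omega, lt_of_le_of_ne this.2.1 fun h => ?_⟩
      exact Finset.notMem_empty w (hAe ▸ Finset.mem_filter.2 ⟨hw, h⟩)
    · have := hSr' w hw
      rw [Finset.mem_product, Finset.mem_range, Finset.mem_range]
      omega
  rcases B.eq_empty_or_nonempty with hBe | hBn
  · refine ⟨S', fun w hw => ?_, S, fun w hw => ?_, Finset.union_comm _ _, Finset.inter_comm _ _,
      Or.inr ⟨hk', hk⟩⟩
    · have := hSr' w hw
      rw [Finset.mem_product, Finset.mem_range, Finset.mem_range]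
      omega
    · have := hSr w hw
      rw [Finset.mem_product, Finset.mem_range, Finset.mem_range]
      refine ⟨lt_of_le_of_ne this.1 fun h => ?_, by omega⟩
      exact Finset.notMem_empty w (hBe ▸ Finset.mem_filter.2 ⟨hw, h⟩)
  -- Only the leftmost point `t` of the top row and the lowest point `u` of the right column enter
  -- the exchange. The rest of `A` and `B` is added afterwards at no cost in width.
  obtain ⟨t, htA, htmin⟩ := A.exists_min_image Prod.fst hAn
  obtain ⟨u, huB, humin⟩ := B.exists_min_image Prod.snd hBn
  obtain ⟨htS, htb⟩ := Finset.mem_filter.1 htA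
  obtain ⟨huS, hua⟩ := Finset.mem_filter.1 huB
  set S₀ := S.filter fun w => (w.2 = b → w = t) ∧ (w.1 = a → w = u) with hS₀
  have hS₀S : S₀ ⊆ S := Finset.filter_subset _ _
  have ht0 : t ∈ S₀ := Finset.mem_filter.2 ⟨htS, fun _ => rfl, fun h => absurd ⟨h, htb⟩ (hSr t htS).2.2⟩
  have hu0 : u ∈ S₀ := Finset.mem_filter.2 ⟨huS, fun h => absurd ⟨hua, h⟩ (hSr u huS).2.2, fun _ => rfl⟩
  have htu : t ≠ u := fun h => (hSr t htS).2.2 ⟨h ▸ hua, htb⟩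
  obtain ⟨r, hr1, hr2⟩ := (hk.mono hS₀S).exists_coloring
  obtain ⟨r', hr1', hr2'⟩ := hk'.exists_coloring
  obtain ⟨M, hM, hMc⟩ := exists_isLinking_of_coloring r hr1 hr2
  obtain ⟨M', hM', hMc'⟩ := exists_isLinking_of_coloring r' hr1' hr2'
  have htS' : t ∉ S' := fun h => by have := hSr' t h; omega
  have huS' : u ∉ S' := fun h => by have := hSr' u h; omega
  -- Nothing in `S₀` lies above `t` or `u`, so neither has an outgoing link. The exchange moves `t`
  -- to `T'` and leaves `u` in `T`.
  obtain ⟨T, T', N, N', hN, hN', hun, hin, htT, huT, huT', hcount⟩ :=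
    exists_exchange hM hM' ht0 htS' hu0 htu
      (by
        intro e he het
        have h1 := hM.snd_mem e he
        have h2 := hM.lt e he
        obtain ⟨h3, h4, -⟩ := Finset.mem_filter.1 h1
        have h5 := hSr _ h3
        have h6 := Prod.le_def.1 h2.le
        rw [het] at h6 h2
        exact h2.ne (h4 (by omega)).symm)
      (by
        intro e he heu
        have h1 := hM.snd_mem e he
        have h2 := hM.lt e he
        obtain ⟨h3, -, h4⟩ := Finset.mem_filter.1 h1
        have h5 := hSr _ h3
        have h6 := Prod.le_def.1 h2.le
        rw [heu] at h6 h2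
        exact h2.ne (h4 (by omega)).symm)
  have htT' : t ∈ T' := by
    have : t ∈ T ∪ T' := hun ▸ Finset.mem_union_left _ ht0
    exact (Finset.mem_union.1 this).resolve_left htT
  have huT'' := huT' huS'
  have memS₀ : ∀ w, w ∈ S₀ ↔ w ∈ S ∧ (w.2 = b → w = t) ∧ (w.1 = a → w = u) := fun w => by
    rw [hS₀, Finset.mem_filter]
  have hTsub : ∀ w, w ∈ T ∨ w ∈ T' → (w ∈ S₀ ∨ w ∈ S') := fun w hw => by
    have : w ∈ T ∪ T' := Finset.mem_union.2 hw
    rw [hun] at this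
    exact Finset.mem_union.1 this
  have hTr : ∀ w ∈ T, w.1 ≤ a ∧ w.2 < b := by
    intro w hw
    rcases hTsub w (Or.inl hw) with h | h
    · obtain ⟨h1, h2, -⟩ := (memS₀ w).1 h
      have := hSr w h1
      refine ⟨this.1, lt_of_le_of_ne this.2.1 fun h => htT ?_⟩
      rwa [← h2 h]
    · have := hSr' w h; omega
  have hTr' : ∀ w ∈ T', w.1 < a ∧ w.2 ≤ b := by
    intro w hw
    rcases hTsub w (Or.inr hw) with h | h
    · obtain ⟨h1, -, h2⟩ := (memS₀ w).1 h
      have := hSr w h1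
      refine ⟨lt_of_le_of_ne this.1 fun h => huT'' ?_, this.2.1⟩
      rwa [← h2 h]
    · have := hSr' w h; omega
  have memB : ∀ w ∈ B, w ∈ S ∧ w.1 = a := fun w hw => Finset.mem_filter.1 hw
  have memA : ∀ w ∈ A, w ∈ S ∧ w.2 = b := fun w hw => Finset.mem_filter.1 hw
  have hwB : ∀ {j}, Width j T → Width j (T ∪ B) := fun hj =>
    hj.union_column huT (fun z hz => ⟨(memB z hz).2.trans hua.symm, humin z hz⟩)
      fun w hw => hua ▸ (hTr w hw).1
  have hwA : ∀ {j}, Width j T' → Width j (T' ∪ A) := fun hj =>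
    hj.union_row htT' (fun z hz => ⟨(memA z hz).2.trans htb.symm, htmin z hz⟩)
      fun w hw => htb ▸ (hTr' w hw).2
  refine ⟨T ∪ B, ?_, T' ∪ A, ?_, ?_, ?_, ?_⟩
  · intro w hw
    rw [Finset.mem_product, Finset.mem_range, Finset.mem_range]
    rcases Finset.mem_union.1 hw with hw | hw
    · have := hTr w hw; omega
    · have h1 := memB w hw
      have h2 := hSr w h1.1
      omega
  · intro w hw
    rw [Finset.mem_product, Finset.mem_range, Finset.mem_range]
    rcases Finset.mem_union.1 hw with hw | hw
    · have := hTr' w hw; omega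
    · have h1 := memA w hw
      have h2 := hSr w h1.1
      omega
  · have hAB : S₀ ∪ (A ∪ B) = S := by
      ext w
      rw [Finset.mem_union, Finset.mem_union, memS₀, hA, hB, Finset.mem_filter, Finset.mem_filter]
      clear * -
      tauto
    calc T ∪ B ∪ (T' ∪ A) = (T ∪ T') ∪ (A ∪ B) := by
          clear * -; ext w; simp only [Finset.mem_union]; tauto
      _ = S₀ ∪ (A ∪ B) ∪ S' := by
          rw [hun]; clear * -; ext w; simp only [Finset.mem_union]; tauto
      _ = S ∪ S' := by rw [hAB]
  · ext w
    have hi : w ∈ T ∩ T' ↔ w ∈ S₀ ∩ S' := by rw [hin]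
    simp only [Finset.mem_inter, Finset.mem_union] at hi ⊢
    have c1 : w ∈ B → w ∉ T' ∧ w ∉ A ∧ w ∉ S' := fun hw => by
      have h1 := memB w hw
      refine ⟨fun h => ?_, fun h => ?_, fun h => ?_⟩
      · have := hTr' w h; omega
      · exact (hSr w h1.1).2.2 ⟨h1.2, (memA w h).2⟩
      · have := hSr' w h; omega
    have c2 : w ∈ A → w ∉ T ∧ w ∉ S' := fun hw => by
      have h1 := memA w hw
      refine ⟨fun h => ?_, fun h => ?_⟩
      · have := hTr w h; omega
      · have := hSr' w h; omega
    have c3 : w ∈ S₀ ↔ w ∈ S ∧ (w ∈ A → w = t) ∧ (w ∈ B → w = u) := by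
      rw [memS₀, hA, hB, Finset.mem_filter, Finset.mem_filter]; clear * -; tauto
    clear * - hi c1 c2 c3
    tauto
  · have key : ∀ {U : Finset (ℕ × ℕ)} {L : Finset ((ℕ × ℕ) × (ℕ × ℕ))} {j : ℕ}, IsLinking U L →
        U.card ≤ L.card + j → Width j U := fun hL hj Z hZ hZc => by
      have := hL.card_antichain_add_card_le hZ hZc
      omega
    -- Either both bounds on the number of chains persist, or one chain passes from the first set to
    -- the second; these are the two terms of the maximum in the recurrence.
    rcases hcount with ⟨h1, h2⟩ | ⟨h1, h2⟩
    · exact Or.inl ⟨hwB (key hN (by omega)), hwA (key hN' (by omega))⟩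
    · exact Or.inr ⟨hwB (key hN (by omega)), hwA (key hN' (by omega))⟩

/-- The bilinear recursion of the maximal weights. -/
theorem widthMax_add_widthMax [IsOrderedAddMonoid R] {x : ℕ × ℕ → R} (hx : ∀ v, 0 ≤ x v)
    (k a b : ℕ) :
    widthMax x (k + 1) (a + 1) (b + 1) + widthMax x k a b = x (a, b) +
      max (widthMax x (k + 1) (a + 1) b + widthMax x k a (b + 1))
        (widthMax x k (a + 1) b + widthMax x (k + 1) a (b + 1)) := by
  classical
  apply le_antisymm
  · obtain ⟨S, hS, hk, e⟩ := exists_widthMax_eq x (k + 1) (a + 1) (b + 1)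
    obtain ⟨S', hS', hk', e'⟩ := exists_widthMax_eq x k a b
    obtain ⟨T, hT, T', hT', hun, hin, hcase⟩ := exists_redivision
      ((Finset.erase_subset (a, b) S).trans hS) (Finset.notMem_erase _ _) hS'
      (hk.mono (Finset.erase_subset _ _)) hk'
    have h1 : ∑ w ∈ S, x w ≤ x (a, b) + ∑ w ∈ S.erase (a, b), x w := by
      by_cases hab : (a, b) ∈ S
      · rw [Finset.add_sum_erase _ _ hab]
      · rw [Finset.erase_eq_of_notMem hab]
        exact le_add_of_nonneg_left (hx _)
    have h2 : ∑ w ∈ S.erase (a, b), x w + ∑ w ∈ S', x w = ∑ w ∈ T, x w + ∑ w ∈ T', x w := by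
      rw [← Finset.sum_union_inter, ← hun, ← hin, Finset.sum_union_inter]
    rw [e, e']
    refine (add_le_add_left h1 _).trans ?_
    rw [add_assoc, h2]
    refine add_le_add_right ?_ _
    rcases hcase with ⟨w1, w2⟩ | ⟨w1, w2⟩
    · exact (add_le_add (le_widthMax x hT w1) (le_widthMax x hT' w2)).trans (le_max_left _ _)
    · exact (add_le_add (le_widthMax x hT w1) (le_widthMax x hT' w2)).trans (le_max_right _ _)
  · rw [← max_add_add_left]
    refine max_le ?_ ?_
    · obtain ⟨T, hT, hk, e⟩ := exists_widthMax_eq x (k + 1) (a + 1) b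
      obtain ⟨T', hT', hk', e'⟩ := exists_widthMax_eq x k a (b + 1)
      rw [e, e']
      exact add_sum_le_widthMax x (by omega) hT hT' hk hk'
    · obtain ⟨T, hT, hk, e⟩ := exists_widthMax_eq x k (a + 1) b
      obtain ⟨T', hT', hk', e'⟩ := exists_widthMax_eq x (k + 1) a (b + 1)
      rw [e, e']
      exact add_sum_le_widthMax x (by omega) hT hT' hk hk'

end Exchange

end LPP


/-! ### Growth by the local rule, Greene's theorem, and interlacing -/

namespace LPP

section Shape

variable {R : Type*} [AddCommGroup R] [LinearOrder R]

/-- The shapes grown from the weights `x` by the local rule of the Robinson-Schensted-Knuth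
correspondence: `shape x a b k` is the `(k+1)`-st row for the rectangle `[0, a) × [0, b)`. -/
def shape (x : ℕ × ℕ → R) : ℕ → ℕ → ℕ → R
  | 0, _, _ => 0
  | _ + 1, 0, _ => 0
  | a + 1, b + 1, 0 => max (shape x (a + 1) b 0) (shape x a (b + 1) 0) + x (a, b)
  | a + 1, b + 1, k + 1 =>
    if k < min a b then
      max (shape x (a + 1) b (k + 1)) (shape x a (b + 1) (k + 1)) +
        min (shape x (a + 1) b k) (shape x a (b + 1) k) - shape x a b k
    else 0
  termination_by a b => a + b

theorem shape_zero_left (x : ℕ × ℕ → R) (b k : ℕ) : shape x 0 b k = 0 := by rw [shape]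

theorem shape_zero_right (x : ℕ × ℕ → R) (a k : ℕ) : shape x a 0 k = 0 := by
  cases a <;> rw [shape]

theorem shape_succ_zero (x : ℕ × ℕ → R) (a b : ℕ) : shape x (a + 1) (b + 1) 0 =
    max (shape x (a + 1) b 0) (shape x a (b + 1) 0) + x (a, b) := by rw [shape]

theorem shape_succ_succ (x : ℕ × ℕ → R) {a b k : ℕ} (h : k < min a b) :
    shape x (a + 1) (b + 1) (k + 1) =
      max (shape x (a + 1) b (k + 1)) (shape x a (b + 1) (k + 1)) +
        min (shape x (a + 1) b k) (shape x a (b + 1) k) - shape x a b k := by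
  rw [shape, if_pos h]

theorem shape_eq_zero (x : ℕ × ℕ → R) {a b k : ℕ} (h : min a b ≤ k) : shape x a b k = 0 := by
  rcases a with _ | a
  · exact shape_zero_left x b k
  rcases b with _ | b
  · exact shape_zero_right x _ k
  rcases k with _ | k
  · omega
  · rw [shape, if_neg (by omega)]

theorem shape_congr {x y : ℕ × ℕ → R} : ∀ {a b : ℕ}, (∀ c < a, ∀ d < b, x (c, d) = y (c, d)) →
    ∀ k, shape x a b k = shape y a b k := by
  intro a b
  induction hs : a + b using Nat.strong_induction_on generalizing a b with
  | _ s ih =>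
    intro h k
    rcases a with _ | a
    · rw [shape_zero_left, shape_zero_left]
    rcases b with _ | b
    · rw [shape_zero_right, shape_zero_right]
    have h1 := ih (a + 1 + b) (by omega) rfl fun c hc d hd => h c hc d (by omega)
    have h2 := ih (a + (b + 1)) (by omega) rfl fun c hc d hd => h c (by omega) d hd
    have h3 := ih (a + b) (by omega) rfl fun c hc d hd => h c (by omega) d (by omega)
    rcases k with _ | k
    · rw [shape_succ_zero, shape_succ_zero, h1, h2, h a (by omega) b (by omega)]
    · by_cases hk : k < min a b
      · rw [shape_succ_succ x hk, shape_succ_succ y hk, h1, h1, h2, h2, h3]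
      · rw [shape_eq_zero x (by omega), shape_eq_zero y (by omega)]

variable [IsOrderedAddMonoid R]

omit [IsOrderedAddMonoid R] in
theorem widthMax_zero (x : ℕ × ℕ → R) (a b : ℕ) : widthMax x 0 a b = 0 := by
  obtain ⟨S, -, hk, e⟩ := exists_widthMax_eq x 0 a b
  have : S = ∅ := Finset.eq_empty_of_forall_notMem fun w hw => by
    simpa using hk {w} (by simpa using hw) (by simp)
  rw [e, this, Finset.sum_empty]

/-- The rows or the columns of the rectangle, whichever are fewer, colour all of it by chains. -/
theorem widthMax_eq_sum {x : ℕ × ℕ → R} (hx : ∀ v, 0 ≤ x v) {k a b : ℕ} (h : min a b ≤ k) :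
    widthMax x k a b = ∑ w ∈ Finset.range a ×ˢ Finset.range b, x w := by
  apply le_antisymm
  · obtain ⟨S, hS, -, e⟩ := exists_widthMax_eq x k a b
    rw [e]
    exact Finset.sum_le_sum_of_subset_of_nonneg hS fun w _ _ => hx w
  · refine le_widthMax x subset_rfl ?_
    rcases min_le_iff.1 h with h | h
    · refine width_of_coloring Prod.fst (fun w hw => ?_) fun w _ w' _ e => ?_
      · have := Finset.mem_range.1 (Finset.mem_product.1 hw).1
        omega
      · simp only [Prod.le_def]; omega
    · refine width_of_coloring Prod.snd (fun w hw => ?_) fun w _ w' _ e => ?_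
      · have := Finset.mem_range.1 (Finset.mem_product.1 hw).2
        omega
      · simp only [Prod.le_def]; omega

/-- Greene's theorem. The recurrences for `k + 1` and for `k` are subtracted; the weight of the
corner cancels, and the smaller rectangle contributes the old row. -/
theorem widthMax_succ_sub {x : ℕ × ℕ → R} (hx : ∀ v, 0 ≤ x v) : ∀ (a b k : ℕ),
    widthMax x (k + 1) a b - widthMax x k a b = shape x a b k := by
  intro a b
  induction hs : a + b using Nat.strong_induction_on generalizing a b with
  | _ s ih =>
    intro k
    by_cases hk : min a b ≤ k
    · rw [shape_eq_zero x hk, widthMax_eq_sum hx hk, widthMax_eq_sum hx (by omega), sub_self]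
    obtain ⟨a, rfl⟩ : ∃ c, a = c + 1 := ⟨a - 1, by omega⟩
    obtain ⟨b, rfl⟩ : ∃ c, b = c + 1 := ⟨b - 1, by omega⟩
    have h1 := ih (a + 1 + b) (by omega) _ _ rfl
    have h2 := ih (a + (b + 1)) (by omega) _ _ rfl
    have h3 := ih (a + b) (by omega) _ _ rfl
    rcases k with _ | k
    · have e := widthMax_add_widthMax hx 0 a b
      simp only [widthMax_zero, add_zero, zero_add] at e
      rw [shape_succ_zero, ← h1, ← h2, e, widthMax_zero, widthMax_zero, widthMax_zero]
      simp only [sub_zero, zero_add]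
      exact add_comm _ _
    · rw [shape_succ_succ x (by omega), ← h1, ← h1, ← h2, ← h2, ← h3]
      have e1 := eq_sub_of_add_eq (widthMax_add_widthMax hx (k + 1) a b)
      have e0 := eq_sub_of_add_eq (widthMax_add_widthMax hx k a b)
      rw [e1, e0]
      generalize widthMax x (k + 1 + 1) (a + 1) b = m2
      generalize widthMax x (k + 1) (a + 1) b = m1
      generalize widthMax x k (a + 1) b = m0
      generalize widthMax x (k + 1 + 1) a (b + 1) = n2
      generalize widthMax x (k + 1) a (b + 1) = n1
      generalize widthMax x k a (b + 1) = n0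
      -- Taking `m1 + n1` out of both maxima leaves a maximum of rows in one and, with a minus sign,
      -- a minimum of rows in the other.
      have f1 : max (m2 + n1) (m1 + n2) = max (m2 - m1) (n2 - n1) + (m1 + n1) := by
        rw [← max_add_add_right]
        congr 1 <;> abel
      have f0 : max (m1 + n0) (m0 + n1) = (m1 + n1) - min (m1 - m0) (n1 - n0) := by
        rw [← max_sub_sub_left, max_comm]
        congr 1 <;> abel
      rw [f1, f0]
      abel

theorem increment_eq_shape {x : ℕ × ℕ → R} (hx : ∀ v, 0 ≤ x v) (k a b : ℕ) :
    increment x (k + 1) (a, b) = shape x (a + 1) (b + 1) k := by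
  rw [increment, Nat.add_sub_cancel, maxWeight_eq_widthMax hx, maxWeight_eq_widthMax hx,
    widthMax_succ_sub hx]

/-- The interlacing conditions between the levels `s` and `s + 1` of an array. -/
structure LevelInterlacing (s : ℕ) (p : ℕ → ℕ → ℕ → R) : Prop where
  nonneg : ∀ a b k, a + b = s → 0 ≤ p a b k
  nonneg_succ : ∀ a b k, a + b = s + 1 → 0 ≤ p a b k
  le_right : ∀ a b k, a + b = s → p a b k ≤ p (a + 1) b k
  le_up : ∀ a b k, a + b = s → p a b k ≤ p a (b + 1) k
  right_le : ∀ a b k, a + b = s → p (a + 1) b (k + 1) ≤ p a b k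
  up_le : ∀ a b k, a + b = s → p a (b + 1) (k + 1) ≤ p a b k

/-- With the middle level fixed, an old entry and the new entry of the next row diagonally beyond it
are subject to the same bounds, a maximum below and a minimum above, and the rule reflects the
interval between them. A new first-row entry exceeds its lower bound by the weight, whence the sign
condition on `x`. -/
theorem levelInterlacing_succ_iff {s : ℕ} {p : ℕ → ℕ → ℕ → R} {x : ℕ × ℕ → R}
    (hsupp : ∀ a b k, s ≤ a + b → a + b ≤ s + 2 → min a b ≤ k → p a b k = 0)
    (h0 : ∀ a b, a + b = s → p (a + 1) (b + 1) 0 = max (p (a + 1) b 0) (p a (b + 1) 0) + x (a, b))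
    (h1 : ∀ a b k, a + b = s → k < min a b → p (a + 1) (b + 1) (k + 1) =
      max (p (a + 1) b (k + 1)) (p a (b + 1) (k + 1)) + min (p (a + 1) b k) (p a (b + 1) k)
        - p a b k) :
    LevelInterlacing (s + 1) p ↔ LevelInterlacing s p ∧ ∀ a b, a + b = s → 0 ≤ x (a, b) := by
  constructor
  · intro h
    have lam : ∀ a b k, a + b = s → k < min a b → p a b k =
        max (p (a + 1) b (k + 1)) (p a (b + 1) (k + 1)) + min (p (a + 1) b k) (p a (b + 1) k)
          - p (a + 1) (b + 1) (k + 1) := fun a b k hs hk => by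
      rw [h1 a b k hs hk]; abel
    have ub : ∀ a b k, a + b = s → k < min a b →
        p a b k ≤ min (p (a + 1) b k) (p a (b + 1) k) := fun a b k hs hk => by
      rw [lam a b k hs hk, sub_le_iff_le_add, add_comm]
      exact add_le_add_right (max_le (h.le_up _ _ _ (by omega)) (h.le_right _ _ _ (by omega))) _
    have lb : ∀ a b k, a + b = s → k < min a b →
        max (p (a + 1) b (k + 1)) (p a (b + 1) (k + 1)) ≤ p a b k := fun a b k hs hk => by
      rw [lam a b k hs hk, le_sub_iff_add_le]
      exact add_le_add_right (le_min (h.up_le _ _ _ (by omega)) (h.right_le _ _ _ (by omega))) _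
    refine ⟨⟨fun a b k hs => ?_, fun a b k hs => h.nonneg a b k hs, fun a b k hs => ?_,
      fun a b k hs => ?_, fun a b k hs => ?_, fun a b k hs => ?_⟩, fun a b hs => ?_⟩
    · by_cases hk : k < min a b
      · exact (h.nonneg _ _ _ (by omega)).trans ((le_max_left _ _).trans (lb a b k hs hk))
      · rw [hsupp a b k (by omega) (by omega) (by omega)]
    · by_cases hk : k < min a b
      · exact (ub a b k hs hk).trans (min_le_left _ _)
      · rw [hsupp a b k (by omega) (by omega) (by omega)]
        exact h.nonneg _ _ _ (by omega)
    · by_cases hk : k < min a b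
      · exact (ub a b k hs hk).trans (min_le_right _ _)
      · rw [hsupp a b k (by omega) (by omega) (by omega)]
        exact h.nonneg _ _ _ (by omega)
    · by_cases hk : k < min a b
      · exact (le_max_left _ _).trans (lb a b k hs hk)
      · rw [hsupp a b k (by omega) (by omega) (by omega),
          hsupp (a + 1) b (k + 1) (by omega) (by omega) (by omega)]
    · by_cases hk : k < min a b
      · exact (le_max_right _ _).trans (lb a b k hs hk)
      · rw [hsupp a b k (by omega) (by omega) (by omega),
          hsupp a (b + 1) (k + 1) (by omega) (by omega) (by omega)]
    · have := max_le (h.le_up (a + 1) b 0 (by omega)) (h.le_right a (b + 1) 0 (by omega))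
      rw [h0 a b hs] at this
      exact (le_add_iff_nonneg_right _).1 this
  · rintro ⟨h, hx⟩
    have lb : ∀ a b k, a + b = s →
        max (p (a + 1) b k) (p a (b + 1) k) ≤ p (a + 1) (b + 1) k := fun a b k hs => by
      rcases k with _ | k
      · rw [h0 a b hs]
        exact le_add_of_nonneg_right (hx a b hs)
      · by_cases hk : k < min a b
        · rw [h1 a b k hs hk, le_sub_iff_add_le]
          exact add_le_add_right (le_min (h.le_right _ _ _ hs) (h.le_up _ _ _ hs)) _
        · rw [hsupp (a + 1) b (k + 1) (by omega) (by omega) (by omega),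
            hsupp a (b + 1) (k + 1) (by omega) (by omega) (by omega),
            hsupp (a + 1) (b + 1) (k + 1) (by omega) (by omega) (by omega), max_self]
    have ub : ∀ a b k, a + b = s →
        p (a + 1) (b + 1) (k + 1) ≤ min (p (a + 1) b k) (p a (b + 1) k) := fun a b k hs => by
      by_cases hk : k < min a b
      · rw [h1 a b k hs hk, sub_le_iff_le_add, add_comm]
        exact add_le_add_right (max_le (h.right_le _ _ _ hs) (h.up_le _ _ _ hs)) _
      · rw [hsupp (a + 1) (b + 1) (k + 1) (by omega) (by omega) (by omega)]
        exact le_min (h.nonneg_succ _ _ _ (by omega)) (h.nonneg_succ _ _ _ (by omega))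
    refine ⟨fun a b k hs => h.nonneg_succ a b k hs, fun a b k hs => ?_, fun a b k hs => ?_,
      fun a b k hs => ?_, fun a b k hs => ?_, fun a b k hs => ?_⟩
    · by_cases hk : min a b ≤ k
      · rw [hsupp a b k (by omega) (by omega) hk]
      obtain ⟨a, rfl⟩ : ∃ c, a = c + 1 := ⟨a - 1, by omega⟩
      obtain ⟨b, rfl⟩ : ∃ c, b = c + 1 := ⟨b - 1, by omega⟩
      exact (h.nonneg_succ _ _ _ (by omega)).trans
        ((le_max_left _ _).trans (lb a b k (by omega)))
    · rcases b with _ | b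
      · rw [hsupp a 0 k (by omega) (by omega) (by omega),
          hsupp (a + 1) 0 k (by omega) (by omega) (by omega)]
      · exact (le_max_right _ _).trans (lb a b k (by omega))
    · rcases a with _ | a
      · rw [hsupp 0 b k (by omega) (by omega) (by omega),
          hsupp 0 (b + 1) k (by omega) (by omega) (by omega)]
      · exact (le_max_left _ _).trans (lb a b k (by omega))
    · rcases b with _ | b
      · rw [hsupp a 0 k (by omega) (by omega) (by omega),
          hsupp (a + 1) 0 (k + 1) (by omega) (by omega) (by omega)]
      · exact (ub a b k (by omega)).trans (min_le_right _ _)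
    · rcases a with _ | a
      · rw [hsupp 0 b k (by omega) (by omega) (by omega),
          hsupp 0 (b + 1) (k + 1) (by omega) (by omega) (by omega)]
      · exact (ub a b k (by omega)).trans (min_le_left _ _)

theorem levelInterlacing_shape_iff (x : ℕ × ℕ → R) (s : ℕ) :
    LevelInterlacing s (shape x) ↔ ∀ a b, a + b < s → 0 ≤ x (a, b) := by
  induction s with
  | zero =>
    simp only [not_lt_zero, false_imp_iff, implies_true, iff_true]
    have hz : ∀ a b k, a + b ≤ 1 → shape x a b k = 0 := fun a b k h =>
      shape_eq_zero x (by omega)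
    exact ⟨fun a b k h => (hz a b k (by omega)).ge, fun a b k h => (hz a b k (by omega)).ge,
      fun a b k h => by rw [hz, hz] <;> omega, fun a b k h => by rw [hz, hz] <;> omega,
      fun a b k h => by rw [hz, hz] <;> omega, fun a b k h => by rw [hz, hz] <;> omega⟩
  | succ s ih =>
    rw [levelInterlacing_succ_iff (x := x) (fun a b k _ _ h => shape_eq_zero x h)
      (fun a b _ => shape_succ_zero x a b) (fun a b k _ h => shape_succ_succ x h), ih]
    constructor
    · rintro ⟨h1, h2⟩ a b hab
      rcases Nat.lt_succ_iff_lt_or_eq.1 hab with h | h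
      · exact h1 a b h
      · exact h2 a b h
    · exact fun h => ⟨fun a b hab => h a b (by omega), fun a b hab => h a b (by omega)⟩

/-- The local rule can be solved for the oldest of three levels, and the weights on that
antidiagonal are read off the first rows; the recursion then goes down to the origin. -/
theorem shape_injective {x y : ℕ × ℕ → R} {s : ℕ}
    (h : ∀ a b k, s ≤ a + b → a + b ≤ s + 1 → k < min a b → shape x a b k = shape y a b k) :
    ∀ a b, a + b < s → x (a, b) = y (a, b) := by
  induction s with
  | zero => intro a b hab; omega
  | succ s ih =>
    have h' : ∀ a b k, s + 1 ≤ a + b → a + b ≤ s + 2 → shape x a b k = shape y a b k := by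
      intro a b k h1 h2
      by_cases hk : k < min a b
      · exact h a b k h1 h2 hk
      · rw [shape_eq_zero x (by omega), shape_eq_zero y (by omega)]
    have hlow : ∀ a b k, s ≤ a + b → a + b ≤ s + 1 → k < min a b →
        shape x a b k = shape y a b k := by
      intro a b k h1 h2 hk
      rcases (by omega : a + b = s ∨ a + b = s + 1) with hs | hs
      · have e := h' (a + 1) (b + 1) (k + 1) (by omega) (by omega)
        rw [shape_succ_succ x hk, shape_succ_succ y hk,
          h' (a + 1) b (k + 1) (by omega) (by omega), h' a (b + 1) (k + 1) (by omega) (by omega),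
          h' (a + 1) b k (by omega) (by omega), h' a (b + 1) k (by omega) (by omega)] at e
        exact sub_right_injective e
      · exact h' a b k (by omega) (by omega)
    intro a b hab
    rcases Nat.lt_succ_iff_lt_or_eq.1 hab with hs | hs
    · exact ih hlow a b hs
    · have e := h' (a + 1) (b + 1) 0 (by omega) (by omega)
      rw [shape_succ_zero, shape_succ_zero, h' (a + 1) b 0 (by omega) (by omega),
        h' a (b + 1) 0 (by omega) (by omega)] at e
      exact add_left_cancel e

theorem exists_shape_eq {s : ℕ} {q : ℕ → ℕ → ℕ → R} (hq : LevelInterlacing s q)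
    (hsupp : ∀ a b k, s ≤ a + b → a + b ≤ s + 1 → min a b ≤ k → q a b k = 0) :
    ∃ x : ℕ × ℕ → R, (∀ v, 0 ≤ x v) ∧ (∀ v : ℕ × ℕ, s ≤ v.1 + v.2 → x v = 0) ∧
      ∀ a b k, s ≤ a + b → a + b ≤ s + 1 → shape x a b k = q a b k := by
  induction s generalizing q with
  | zero =>
    refine ⟨0, fun v => le_rfl, fun v _ => rfl, fun a b k h1 h2 => ?_⟩
    rw [shape_eq_zero _ (by omega), hsupp a b k h1 h2 (by omega)]
  | succ s ih =>
    -- One level is peeled off: level `s` is recovered by the reflection, and the weights `y` below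
    -- are the excess of the newest first row over the maximum of its neighbours.
    set q' : ℕ → ℕ → ℕ → R := fun a b k =>
      if a + b = s then
        if k < min a b then max (q (a + 1) b (k + 1)) (q a (b + 1) (k + 1)) +
          min (q (a + 1) b k) (q a (b + 1) k) - q (a + 1) (b + 1) (k + 1) else 0
      else q a b k with hq'
    have q'_eq : ∀ a b k, a + b ≠ s → q' a b k = q a b k := fun a b k h => if_neg h
    set y : ℕ × ℕ → R := fun v =>
      q (v.1 + 1) (v.2 + 1) 0 - max (q (v.1 + 1) v.2 0) (q v.1 (v.2 + 1) 0) with hy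
    have hq'I : LevelInterlacing (s + 1) q' := by
      constructor <;> intro a b k hs <;> simp only [q'_eq _ _ _ (by omega : a + b ≠ s),
        q'_eq _ _ _ (by omega : a + 1 + b ≠ s), q'_eq _ _ _ (by omega : a + (b + 1) ≠ s)]
      exacts [hq.nonneg a b k hs, hq.nonneg_succ a b k hs, hq.le_right a b k hs,
        hq.le_up a b k hs, hq.right_le a b k hs, hq.up_le a b k hs]
    have hsupp' : ∀ a b k, s ≤ a + b → a + b ≤ s + 2 → min a b ≤ k → q' a b k = 0 := by
      intro a b k h1 h2 hk
      by_cases hs : a + b = s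
      · simp only [hq']
        rw [if_pos hs, if_neg (by omega)]
      · rw [q'_eq _ _ _ hs, hsupp a b k (by omega) (by omega) hk]
    obtain ⟨hI, hy0⟩ := (levelInterlacing_succ_iff (s := s) (p := q') (x := y) hsupp'
      (fun a b hs => by
        rw [q'_eq _ _ _ (by omega), q'_eq _ _ _ (by omega), q'_eq _ _ _ (by omega)]
        simp only [hy]; abel)
      (fun a b k hs hk => by
        rw [q'_eq _ _ _ (by omega), q'_eq _ _ _ (by omega), q'_eq _ _ _ (by omega),
          q'_eq _ _ _ (by omega), q'_eq _ _ _ (by omega)]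
        simp only [hq']
        rw [if_pos hs, if_pos hk]; abel)).1 hq'I
    obtain ⟨x, hx, hxs, hsh⟩ := ih hI fun a b k h1 h2 hk => hsupp' a b k h1 (by omega) hk
    refine ⟨fun v => if v.1 + v.2 = s then y v else x v, fun v => ?_, fun v hv => ?_, ?_⟩
    · simp only
      split_ifs with h
      · exact hy0 v.1 v.2 h
      · exact hx v
    · simp only
      rw [if_neg (by omega)]
      exact hxs v (by omega)
    · set z : ℕ × ℕ → R := fun v => if v.1 + v.2 = s then y v else x v with hz
      have low : ∀ a b k, s ≤ a + b → a + b ≤ s + 1 → shape z a b k = q' a b k := by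
        intro a b k h1 h2
        rw [← hsh a b k h1 h2]
        refine shape_congr (fun c hc d hd => ?_) k
        simp only [hz]
        rw [if_neg (by omega)]
      intro a b k h1 h2
      rcases (by omega : a + b = s + 1 ∨ a + b = s + 2) with hs | hs
      · rw [low a b k (by omega) (by omega), q'_eq _ _ _ (by omega)]
      · by_cases hk : min a b ≤ k
        · rw [shape_eq_zero z hk, hsupp a b k (by omega) (by omega) hk]
        obtain ⟨a, rfl⟩ : ∃ c, a = c + 1 := ⟨a - 1, by omega⟩
        obtain ⟨b, rfl⟩ : ∃ c, b = c + 1 := ⟨b - 1, by omega⟩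
        rcases k with _ | k
        · rw [shape_succ_zero, low _ _ _ (by omega) (by omega), low _ _ _ (by omega) (by omega),
            q'_eq _ _ _ (by omega), q'_eq _ _ _ (by omega)]
          simp only [hz]
          rw [if_pos (by omega)]
          simp only [hy]; abel
        · rw [shape_succ_succ z (by omega), low _ _ _ (by omega) (by omega),
            low _ _ _ (by omega) (by omega), low _ _ _ (by omega) (by omega),
            low _ _ _ (by omega) (by omega), low a b _ (by omega) (by omega),
            q'_eq _ _ _ (by omega), q'_eq _ _ _ (by omega), q'_eq _ _ _ (by omega),
            q'_eq _ _ _ (by omega)]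
          simp only [hq']
          rw [if_pos (by omega), if_pos (by omega)]
          abel

/-- The rows are successive differences of the maximal weights, and the last of these is the total
weight. -/
theorem sum_shape {x : ℕ × ℕ → R} (hx : ∀ v, 0 ≤ x v) (a b : ℕ) :
    ∑ k ∈ Finset.range (min a b), shape x a b k = ∑ w ∈ Finset.range a ×ˢ Finset.range b, x w := by
  rw [Finset.sum_congr rfl fun k _ => (widthMax_succ_sub hx a b k).symm,
    Finset.sum_range_sub (fun k => widthMax x k a b), widthMax_zero, sub_zero,
    widthMax_eq_sum hx le_rfl]

end Shape

end LPP


/-! ### The array on two antidiagonals: indices, energy, bijection -/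

namespace LPP

/-- The points `(a, b)` with `a + b < s`. -/
def triangle (s : ℕ) : Finset (ℕ × ℕ) :=
  (Finset.range s ×ˢ Finset.range s).filter fun v => v.1 + v.2 < s

theorem mem_triangle {s : ℕ} {v : ℕ × ℕ} : v ∈ triangle s ↔ v.1 + v.2 < s := by
  simp only [triangle, Finset.mem_filter, Finset.mem_product, Finset.mem_range]
  omega

/-- The index set of the shapes of the rectangles with half-perimeter `s`. -/
def cells (s : ℕ) : Finset ((ℕ × ℕ) × ℕ) :=
  (Finset.HasAntidiagonal.antidiagonal s ×ˢ Finset.range s).filter fun c => c.2 < min c.1.1 c.1.2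

theorem mem_cells {s : ℕ} {c : (ℕ × ℕ) × ℕ} :
    c ∈ cells s ↔ c.1.1 + c.1.2 = s ∧ c.2 < min c.1.1 c.1.2 := by
  simp only [cells, Finset.mem_filter, Finset.mem_product, Finset.HasAntidiagonal.mem_antidiagonal,
    Finset.mem_range]
  omega

section

variable {R : Type*} [AddCommGroup R]

theorem sum_cells (f : ℕ → ℕ → ℕ → R) (s : ℕ) : ∑ c ∈ cells s, f c.1.1 c.1.2 c.2 =
    ∑ v ∈ Finset.HasAntidiagonal.antidiagonal s,
      ∑ k ∈ Finset.range (min v.1 v.2), f v.1 v.2 k := by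
  rw [Finset.sum_sigma']
  refine Finset.sum_nbij' (fun c => ⟨c.1, c.2⟩) (fun c => (c.1, c.2)) ?_ ?_ ?_ ?_ ?_
  · intro c hc
    simpa [mem_cells] using hc
  · intro c hc
    simpa [mem_cells] using hc
  · intro c _; rfl
  · intro c _; rfl
  · intro c _; rfl

/-- The entry `k` at the vertex `(a, b)` is row `k - 1` of the half-open rectangle with sides `a +
1` and `b + 1`, so level `m` has half-perimeter `m + 2`. -/
theorem sum_idx (f : ℕ → ℕ → ℕ → R) (m : ℕ) :
    ∑ i ∈ idx m, f (i.1.1 + 1) (i.1.2 + 1) (i.2 - 1) = ∑ c ∈ cells (m + 2), f c.1.1 c.1.2 c.2 := by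
  refine Finset.sum_nbij' (fun i => ((i.1.1 + 1, i.1.2 + 1), i.2 - 1))
    (fun c => ((c.1.1 - 1, c.1.2 - 1), c.2 + 1)) ?_ ?_ ?_ ?_ ?_
  · rintro ⟨⟨a, b⟩, k⟩ hi
    rw [mem_idx] at hi
    rw [mem_cells]
    dsimp only
    omega
  · rintro ⟨⟨a, b⟩, k⟩ hc
    rw [mem_cells] at hc
    dsimp only at hc ⊢
    rw [mem_idx]
    omega
  · rintro ⟨⟨a, b⟩, k⟩ hi
    rw [mem_idx] at hi
    simp; omega
  · rintro ⟨⟨a, b⟩, k⟩ hc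
    rw [mem_cells] at hc
    dsimp only at hc
    simp; omega
  · intro i _; rfl

theorem energy_eq_sum (n : ℕ) (g : (ℕ × ℕ) × ℕ → R) :
    energy n (fun i => g i.1) = ∑ i ∈ idx (n + 1), g i - ∑ i ∈ idx n, g i := by
  have key : ∀ m, idx m ⊆ idx n ∪ idx (n + 1) →
      ∑ i : Idx n with i.1 ∈ idx m, g i.1 = ∑ i ∈ idx m, g i := fun m hm => by
    rw [Finset.sum_filter, Finset.sum_coe_sort (idx n ∪ idx (n + 1))
      (fun i => if i ∈ idx m then g i else 0), ← Finset.sum_filter,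
      Finset.filter_mem_eq_inter, Finset.inter_eq_right.2 hm]
  rw [energy, key _ Finset.subset_union_right, key _ Finset.subset_union_left]

/-- Prolonging the rectangle at `v` by one in the first direction adds a column of `v.2` points. For
`v` on the antidiagonal `s` these columns tile the triangle. -/
theorem sum_rectangle_sub (x : ℕ × ℕ → R) (s : ℕ) :
    ∑ v ∈ Finset.HasAntidiagonal.antidiagonal (s + 1),
        ∑ w ∈ Finset.range v.1 ×ˢ Finset.range v.2, x w -
      ∑ v ∈ Finset.HasAntidiagonal.antidiagonal s,
        ∑ w ∈ Finset.range v.1 ×ˢ Finset.range v.2, x w = ∑ v ∈ triangle s, x v := by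
  rw [Finset.Nat.sum_antidiagonal_succ, Finset.range_zero, Finset.empty_product, Finset.sum_empty,
    zero_add, ← Finset.sum_sub_distrib]
  have h1 : ∀ v : ℕ × ℕ, ∑ w ∈ Finset.range (v.1 + 1) ×ˢ Finset.range v.2, x w -
      ∑ w ∈ Finset.range v.1 ×ˢ Finset.range v.2, x w = ∑ j ∈ Finset.range v.2, x (v.1, j) := by
    intro v
    rw [Finset.sum_product, Finset.sum_product, Finset.sum_range_succ, add_sub_cancel_left]
  rw [Finset.sum_congr rfl fun v _ => h1 v, Finset.sum_sigma']
  refine Finset.sum_nbij' (fun c => (c.1.1, c.2)) (fun v => ⟨(v.1, s - v.1), v.2⟩) ?_ ?_ ?_ ?_ ?_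
  · rintro ⟨⟨a, b⟩, j⟩ hc
    simp only [Finset.mem_sigma, Finset.HasAntidiagonal.mem_antidiagonal, Finset.mem_range] at hc
    rw [mem_triangle]
    dsimp only
    omega
  · rintro ⟨a, j⟩ hv
    rw [mem_triangle] at hv
    dsimp only at hv
    simp only [Finset.mem_sigma, Finset.HasAntidiagonal.mem_antidiagonal, Finset.mem_range]
    omega
  · rintro ⟨⟨a, b⟩, j⟩ hc
    simp only [Finset.mem_sigma, Finset.HasAntidiagonal.mem_antidiagonal, Finset.mem_range] at hc
    obtain rfl : b = s - a := by omega
    rfl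
  · rintro ⟨a, j⟩ _; rfl
  · rintro ⟨⟨a, b⟩, j⟩ _; rfl

end

section Array

variable {R : Type*} [AddCommGroup R] [LinearOrder R]

theorem Idx.one_le {n : ℕ} (i : Idx n) : 1 ≤ i.1.2 := by
  obtain ⟨⟨⟨a, b⟩, k⟩, hi⟩ := i
  rw [Finset.mem_union, mem_idx, mem_idx] at hi
  dsimp only
  omega

/-- The array on `I_n ∪ I_{n+1}` of the shapes grown from `x`. -/
def shapeArray (n : ℕ) (x : ℕ × ℕ → R) (i : Idx n) : R :=
  shape x (i.1.1.1 + 1) (i.1.1.2 + 1) (i.1.2 - 1)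

theorem incrementArray_eq_shapeArray [IsOrderedAddMonoid R] (n : ℕ) {x : ℕ × ℕ → R}
    (hx : ∀ v, 0 ≤ x v) : incrementArray n x = shapeArray n x := by
  funext i
  rw [shapeArray, ← increment_eq_shape hx, Nat.sub_add_cancel i.one_le, incrementArray]

theorem energy_shapeArray [IsOrderedAddMonoid R] (n : ℕ) {x : ℕ × ℕ → R} (hx : ∀ v, 0 ≤ x v) :
    energy n (shapeArray n x) = ∑ v ∈ triangle (n + 2), x v := by
  refine (energy_eq_sum n fun i => shape x (i.1.1 + 1) (i.1.2 + 1) (i.2 - 1)).trans ?_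
  rw [sum_idx (shape x), sum_idx (shape x), sum_cells, sum_cells, ← sum_rectangle_sub]
  simp only [sum_shape hx]

theorem shapeArray_congr (n : ℕ) {x y : ℕ × ℕ → R} (h : ∀ v ∈ triangle (n + 2), x v = y v) :
    shapeArray n x = shapeArray n y := by
  funext i
  refine shape_congr (fun c hc d hd => h _ (mem_triangle.2 ?_)) _
  obtain ⟨⟨⟨a, b⟩, k⟩, hi⟩ := i
  rw [Finset.mem_union, mem_idx, mem_idx] at hi
  dsimp only at hc hd ⊢
  omega

/-- The extension of an array on `I_n ∪ I_{n+1}` by zero, indexed by half-open rectangles. -/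
def extendArray {n : ℕ} (p : Idx n → R) (a b k : ℕ) : R :=
  if h : ((a - 1, b - 1), k + 1) ∈ idx n ∪ idx (n + 1) ∧ 0 < a ∧ 0 < b then p ⟨_, h.1⟩ else 0

omit [LinearOrder R] in
theorem extendArray_apply {n : ℕ} (p : Idx n → R) (i : Idx n) :
    extendArray p (i.1.1.1 + 1) (i.1.1.2 + 1) (i.1.2 - 1) = p i := by
  have h1 := i.one_le
  have h2 : ((i.1.1.1 + 1 - 1, i.1.1.2 + 1 - 1), i.1.2 - 1 + 1) = i.1 := by
    rw [Nat.sub_add_cancel h1]; rfl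
  rw [extendArray, dif_pos ⟨h2 ▸ i.2, Nat.succ_pos _, Nat.succ_pos _⟩]
  congr 1
  exact Subtype.ext h2

omit [LinearOrder R] in
theorem extendArray_of_le {n : ℕ} (p : Idx n → R) {a b k : ℕ} (h : min a b ≤ k) :
    extendArray p a b k = 0 := by
  rw [extendArray, dif_neg]
  rw [Finset.mem_union, mem_idx, mem_idx]
  omega

omit [LinearOrder R] in
theorem exists_idx_extendArray {n : ℕ} (p : Idx n → R) {a b k : ℕ} (h1 : n + 2 ≤ a + b)
    (h2 : a + b ≤ n + 3) (hk : k < min a b) : ∃ i : Idx n, extendArray p a b k = p i ∧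
      i.1 = ((a - 1, b - 1), k + 1) := by
  have h : ((a - 1, b - 1), k + 1) ∈ idx n ∪ idx (n + 1) ∧ 0 < a ∧ 0 < b := by
    rw [Finset.mem_union, mem_idx, mem_idx]
    omega
  exact ⟨⟨_, h.1⟩, by rw [extendArray, dif_pos h], rfl⟩

/-- Missing entries count as zero, so the inequalities that involve them amount to non-negativity.
-/
theorem levelInterlacing_extendArray_iff (n : ℕ) (p : Idx n → R) :
    LevelInterlacing (n + 2) (extendArray p) ↔ Interlacing n p := by
  constructor
  · intro h
    refine ⟨fun i => ?_, fun i j hij => ?_⟩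
    · rw [← extendArray_apply p i]
      obtain ⟨⟨⟨a, b⟩, k⟩, hi⟩ := i
      rw [Finset.mem_union, mem_idx, mem_idx] at hi
      dsimp only
      rcases hi with hi | hi
      · exact h.nonneg _ _ _ (by omega)
      · exact h.nonneg_succ _ _ _ (by omega)
    · rw [← extendArray_apply p i, ← extendArray_apply p j]
      have hi1 := i.one_le
      obtain ⟨⟨⟨a, b⟩, k⟩, hi⟩ := i
      obtain ⟨⟨⟨c, d⟩, l⟩, hj⟩ := j
      rw [Finset.mem_union, mem_idx, mem_idx] at hi hj
      dsimp only at hij hi1 ⊢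
      have hsum := hij.sum_eq
      dsimp only at hsum
      rcases hij with e | e
      · obtain ⟨rfl, rfl⟩ := Prod.mk.inj e
        refine ⟨fun e => ?_, fun e => ?_⟩
        · rw [e]
          exact h.le_right _ _ _ (by omega)
        · rw [e, (by omega : k + 1 - 1 = (k - 1) + 1)]
          exact h.right_le _ _ _ (by omega)
      · obtain ⟨rfl, rfl⟩ := Prod.mk.inj e
        refine ⟨fun e => ?_, fun e => ?_⟩
        · rw [e]
          exact h.le_up _ _ _ (by omega)
        · rw [e, (by omega : k + 1 - 1 = (k - 1) + 1)]
          exact h.up_le _ _ _ (by omega)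
  · rintro ⟨h0, h⟩
    have nn : ∀ a b k, n + 2 ≤ a + b → a + b ≤ n + 3 → 0 ≤ extendArray p a b k := by
      intro a b k h1 h2
      by_cases hk : k < min a b
      · obtain ⟨i, e, -⟩ := exists_idx_extendArray p h1 h2 hk
        rw [e]; exact h0 i
      · rw [extendArray_of_le p (by omega)]
    have le1 : ∀ a b c d k, a + b = n + 2 → (c = a + 1 ∧ d = b ∨ c = a ∧ d = b + 1) →
        extendArray p a b k ≤ extendArray p c d k := by
      intro a b c d k hs hcd
      by_cases hk : k < min a b
      · obtain ⟨i, e, hi⟩ := exists_idx_extendArray p (by omega) (by omega) hk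
        obtain ⟨j, e', hj⟩ := exists_idx_extendArray p (a := c) (b := d) (k := k)
          (by omega) (by omega) (by omega)
        rw [e, e']
        refine (h i j ?_).1 (by rw [hi, hj])
        rw [hi, hj]
        rcases hcd with ⟨rfl, rfl⟩ | ⟨rfl, rfl⟩
        · exact Or.inl (by simp; omega)
        · exact Or.inr (by simp; omega)
      · rw [extendArray_of_le p (by omega)]
        exact nn _ _ _ (by omega) (by omega)
    have le2 : ∀ a b c d k, a + b = n + 2 → (c = a + 1 ∧ d = b ∨ c = a ∧ d = b + 1) →
        extendArray p c d (k + 1) ≤ extendArray p a b k := by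
      intro a b c d k hs hcd
      by_cases hk : k + 1 < min c d
      · obtain ⟨i, e, hi⟩ := exists_idx_extendArray p (a := a) (b := b) (k := k)
          (by omega) (by omega) (by omega)
        obtain ⟨j, e', hj⟩ := exists_idx_extendArray p (a := c) (b := d) (k := k + 1)
          (by omega) (by omega) hk
        rw [e, e']
        refine (h i j ?_).2 (by rw [hi, hj])
        rw [hi, hj]
        rcases hcd with ⟨rfl, rfl⟩ | ⟨rfl, rfl⟩
        · exact Or.inl (by simp; omega)
        · exact Or.inr (by simp; omega)
      · rw [extendArray_of_le p (by omega)]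
        exact nn _ _ _ (by omega) (by omega)
    exact ⟨fun a b k hs => nn _ _ _ (by omega) (by omega),
      fun a b k hs => nn _ _ _ (by omega) (by omega),
      fun a b k hs => le1 _ _ _ _ _ hs (Or.inl ⟨rfl, rfl⟩),
      fun a b k hs => le1 _ _ _ _ _ hs (Or.inr ⟨rfl, rfl⟩),
      fun a b k hs => le2 _ _ _ _ _ hs (Or.inl ⟨rfl, rfl⟩),
      fun a b k hs => le2 _ _ _ _ _ hs (Or.inr ⟨rfl, rfl⟩)⟩

theorem extendArray_shapeArray (n : ℕ) (x : ℕ × ℕ → R) {a b : ℕ} (k : ℕ) (h1 : n + 2 ≤ a + b)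
    (h2 : a + b ≤ n + 3) : extendArray (shapeArray n x) a b k = shape x a b k := by
  by_cases hk : k < min a b
  · obtain ⟨i, e, hi⟩ := exists_idx_extendArray (shapeArray n x) h1 h2 hk
    rw [e, shapeArray, hi]
    dsimp only
    rw [Nat.sub_add_cancel (by omega), Nat.sub_add_cancel (by omega), Nat.add_sub_cancel]
  · rw [extendArray_of_le _ (by omega), shape_eq_zero _ (by omega)]

theorem LevelInterlacing.congr {s : ℕ} {p q : ℕ → ℕ → ℕ → R} (h : LevelInterlacing s p)
    (hpq : ∀ a b k, s ≤ a + b → a + b ≤ s + 1 → p a b k = q a b k) : LevelInterlacing s q := by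
  constructor <;> intro a b k hs
  · rw [← hpq _ _ _ (by omega) (by omega)]
    exact h.nonneg a b k hs
  · rw [← hpq _ _ _ (by omega) (by omega)]
    exact h.nonneg_succ a b k hs
  · rw [← hpq _ _ _ (by omega) (by omega), ← hpq _ _ _ (by omega) (by omega)]
    exact h.le_right a b k hs
  · rw [← hpq _ _ _ (by omega) (by omega), ← hpq _ _ _ (by omega) (by omega)]
    exact h.le_up a b k hs
  · rw [← hpq _ _ _ (by omega) (by omega), ← hpq _ _ _ (by omega) (by omega)]
    exact h.right_le a b k hs
  · rw [← hpq _ _ _ (by omega) (by omega), ← hpq _ _ _ (by omega) (by omega)]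
    exact h.up_le a b k hs

variable [IsOrderedAddMonoid R]

theorem interlacing_shapeArray_iff (n : ℕ) (x : ℕ × ℕ → R) :
    Interlacing n (shapeArray n x) ↔ ∀ v ∈ triangle (n + 2), 0 ≤ x v := by
  rw [← levelInterlacing_extendArray_iff]
  trans LevelInterlacing (n + 2) (shape x)
  · exact ⟨fun h => h.congr fun a b k h1 h2 => extendArray_shapeArray n x k h1 h2,
      fun h => h.congr fun a b k h1 h2 => (extendArray_shapeArray n x k h1 h2).symm⟩
  · rw [levelInterlacing_shape_iff]
    exact ⟨fun h v hv => h v.1 v.2 (mem_triangle.1 hv), fun h a b hab => h _ (mem_triangle.2 hab)⟩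

theorem exists_shapeArray_eq {n : ℕ} {p : Idx n → R} (hp : Interlacing n p) :
    ∃ x : ℕ × ℕ → R, (∀ v, 0 ≤ x v) ∧ (∀ v ∉ triangle (n + 2), x v = 0) ∧
      shapeArray n x = p := by
  obtain ⟨x, h1, h2, h3⟩ := exists_shape_eq ((levelInterlacing_extendArray_iff n p).2 hp)
    fun a b k _ _ hk => extendArray_of_le p hk
  refine ⟨x, h1, fun v hv => h2 v (not_lt.1 fun h => hv (mem_triangle.2 h)), ?_⟩
  funext i
  rw [← extendArray_apply p i, shapeArray]
  obtain ⟨⟨⟨a, b⟩, k⟩, hi⟩ := i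
  rw [Finset.mem_union, mem_idx, mem_idx] at hi
  exact h3 _ _ _ (by dsimp only; omega) (by dsimp only; omega)

theorem shapeArray_injOn {n : ℕ} {x y : ℕ × ℕ → R} (h : shapeArray n x = shapeArray n y) :
    ∀ v ∈ triangle (n + 2), x v = y v := by
  refine fun v hv => shape_injective (s := n + 2) (fun a b k h1 h2 hk => ?_) v.1 v.2
    (mem_triangle.1 hv)
  rw [← extendArray_shapeArray n x k h1 h2, ← extendArray_shapeArray n y k h1 h2, h]

end Array

theorem rskMap_bijOn (n : ℕ) :
    Set.BijOn (rskMap n) {t | ∀ v, 0 ≤ t v} {p | Interlacing n p} := by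
  set e : (Triangle (n + 1) → ℤ) → ℕ × ℕ → ℤ := fun t v =>
    if h : v.1 + v.2 ≤ n + 1 then t ⟨v, h⟩ else 0 with he
  have hpos : ∀ t, (∀ v, 0 ≤ t v) → ∀ v, 0 ≤ e t v := fun t ht v => by
    simp only [he]
    split_ifs with h
    · exact ht _
    · exact le_rfl
  have happly : ∀ t (v : Triangle (n + 1)), e t v.1 = t v := fun t v => dif_pos v.2
  have hmap : ∀ t, (∀ v, 0 ≤ t v) → rskMap n t = shapeArray n (e t) := fun t ht =>
    incrementArray_eq_shapeArray n (hpos t ht)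
  refine ⟨fun t ht => ?_, fun t ht t' ht' h => ?_, fun p hp => ?_⟩
  · rw [Set.mem_ofPred_eq, hmap t ht, interlacing_shapeArray_iff]
    exact fun v _ => hpos t ht v
  · rw [hmap t ht, hmap t' ht'] at h
    funext v
    rw [← happly t, ← happly t']
    exact shapeArray_injOn h v.1 (mem_triangle.2 (by have := v.2; omega))
  · obtain ⟨x, h1, h2, rfl⟩ := exists_shapeArray_eq hp
    refine ⟨fun v => x v.1, fun v => h1 _, ?_⟩
    rw [hmap _ fun v => h1 _]
    refine shapeArray_congr n fun v hv => ?_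
    simp only [he]
    rw [dif_pos (by have := mem_triangle.1 hv; omega)]

end LPP


/-! ### Geometric weights -/

namespace LPP

theorem card_triangle (s : ℕ) : (triangle s).card = s * (s + 1) / 2 := by
  have h : ∀ s, 2 * (triangle s).card = s * (s + 1) := fun s => by
    induction s with
    | zero => rfl
    | succ s ih =>
      have h : triangle (s + 1) = triangle s ∪ Finset.HasAntidiagonal.antidiagonal s := by
        ext v
        simp only [mem_triangle, Finset.mem_union, Finset.HasAntidiagonal.mem_antidiagonal]
        omega
      rw [h, Finset.card_union_of_disjoint, mul_add, ih, Finset.Nat.card_antidiagonal]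
      · ring
      · rw [Finset.disjoint_left]
        intro v
        simp only [mem_triangle, Finset.HasAntidiagonal.mem_antidiagonal]
        omega
  have := h s
  omega

/-- By the bijection, prescribing the array means prescribing every weight in the triangle; the
exponents of `β` add up to the energy. -/
theorem measureReal_incrementArray_eq_of_geometric (n : ℕ) {β : ℝ} (h0 : 0 < β) (h1 : β < 1)
    {Ω : Type*} [MeasurableSpace Ω] (μ : Measure Ω) [IsProbabilityMeasure μ]
    (ξ : ℕ × ℕ → Ω → ℕ) (hξ : iIndepFun ξ μ)
    (hlaw : ∀ v, HasLaw (ξ v)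
      (geometricMeasure ⟨1 - β, sub_nonneg.2 h1.le, sub_le_self 1 h0.le⟩) μ)
    {p : Idx n → ℤ} (hp : Interlacing n p) :
    μ.real {ω | incrementArray n (fun v => (ξ v ω : ℤ)) = p} =
      (1 - β) ^ ((n + 2) * (n + 3) / 2) * β ^ energy n p := by
  obtain ⟨x, hx, -, rfl⟩ := exists_shapeArray_eq hp
  have hset : {ω | incrementArray n (fun v => (ξ v ω : ℤ)) = shapeArray n x} =
      ⋂ v ∈ triangle (n + 2), ξ v ⁻¹' {(x v).toNat} := by
    ext ω
    simp only [Set.mem_ofPred_eq, Set.mem_iInter, Set.mem_preimage, Set.mem_singleton_iff]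
    rw [incrementArray_eq_shapeArray n fun v => Int.natCast_nonneg _]
    constructor
    · intro h v hv
      have := shapeArray_injOn h v hv
      omega
    · intro h
      refine shapeArray_congr n fun v hv => ?_
      rw [h v hv, Int.toNat_of_nonneg (hx v)]
  have hv : ∀ v, (μ (ξ v ⁻¹' {(x v).toNat})).toReal = (1 - β) * β ^ (x v).toNat := fun v => by
    rw [← Measure.map_apply_of_aemeasurable (hlaw v).aemeasurable (measurableSet_singleton _),
      (hlaw v).map_eq]
    refine (geometricMeasure_real_singleton (fun h => ?_) _).trans ?_
    · have := congrArg Subtype.val h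
      simp at this
      linarith
    · simp [mul_comm]
  rw [hset, Measure.real, hξ.measure_inter_preimage_eq_mul _ fun v _ => measurableSet_singleton _,
    ENNReal.toReal_prod, Finset.prod_congr rfl fun v _ => hv v, Finset.prod_mul_distrib,
    Finset.prod_const, card_triangle, Finset.prod_pow_eq_pow_sum, energy_shapeArray n hx,
    ← zpow_natCast β, Nat.cast_sum, Finset.sum_congr rfl fun v _ => Int.toNat_of_nonneg (hx v)]

end LPP


/-! ### Volume preservation of the growth -/

namespace LPP

section Pi

variable {ι ι' κ : Type*} [Fintype ι] [Fintype ι'] [Fintype κ] {f : ι → κ} {g : ι' → κ}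

theorem measurePreserving_pi_split (h : Function.Bijective (Sum.elim f g)) :
    MeasurePreserving (fun y : κ → ℝ => (fun i => y (f i), fun j => y (g j))) := by
  have h1 := (volume_measurePreserving_piCongrLeft (fun _ : κ => ℝ)
    (Equiv.ofBijective _ h)).symm
  exact (volume_measurePreserving_sumPiEquivProdPi fun _ : ι ⊕ ι' => ℝ).comp h1

theorem measurePreserving_pi_join (h : Function.Bijective (Sum.elim f g))
    {F : (ι → ℝ) × (ι' → ℝ) → κ → ℝ} (hf : ∀ p i, F p (f i) = p.1 i)
    (hg : ∀ p j, F p (g j) = p.2 j) : MeasurePreserving F := by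
  have h1 := volume_measurePreserving_piCongrLeft (fun _ : κ => ℝ) (Equiv.ofBijective _ h)
  have h2 := h1.comp (volume_measurePreserving_sumPiEquivProdPi_symm fun _ : ι ⊕ ι' => ℝ)
  refine cast (congrArg (fun G => MeasurePreserving G volume volume) ?_) h2
  funext p k
  obtain ⟨k, rfl⟩ := (Equiv.ofBijective _ h).surjective k
  rw [Function.comp_apply, MeasurableEquiv.coe_piCongrLeft, Equiv.piCongrLeft_apply_apply]
  rcases k with i | j
  · exact (hf p i).symm
  · exact (hg p j).symm

theorem measurePreserving_pi_join_affine (h : Function.Bijective (Sum.elim f g))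
    {F : (ι → ℝ) × (ι' → ℝ) → κ → ℝ} (a : ι → ℝ) (b : ι' → ℝ)
    (hf : ∀ p i, F p (f i) = a i - p.1 i) (hg : ∀ p j, F p (g j) = b j + p.2 j) :
    MeasurePreserving F := by
  classical
  set e := Equiv.ofBijective _ h with he
  have h1 : MeasurePreserving (fun p : (ι → ℝ) × (ι' → ℝ) =>
      ((fun i => a i - p.1 i : ι → ℝ), (fun j => b j + p.2 j : ι' → ℝ))) :=
    (volume_preserving_pi fun i => Measure.measurePreserving_sub_left volume (a i)).prod
      (volume_preserving_pi fun j => measurePreserving_add_left volume (b j))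
  have h2 : MeasurePreserving fun (p : (ι → ℝ) × (ι' → ℝ)) k => Sum.elim p.1 p.2 (e.symm k) :=
    measurePreserving_pi_join h
      (fun p i => congrArg (Sum.elim p.1 p.2) (e.symm_apply_apply (Sum.inl i)))
      (fun p j => congrArg (Sum.elim p.1 p.2) (e.symm_apply_apply (Sum.inr j)))
  convert h2.comp h1 using 1
  funext p k
  obtain ⟨k, rfl⟩ := e.surjective k
  rw [Function.comp_apply, e.symm_apply_apply]
  rcases k with i | j
  · exact hf p i
  · exact hg p j

end Pi

section Volume

/-- The extension by zero of weights on a triangle. -/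
noncomputable def extendWeights (s : ℕ) (y : triangle s → ℝ) (v : ℕ × ℕ) : ℝ :=
  if h : v ∈ triangle s then y ⟨v, h⟩ else 0

theorem extendWeights_apply {s : ℕ} (y : triangle s → ℝ) {v : ℕ × ℕ} (h : v ∈ triangle s) :
    extendWeights s y v = y ⟨v, h⟩ := dif_pos h

/-- The shapes of the rectangles with half-perimeter `s` or `s + 1`. -/
noncomputable def levelShapes (s : ℕ) (y : triangle s → ℝ) : (cells s → ℝ) × (cells (s + 1) → ℝ) :=
  (fun c => shape (extendWeights s y) c.1.1.1 c.1.1.2 c.1.2,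
    fun c => shape (extendWeights s y) c.1.1.1 c.1.1.2 c.1.2)

/-- The extension by zero of the rows of the shapes on one level. -/
noncomputable def extendCells {s : ℕ} (q : cells s → ℝ) (a b k : ℕ) : ℝ :=
  if h : ((a, b), k) ∈ cells s then q ⟨_, h⟩ else 0

theorem extendCells_shape {s : ℕ} (x : ℕ × ℕ → ℝ) {a b : ℕ} (k : ℕ) (h : a + b = s) :
    extendCells (fun c : cells s => shape x c.1.1.1 c.1.1.2 c.1.2) a b k = shape x a b k := by
  by_cases hk : k < min a b
  · rw [extendCells, dif_pos (mem_cells.2 ⟨h, hk⟩)]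
  · rw [shape_eq_zero x (not_lt.1 hk), extendCells, dif_neg fun h => hk (mem_cells.1 h).2]

theorem measurable_extendCells (s a b k : ℕ) :
    Measurable fun q : cells s → ℝ => extendCells q a b k := by
  unfold extendCells
  split_ifs
  · fun_prop
  · fun_prop

/-- The local rule: the shapes of half-perimeter `s + 2` in terms of those of half-perimeter
`s` and `s + 1` and the weights on the antidiagonal. -/
noncomputable def growLevel (s : ℕ) (q : cells (s + 1) → ℝ)
    (py : (cells s → ℝ) × (Finset.HasAntidiagonal.antidiagonal s → ℝ)) (c : cells (s + 2)) : ℝ :=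
  if h : c.1.2 = 0 then
    max (extendCells q c.1.1.1 (c.1.1.2 - 1) 0) (extendCells q (c.1.1.1 - 1) c.1.1.2 0) +
      py.2 ⟨(c.1.1.1 - 1, c.1.1.2 - 1), by
        have := mem_cells.1 c.2
        rw [Finset.HasAntidiagonal.mem_antidiagonal]
        dsimp only
        omega⟩
  else
    max (extendCells q c.1.1.1 (c.1.1.2 - 1) c.1.2) (extendCells q (c.1.1.1 - 1) c.1.1.2 c.1.2) +
      min (extendCells q c.1.1.1 (c.1.1.2 - 1) (c.1.2 - 1))
        (extendCells q (c.1.1.1 - 1) c.1.1.2 (c.1.2 - 1)) -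
      py.1 ⟨((c.1.1.1 - 1, c.1.1.2 - 1), c.1.2 - 1), by
        have := mem_cells.1 c.2
        rw [mem_cells]
        dsimp only
        omega⟩

theorem measurable_growLevel (s : ℕ) : Measurable (Function.uncurry (growLevel s)) := by
  refine measurable_pi_lambda _ fun c => ?_
  have h : ∀ a b k, Measurable fun z : (cells (s + 1) → ℝ) ×
      ((cells s → ℝ) × (Finset.HasAntidiagonal.antidiagonal s → ℝ)) => extendCells z.1 a b k :=
    fun a b k => (measurable_extendCells _ a b k).comp measurable_fst
  simp only [Function.uncurry, growLevel]
  split_ifs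
  · exact ((h _ _ _).max (h _ _ _)).add (by fun_prop)
  · exact (((h _ _ _).max (h _ _ _)).add ((h _ _ _).min (h _ _ _))).sub (by fun_prop)

/-- Once the middle level `q` is fixed, the maxima and minima are constants: each new coordinate is
a constant minus one old entry or a constant plus one weight, and each of these is used exactly
once. -/
theorem measurePreserving_growLevel (s : ℕ) (q : cells (s + 1) → ℝ) :
    MeasurePreserving (growLevel s q) := by
  have hf : ∀ c : cells s, ((c.1.1.1 + 1, c.1.1.2 + 1), c.1.2 + 1) ∈ cells (s + 2) := fun c => by
    have := mem_cells.1 c.2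
    rw [mem_cells]
    dsimp only
    omega
  have hg : ∀ v : Finset.HasAntidiagonal.antidiagonal s,
      ((v.1.1 + 1, v.1.2 + 1), 0) ∈ cells (s + 2) := fun v => by
    have := Finset.HasAntidiagonal.mem_antidiagonal.1 v.2
    rw [mem_cells]
    dsimp only
    omega
  refine measurePreserving_pi_join_affine (f := fun c => ⟨_, hf c⟩) (g := fun v => ⟨_, hg v⟩) ?_
    (fun c => max (extendCells q (c.1.1.1 + 1) c.1.1.2 (c.1.2 + 1))
        (extendCells q c.1.1.1 (c.1.1.2 + 1) (c.1.2 + 1)) +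
      min (extendCells q (c.1.1.1 + 1) c.1.1.2 c.1.2)
        (extendCells q c.1.1.1 (c.1.1.2 + 1) c.1.2))
    (fun v => max (extendCells q (v.1.1 + 1) v.1.2 0) (extendCells q v.1.1 (v.1.2 + 1) 0))
    (fun p c => ?_) (fun p v => ?_)
  · constructor
    · rintro (⟨⟨⟨a, b⟩, k⟩, h⟩ | ⟨⟨a, b⟩, h⟩) (⟨⟨⟨a', b'⟩, k'⟩, h'⟩ | ⟨⟨a', b'⟩, h'⟩) e <;>
        simp_all
    · rintro ⟨⟨⟨a, b⟩, k⟩, h⟩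
      have h' := mem_cells.1 h
      dsimp only at h'
      obtain ⟨a, rfl⟩ := Nat.exists_eq_add_one.2 (show 0 < a by omega)
      obtain ⟨b, rfl⟩ := Nat.exists_eq_add_one.2 (show 0 < b by omega)
      rcases k with _ | k
      · exact ⟨Sum.inr ⟨(a, b), Finset.HasAntidiagonal.mem_antidiagonal.2 (by dsimp only; omega)⟩, rfl⟩
      · exact ⟨Sum.inl ⟨((a, b), k), mem_cells.2 (by dsimp only; omega)⟩, rfl⟩
  · rw [growLevel, dif_neg (by simp)]
    rfl
  · rw [growLevel, dif_pos (by rfl)]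
    rfl

theorem levelShapes_succ (s : ℕ) (y : triangle (s + 1) → ℝ)
    (h1 : ∀ v : triangle s, v.1 ∈ triangle (s + 1))
    (h2 : ∀ v : Finset.HasAntidiagonal.antidiagonal s, v.1 ∈ triangle (s + 1)) :
    levelShapes (s + 1) y = ((levelShapes s fun v => y ⟨_, h1 v⟩).2,
      growLevel s (levelShapes s fun v => y ⟨_, h1 v⟩).2
        ((levelShapes s fun v => y ⟨_, h1 v⟩).1, fun v => y ⟨_, h2 v⟩)) := by
  have key : ∀ {a b : ℕ} (k : ℕ), a + b ≤ s + 1 →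
      shape (extendWeights s fun v => y ⟨_, h1 v⟩) a b k = shape (extendWeights (s + 1) y) a b k := by
    refine fun {a b} k hab => shape_congr (fun c hc d hd => ?_) k
    have h : (c, d) ∈ triangle s := mem_triangle.2 (by dsimp only; omega)
    rw [extendWeights_apply _ h, extendWeights_apply _ (h1 ⟨_, h⟩)]
  refine Prod.ext ?_ ?_
  · funext c
    exact (key _ (mem_cells.1 c.2).1.le).symm
  · funext ⟨⟨⟨a, b⟩, k⟩, h⟩
    have h' := mem_cells.1 h
    dsimp only at h'
    obtain ⟨a, rfl⟩ := Nat.exists_eq_add_one.2 (show 0 < a by omega)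
    obtain ⟨b, rfl⟩ := Nat.exists_eq_add_one.2 (show 0 < b by omega)
    have hv : (a, b) ∈ triangle (s + 1) := mem_triangle.2 (by dsimp only; omega)
    dsimp only
    rcases k with _ | k
    · rw [growLevel, dif_pos (by rfl)]
      simp only [levelShapes, Nat.add_sub_cancel]
      rw [extendCells_shape _ _ (by omega), extendCells_shape _ _ (by omega), key _ (by omega),
        key _ (by omega), shape_succ_zero, extendWeights_apply _ hv]
    · rw [growLevel, dif_neg (by simp)]
      simp only [levelShapes, Nat.add_sub_cancel]
      rw [extendCells_shape _ _ (by omega), extendCells_shape _ _ (by omega),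
        extendCells_shape _ _ (by omega), extendCells_shape _ _ (by omega), key _ (by omega),
        key _ (by omega), key _ (by omega), key _ (by omega), key _ (by omega),
        shape_succ_succ _ (by omega)]

/-- One step of growth is a skew product over the level which is kept, with volume preserving maps
in the fibres. At `s = 0` all the spaces are single points. -/
theorem measurePreserving_levelShapes (s : ℕ) : MeasurePreserving (levelShapes s) := by
  induction s with
  | zero =>
    have h0 : IsEmpty (cells 0) := ⟨fun c => by have := mem_cells.1 c.2; omega⟩
    have h1 : IsEmpty (cells (0 + 1)) := ⟨fun c => by have := mem_cells.1 c.2; omega⟩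
    have h2 : IsEmpty (triangle 0) := ⟨fun c => by have := mem_triangle.1 c.2; omega⟩
    have hm : Measurable (levelShapes 0) := measurable_of_subsingleton_codomain _
    refine ⟨hm, ?_⟩
    rw [Measure.volume_pi_eq_dirac (fun i => h2.elim i), Measure.map_dirac' hm,
      Measure.volume_eq_prod, Measure.volume_pi_eq_dirac (fun i => h0.elim i),
      Measure.volume_pi_eq_dirac (fun i => h1.elim i), Measure.dirac_prod_dirac]
    congr 1
    exact Subsingleton.elim _ _
  | succ s ih =>
    have h1 : ∀ v : triangle s, v.1 ∈ triangle (s + 1) := fun v =>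
      mem_triangle.2 ((mem_triangle.1 v.2).trans (Nat.lt_succ_self s))
    have h2 : ∀ v : Finset.HasAntidiagonal.antidiagonal s, v.1 ∈ triangle (s + 1) := fun v =>
      mem_triangle.2 (Nat.lt_succ_of_le (Finset.HasAntidiagonal.mem_antidiagonal.1 v.2).le)
    have hb : Function.Bijective (Sum.elim (fun v => (⟨_, h1 v⟩ : triangle (s + 1)))
        fun v => ⟨_, h2 v⟩) := by
      constructor
      · rintro (⟨v, h⟩ | ⟨v, h⟩) (⟨w, h'⟩ | ⟨w, h'⟩) e <;>
          simp only [Sum.elim_inl, Sum.elim_inr, Subtype.mk.injEq] at e <;> subst e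
        · rfl
        · rw [mem_triangle] at h
          rw [Finset.HasAntidiagonal.mem_antidiagonal] at h'
          omega
        · rw [mem_triangle] at h'
          rw [Finset.HasAntidiagonal.mem_antidiagonal] at h
          omega
        · rfl
      · rintro ⟨v, h⟩
        rcases Nat.lt_succ_iff_lt_or_eq.1 (mem_triangle.1 h) with h' | h'
        · exact ⟨Sum.inl ⟨v, mem_triangle.2 h'⟩, rfl⟩
        · exact ⟨Sum.inr ⟨v, Finset.HasAntidiagonal.mem_antidiagonal.2 h'⟩, rfl⟩
    have hS : MeasurePreserving fun z : (cells (s + 1) → ℝ) ×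
        ((cells s → ℝ) × (Finset.HasAntidiagonal.antidiagonal s → ℝ)) =>
          (z.1, growLevel s z.1 z.2) :=
      MeasurePreserving.skew_product (MeasurePreserving.id volume) (measurable_growLevel s)
        (Filter.Eventually.of_forall fun q => (measurePreserving_growLevel s q).map_eq)
    have hA : MeasurePreserving fun z : ((cells s → ℝ) × (cells (s + 1) → ℝ)) ×
        (Finset.HasAntidiagonal.antidiagonal s → ℝ) => (z.1.2, (z.1.1, z.2)) :=
      (volume_preserving_prodAssoc (α₁ := cells (s + 1) → ℝ) (β₁ := cells s → ℝ)
        (γ₁ := Finset.HasAntidiagonal.antidiagonal s → ℝ)).comp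
        ((Measure.measurePreserving_swap (μ := (volume : Measure (cells s → ℝ)))
          (ν := (volume : Measure (cells (s + 1) → ℝ)))).prod (MeasurePreserving.id volume))
    have h := hS.comp (hA.comp ((ih.prod (MeasurePreserving.id volume)).comp
      (measurePreserving_pi_split hb)))
    convert h using 1
    funext y
    exact levelShapes_succ s y h1 h2

theorem measurePreserving_shapeArray (n : ℕ) :
    MeasurePreserving fun y : triangle (n + 2) → ℝ => shapeArray n (extendWeights (n + 2) y) := by
  have hf : ∀ c : cells (n + 2), ((c.1.1.1 - 1, c.1.1.2 - 1), c.1.2 + 1) ∈ idx n ∪ idx (n + 1) :=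
    fun c => by
      have := mem_cells.1 c.2
      rw [Finset.mem_union, mem_idx, mem_idx]
      omega
  have hg : ∀ c : cells (n + 2 + 1),
      ((c.1.1.1 - 1, c.1.1.2 - 1), c.1.2 + 1) ∈ idx n ∪ idx (n + 1) := fun c => by
    have := mem_cells.1 c.2
    rw [Finset.mem_union, mem_idx, mem_idx]
    omega
  have hb : Function.Bijective (Sum.elim (fun c => (⟨_, hf c⟩ : Idx n)) fun c => ⟨_, hg c⟩) := by
    constructor
    · rintro (⟨⟨⟨a, b⟩, k⟩, h⟩ | ⟨⟨⟨a, b⟩, k⟩, h⟩) (⟨⟨⟨a', b'⟩, k'⟩, h'⟩ | ⟨⟨⟨a', b'⟩, k'⟩, h'⟩) e <;>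
        rw [mem_cells] at h h' <;>
        simp only [Sum.elim_inl, Sum.elim_inr, Subtype.mk.injEq, Prod.mk.injEq, Sum.inl.injEq,
          Sum.inr.injEq, reduceCtorEq] at e h h' ⊢ <;> omega
    · rintro ⟨⟨⟨a, b⟩, k⟩, h⟩
      rw [Finset.mem_union, mem_idx, mem_idx] at h
      obtain ⟨k, rfl⟩ := Nat.exists_eq_add_one.2 (show 0 < k by omega)
      by_cases hn : a + b = n
      · exact ⟨Sum.inl ⟨((a + 1, b + 1), k), mem_cells.2 (by dsimp only; omega)⟩, rfl⟩
      · exact ⟨Sum.inr ⟨((a + 1, b + 1), k), mem_cells.2 (by dsimp only; omega)⟩, rfl⟩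
  set e := Equiv.ofBijective _ hb with he
  have h2 : MeasurePreserving fun (p : (cells (n + 2) → ℝ) × (cells (n + 2 + 1) → ℝ)) k =>
      Sum.elim p.1 p.2 (e.symm k) :=
    measurePreserving_pi_join hb
      (fun p i => congrArg (Sum.elim p.1 p.2) (e.symm_apply_apply (Sum.inl i)))
      (fun p j => congrArg (Sum.elim p.1 p.2) (e.symm_apply_apply (Sum.inr j)))
  convert h2.comp (measurePreserving_levelShapes (n + 2)) using 1
  funext y i
  obtain ⟨c, rfl⟩ := e.surjective i
  rw [Function.comp_apply, e.symm_apply_apply]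
  rcases c with ⟨⟨⟨a, b⟩, k⟩, h⟩ | ⟨⟨⟨a, b⟩, k⟩, h⟩ <;>
  · have h' := mem_cells.1 h
    dsimp only at h'
    obtain ⟨a, rfl⟩ := Nat.exists_eq_add_one.2 (show 0 < a by omega)
    obtain ⟨b, rfl⟩ := Nat.exists_eq_add_one.2 (show 0 < b by omega)
    rfl

end Volume

end LPP


/-! ### The density for exponential weights -/

namespace LPP

theorem lintegral_pi_prod_ofReal {ι : Type*} [Fintype ι] {X : ι → Type*}
    [∀ i, MeasurableSpace (X i)] (μ : ∀ i, Measure (X i)) [∀ i, SigmaFinite (μ i)]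
    {g : ∀ i, X i → ℝ} (h0 : ∀ i x, 0 ≤ g i x) (hg : ∀ i, Integrable (g i) (μ i)) :
    ∫⁻ x, ∏ i, ENNReal.ofReal (g i (x i)) ∂Measure.pi μ =
      ∏ i, ∫⁻ x, ENNReal.ofReal (g i x) ∂μ i := by
  simp only [← ENNReal.ofReal_prod_of_nonneg fun i _ => h0 i _]
  rw [← ofReal_integral_eq_lintegral_ofReal (Integrable.fintype_prod_dep hg)
    (Filter.Eventually.of_forall fun x => Finset.prod_nonneg fun i _ => h0 i _),
    integral_fintype_prod_eq_prod, ENNReal.ofReal_prod_of_nonneg fun i _ => integral_nonneg (h0 i)]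
  exact Finset.prod_congr rfl fun i _ =>
    ofReal_integral_eq_lintegral_ofReal (hg i) (Filter.Eventually.of_forall (h0 i))

theorem pi_withDensity_ofReal {ι : Type*} [Fintype ι] {X : ι → Type*}
    [∀ i, MeasurableSpace (X i)] (μ : ∀ i, Measure (X i)) [∀ i, SigmaFinite (μ i)]
    {g : ∀ i, X i → ℝ} (h0 : ∀ i x, 0 ≤ g i x) (hg : ∀ i, Integrable (g i) (μ i)) :
    Measure.pi (fun i => (μ i).withDensity fun x => ENNReal.ofReal (g i x)) =
      (Measure.pi μ).withDensity fun x => ∏ i, ENNReal.ofReal (g i (x i)) := by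
  have hf : ∀ i, IsFiniteMeasure ((μ i).withDensity fun x => ENNReal.ofReal (g i x)) := fun i =>
    isFiniteMeasure_withDensity_ofReal (hg i).2
  refine Measure.pi_eq (μ := fun i => (μ i).withDensity fun x => ENNReal.ofReal (g i x))
    fun s hs => ?_
  rw [withDensity_apply _ (MeasurableSet.univ_pi hs), Measure.restrict_pi_pi,
    lintegral_pi_prod_ofReal _ h0 fun i => (hg i).restrict]
  exact Finset.prod_congr rfl fun i _ => (withDensity_apply _ (hs i)).symm

theorem MeasurePreserving.map_withDensity {α β : Type*} [MeasurableSpace α] [MeasurableSpace β]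
    {μ : Measure α} {ν : Measure β} {f : α → β} (hf : MeasurePreserving f μ ν) {g : β → ENNReal}
    (hg : Measurable g) : (μ.withDensity fun a => g (f a)).map f = ν.withDensity g := by
  ext s hs
  rw [Measure.map_apply hf.measurable hs, withDensity_apply _ (hf.measurable hs),
    withDensity_apply _ hs, hf.setLIntegral_comp_preimage hs hg]

theorem integrable_exponentialPDFReal : Integrable (exponentialPDFReal 1) := by
  refine ⟨(measurable_exponentialPDFReal 1).aestronglyMeasurable, ?_⟩
  rw [hasFiniteIntegral_iff_ofReal
    (Filter.Eventually.of_forall fun x => exponentialPDFReal_nonneg one_pos x)]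
  exact (lintegral_exponentialPDF_eq_one one_pos).trans_lt ENNReal.one_lt_top

theorem expMeasure_Iio : expMeasure 1 (Set.Iio 0) = 0 := by
  have h : expMeasure 1 = volume.withDensity (exponentialPDF 1) := rfl
  rw [h, withDensity_apply _ measurableSet_Iio]
  exact lintegral_exponentialPDF_of_nonpos le_rfl

theorem measurableSet_interlacing (n : ℕ) : MeasurableSet {p : Idx n → ℝ | Interlacing n p} := by
  unfold Interlacing
  measurability

theorem measurable_energy (n : ℕ) : Measurable fun p : Idx n → ℝ => energy n p := by
  unfold energy
  fun_prop

theorem measurable_gibbsWeight (n : ℕ) : Measurable (gibbsWeight n) :=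
  Measurable.ite (measurableSet_interlacing n) (measurable_energy n).neg.exp.ennreal_ofReal
    measurable_const

/-- Interlacing is non-negativity of the weights in the triangle, and the energy is their sum. The
identity also holds when some weight is negative, both sides being zero; the change of variables
needs it everywhere. -/
theorem gibbsWeight_shapeArray (n : ℕ) (y : triangle (n + 2) → ℝ) :
    gibbsWeight n (shapeArray n (extendWeights (n + 2) y)) =
      ∏ v, ENNReal.ofReal (exponentialPDFReal 1 (y v)) := by
  have h : ∀ x : ℝ, exponentialPDFReal 1 x = if 0 ≤ x then Real.exp (-x) else 0 := fun x => by
    simp [exponentialPDFReal, gammaPDFReal]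
  by_cases hy : ∀ v, 0 ≤ y v
  · have hy' : ∀ v, 0 ≤ extendWeights (n + 2) y v := fun v => by
      unfold extendWeights
      split_ifs
      · exact hy _
      · exact le_rfl
    rw [gibbsWeight, if_pos ((interlacing_shapeArray_iff n _).2 fun v _ => hy' v),
      energy_shapeArray n hy', ← ENNReal.ofReal_prod_of_nonneg
        fun v _ => exponentialPDFReal_nonneg one_pos _, ← Finset.sum_coe_sort]
    simp only [h, if_pos (hy _), ← Real.exp_sum, Finset.sum_neg_distrib]
    congr 3
    exact Finset.sum_congr rfl fun v _ => extendWeights_apply y v.2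
  · rw [gibbsWeight, if_neg fun hI => hy fun v => ?_]
    · push Not at hy
      obtain ⟨v, hv⟩ := hy
      refine (Finset.prod_eq_zero (Finset.mem_univ v) ?_).symm
      rw [h, if_neg (not_le.2 hv), ENNReal.ofReal_zero]
    · rw [← extendWeights_apply y v.2]
      exact (interlacing_shapeArray_iff n _).1 hI v.1 v.2

theorem partitionFunction_eq_one (n : ℕ) : partitionFunction n = 1 := by
  rw [partitionFunction, ← (measurePreserving_shapeArray n).lintegral_comp (measurable_gibbsWeight n)]
  simp only [gibbsWeight_shapeArray]
  rw [volume_pi, lintegral_pi_prod_ofReal _ (fun _ => exponentialPDFReal_nonneg one_pos)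
    fun _ => integrable_exponentialPDFReal]
  exact Finset.prod_eq_one fun v _ => lintegral_exponentialPDF_eq_one one_pos

section Law

variable {Ω : Type*} [MeasurableSpace Ω] {μ : Measure Ω} [IsProbabilityMeasure μ]
  {ξ : ℕ × ℕ → Ω → ℝ}

omit [IsProbabilityMeasure μ] in
theorem ae_nonneg_of_exponential (hlaw : ∀ v, HasLaw (ξ v) (expMeasure 1) μ) :
    ∀ᵐ ω ∂μ, ∀ v, 0 ≤ ξ v ω := by
  rw [ae_all_iff]
  intro v
  have h : ∀ᵐ x ∂(μ.map (ξ v)), 0 ≤ x := by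
    rw [(hlaw v).map_eq, ae_iff]
    simp only [not_le]
    exact expMeasure_Iio
  exact ae_of_ae_map (hlaw v).aemeasurable h

theorem hasLaw_incrementArray_of_exponential (n : ℕ) (hξ : iIndepFun ξ μ)
    (hlaw : ∀ v, HasLaw (ξ v) (expMeasure 1) μ) :
    HasLaw (fun ω => incrementArray n fun v => ξ v ω) (volume.withDensity (gibbsWeight n)) μ := by
  have hX : AEMeasurable (fun ω (v : triangle (n + 2)) => ξ v ω) μ :=
    aemeasurable_pi_lambda _ fun v => (hlaw v).aemeasurable
  have hlawX : μ.map (fun ω (v : triangle (n + 2)) => ξ v ω) = volume.withDensity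
      fun y => ∏ v, ENNReal.ofReal (exponentialPDFReal 1 (y v)) := by
    rw [(iIndepFun_iff_map_fun_eq_pi_map fun v : triangle (n + 2) => (hlaw v.1).aemeasurable).1
      (hξ.precomp Subtype.val_injective)]
    simp only [(hlaw _).map_eq]
    exact pi_withDensity_ofReal (fun _ => volume) (fun _ => exponentialPDFReal_nonneg one_pos)
      fun _ => integrable_exponentialPDFReal
  have hS := measurePreserving_shapeArray n
  -- Greene's theorem was proved for non-negative weights, so increments are shapes only almost
  -- surely.
  have hae : (fun ω => incrementArray n fun v => ξ v ω) =ᵐ[μ]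
      fun ω => shapeArray n (extendWeights (n + 2) fun v => ξ v ω) := by
    filter_upwards [ae_nonneg_of_exponential hlaw] with ω hω
    rw [incrementArray_eq_shapeArray n hω]
    exact shapeArray_congr n fun v hv => (extendWeights_apply (fun v => ξ v ω) hv).symm
  have hm : AEMeasurable (fun ω => shapeArray n (extendWeights (n + 2) fun v => ξ v ω)) μ :=
    hS.measurable.comp_aemeasurable hX
  refine ⟨hm.congr hae.symm, ?_⟩
  rw [Measure.map_congr hae, ← MeasurePreserving.map_withDensity hS (measurable_gibbsWeight n)]
  simp only [gibbsWeight_shapeArray]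
  rw [← hlawX, AEMeasurable.map_map_of_aemeasurable hS.measurable.aemeasurable hX]
  rfl

end Law

end LPP


/-! ### Conditioned kernels, the random walk and its bridge -/

namespace LPP

section CondKernel

variable {𝒴 𝒵 : Type*} [MeasurableSpace 𝒴] [MeasurableSpace 𝒵]

/-- The kernel obtained by conditioning the values of a kernel on the sections of a set. -/
noncomputable def condKernelOn (κ : Kernel 𝒴 𝒵) [IsFiniteKernel κ] {A : Set (𝒴 × 𝒵)}
    (hA : MeasurableSet A) : Kernel 𝒴 𝒵 where
  toFun y := ProbabilityTheory.cond (κ y) (Prod.mk y ⁻¹' A)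
  measurable' := by
    refine Measure.measurable_of_measurable_coe _ fun s hs => ?_
    simp only [cond_apply (measurable_prodMk_left hA)]
    exact (Kernel.measurable_kernel_prodMk_left hA).inv.mul
      (Kernel.measurable_kernel_prodMk_left (hA.inter (measurable_snd hs)))

variable (κ : Kernel 𝒴 𝒵) [IsFiniteKernel κ] {A : Set (𝒴 × 𝒵)} (hA : MeasurableSet A)

theorem condKernelOn_apply (y : 𝒴) :
    condKernelOn κ hA y = ProbabilityTheory.cond (κ y) (Prod.mk y ⁻¹' A) := rfl

instance : IsFiniteKernel (condKernelOn κ hA) := by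
  refine ⟨1, ENNReal.one_lt_top, fun y => ?_⟩
  rw [condKernelOn_apply, cond_apply (measurable_prodMk_left hA), Set.inter_univ]
  exact ENNReal.inv_mul_le_one _

/-- The first marginal of the restriction has density `κ y (Prod.mk y ⁻¹' A)` with respect to `ν`,
which cancels the normalisation of the conditioned kernel; where this mass is zero, both sides
vanish. -/
theorem restrict_compProd_eq (ν : Measure 𝒴) [SFinite ν] :
    (ν ⊗ₘ κ).restrict A = ((ν ⊗ₘ κ).restrict A).fst ⊗ₘ condKernelOn κ hA := by
  have hfst : ((ν ⊗ₘ κ).restrict A).fst = ν.withDensity fun y => κ y (Prod.mk y ⁻¹' A) := by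
    ext s hs
    rw [Measure.fst_apply hs, Measure.restrict_apply (measurable_fst hs), withDensity_apply _ hs,
      Measure.compProd_apply ((measurable_fst hs).inter hA), ← lintegral_indicator hs]
    refine lintegral_congr fun y => ?_
    by_cases hy : y ∈ s <;> simp [hy, Set.preimage]
  ext s hs
  have hm : Measurable fun y => κ y (Prod.mk y ⁻¹' A) := Kernel.measurable_kernel_prodMk_left hA
  rw [hfst, Measure.restrict_apply hs, Measure.compProd_apply hs, Measure.compProd_apply (hs.inter hA),
    lintegral_withDensity_eq_lintegral_mul _ hm (Kernel.measurable_kernel_prodMk_left hs)]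
  refine lintegral_congr fun y => ?_
  rw [Pi.mul_apply, condKernelOn_apply, cond_apply (measurable_prodMk_left hA), ← mul_assoc,
    Set.preimage_inter, Set.inter_comm]
  by_cases h0 : κ y (Prod.mk y ⁻¹' A) = 0
  · rw [h0, zero_mul, zero_mul]
    exact measure_mono_null Set.inter_subset_left h0
  · rw [ENNReal.mul_inv_cancel h0 (measure_ne_top _ _), one_mul]

end CondKernel

section Walk

/-- The partial sums of a sequence of increments. -/
def walkPath (m : ℕ) (x : Fin m → ℝ) (i : Fin (m + 1)) : ℝ := ∑ j : Fin m with j.1 < i.1, x j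

theorem measurable_walkPath (m : ℕ) : Measurable (walkPath m) := by
  unfold walkPath
  fun_prop

theorem walkPath_zero (m : ℕ) (x : Fin m → ℝ) : walkPath m x 0 = 0 := by simp [walkPath]

theorem walkPath_succ (m : ℕ) (x : Fin m → ℝ) (i : Fin m) :
    walkPath m x i.succ = walkPath m x i.castSucc + x i := by
  simp only [walkPath, Finset.sum_filter, Fin.val_succ, Fin.val_castSucc]
  rw [← sub_eq_iff_eq_add', ← Finset.sum_sub_distrib, Finset.sum_eq_single i]
  · simp
  · intro j _ hj
    have : j.1 ≠ i.1 := fun h => hj (Fin.ext h)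
    by_cases h : j.1 < i.1
    · rw [if_pos h, if_pos (by omega), sub_self]
    · rw [if_neg h, if_neg (by omega), sub_self]
  · simp

/-- Summation is given by a lower triangular matrix with unit diagonal. -/
theorem measurePreserving_walkPath (m : ℕ) (c : ℝ) :
    MeasurePreserving fun (x : Fin m → ℝ) (i : Fin m) => c + walkPath m x i.succ := by
  set M : Matrix (Fin m) (Fin m) ℝ := fun i j => if j ≤ i then 1 else 0 with hM
  have hdet : M.det = 1 := by
    rw [Matrix.det_of_isLowerTriangular]
    · simp [hM]
    · intro i j hij
      have : i < j := hij
      simp [hM, this]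
  have h1 : MeasurePreserving (Matrix.toLin' M) := by
    refine ⟨(LinearMap.continuous_of_finiteDimensional _).measurable, ?_⟩
    rw [Real.map_matrix_volume_pi_eq_smul_volume_pi (by rw [hdet]; exact one_ne_zero), hdet]
    simp
  refine cast (congrArg (fun G => MeasurePreserving G volume volume) ?_)
    ((measurePreserving_add_left volume (fun _ : Fin m => c)).comp h1)
  funext x i
  symm
  rw [Function.comp_apply, Pi.add_apply, Matrix.toLin'_apply, walkPath, Finset.sum_filter]
  congr 1
  simp only [Matrix.mulVec, dotProduct, hM, Fin.val_succ, Nat.lt_succ_iff, Fin.le_def, ite_mul,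
    one_mul, zero_mul]

theorem pi_laplaceMeasure (m : ℕ) : (Measure.pi fun _ : Fin m => laplaceMeasure) =
    volume.withDensity fun x => ∏ i, ENNReal.ofReal (1 / 4 * Real.exp (-|x i| / 2)) := by
  refine pi_withDensity_ofReal (fun _ => volume) (g := fun _ x => 1 / 4 * Real.exp (-|x| / 2))
    (fun _ _ => by positivity) fun _ => ⟨by fun_prop, ?_⟩
  rw [hasFiniteIntegral_iff_ofReal (Filter.Eventually.of_forall fun x => by positivity),
    lintegral_laplace]
  exact ENNReal.one_lt_top

theorem lintegral_walkLaw (m : ℕ) {F : (Fin (m + 1) → ℝ) → ENNReal} (hF : Measurable F) :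
    ∫⁻ s, F s ∂walkLaw m = ∫⁻ x : Fin m → ℝ,
      (∏ i, ENNReal.ofReal (1 / 4 * Real.exp (-|x i| / 2))) * F (walkPath m x) := by
  have h : walkLaw m = (Measure.pi fun _ : Fin m => laplaceMeasure).map (walkPath m) := rfl
  rw [h, lintegral_map hF (measurable_walkPath m), pi_laplaceMeasure,
    lintegral_withDensity_eq_lintegral_mul _ (by fun_prop)
      (g := fun x => F (walkPath m x)) (hF.comp (measurable_walkPath m))]
  rfl

instance (m : ℕ) : IsMarkovKernel (walkBridge m) := by
  unfold walkBridge
  infer_instance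

theorem lintegral_walkBridge (m : ℕ) {F : ℝ → (Fin (m + 1) → ℝ) → ENNReal}
    (hF : Measurable (Function.uncurry F)) : ∫⁻ s, F (s (Fin.last m)) s ∂walkLaw m =
      ∫⁻ z, ∫⁻ s, F z s ∂walkBridge m z ∂(walkLaw m).map fun s => s (Fin.last m) := by
  have h := compProd_map_condDistrib (mβ := inferInstance) (μ := walkLaw m) (Y := id)
    (X := fun s : Fin (m + 1) → ℝ => s (Fin.last m)) aemeasurable_id
  have h2 := Measure.lintegral_compProd (μ := (walkLaw m).map fun s => s (Fin.last m))
    (κ := walkBridge m) hF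
  rw [walkBridge, h, lintegral_map hF (by fun_prop)] at h2
  exact h2

end Walk

end LPP


/-! ### Resampling a stretch of the first row -/

namespace LPP

theorem lintegral_exp_neg_ite (M : ℝ) :
    ∫⁻ u : ℝ, ENNReal.ofReal (if M ≤ u then Real.exp (-u) else 0) =
      ENNReal.ofReal (Real.exp (-M)) := by
  have h : ∀ u : ℝ, ENNReal.ofReal (if M ≤ u then Real.exp (-u) else 0) =
      (Set.Ici M).indicator (fun u => ENNReal.ofReal (Real.exp (-u))) u := fun u => by
    by_cases hu : M ≤ u <;> simp [hu]
  simp only [h]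
  rw [lintegral_indicator measurableSet_Ici, setLIntegral_congr Ioi_ae_eq_Ici.symm,
    ← ofReal_integral_eq_lintegral_ofReal (integrableOn_exp_neg_Ioi M)
      (Filter.Eventually.of_forall fun x => (Real.exp_pos _).le), integral_exp_neg_Ioi]

theorem measurable_exp_neg_ite : Measurable fun z : ℝ × ℝ =>
    if z.1 ≤ z.2 then Real.exp (-z.2) else 0 :=
  Measurable.ite (measurableSet_le measurable_fst measurable_snd) (by fun_prop) measurable_const

theorem integrable_exp_neg_ite (M : ℝ) :
    Integrable fun u : ℝ => if M ≤ u then Real.exp (-u) else 0 := by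
  refine ⟨(measurable_exp_neg_ite.comp measurable_prodMk_left).aestronglyMeasurable, ?_⟩
  rw [hasFiniteIntegral_iff_ofReal (Filter.Eventually.of_forall fun x => by positivity),
    lintegral_exp_neg_ite]
  exact ENNReal.ofReal_lt_top

/-- The walk bridge as a kernel of the boundary data. -/
noncomputable def bridgeKernel (m : ℕ) :
    Kernel ((Fin (m + 2) → ℝ) × ℝ × ℝ) (Fin (m + 1) → ℝ) :=
  (walkBridge m).comap (fun y => y.2.2 - y.2.1) (by fun_prop)

instance (m : ℕ) : IsMarkovKernel (bridgeKernel m) := by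
  unfold bridgeKernel
  infer_instance

/-- The walks which stay above the second row. -/
def aboveSet (m : ℕ) : Set (((Fin (m + 2) → ℝ) × ℝ × ℝ) × (Fin (m + 1) → ℝ)) :=
  {z | ∀ i : Fin (m + 1), max (z.1.1 i.castSucc) (z.1.1 i.succ) - z.1.2.1 < z.2 i}

theorem measurableSet_aboveSet (m : ℕ) : MeasurableSet (aboveSet m) := by
  unfold aboveSet
  rw [Set.ofPred_forall]
  exact MeasurableSet.iInter fun i => measurableSet_lt (by fun_prop) (by fun_prop)

/-- For an increment `x` from `s` to `t` one has `t - max s t = x / 2 - |x| / 2`. The second term is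
the exponent of the Laplace density of scale 2; the first terms add up to half the displacement and
so depend on the end point only. -/
theorem exp_sum_mul_prod_exp (m : ℕ) (c : ℝ) (x : Fin m → ℝ) :
    Real.exp (∑ i : Fin m, (c + walkPath m x i.succ)) *
        ∏ i : Fin m, Real.exp (-max (c + walkPath m x i.castSucc) (c + walkPath m x i.succ)) =
      4 ^ m * Real.exp (walkPath m x (Fin.last m) / 2) *
        ∏ i, (1 / 4 * Real.exp (-|x i| / 2)) := by
  have hlast : walkPath m x (Fin.last m) = ∑ i, x i := by simp [walkPath]
  have h4 : (4 : ℝ) ^ m = ∏ _i : Fin m, (4 : ℝ) := by simp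
  rw [hlast, Finset.sum_div, Real.exp_sum, Real.exp_sum, h4, ← Finset.prod_mul_distrib,
    ← Finset.prod_mul_distrib, ← Finset.prod_mul_distrib]
  refine Finset.prod_congr rfl fun i _ => ?_
  have h : c + walkPath m x i.succ + -max (c + walkPath m x i.castSucc) (c + walkPath m x i.succ) =
      x i / 2 + -|x i| / 2 := by
    rw [walkPath_succ]
    rcases le_total 0 (x i) with hx | hx
    · rw [abs_of_nonneg hx, max_eq_right (by linarith)]
      ring
    · rw [abs_of_nonpos hx, max_eq_left (by linarith)]
      ring
  rw [← Real.exp_add, h, Real.exp_add]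
  ring

section Resampling

variable {𝒳 : Type*} [MeasurableSpace 𝒳] {m : ℕ}

/-- The boundary data and the walk read off from a configuration. -/
def boundaryWalk (v : 𝒳 → Fin (m + 2) → ℝ) (t₀ : 𝒳 → ℝ)
    (z : 𝒳 × (Fin m → ℝ) × (Fin m → ℝ)) : ((Fin (m + 2) → ℝ) × ℝ × ℝ) × (Fin (m + 1) → ℝ) :=
  ((v z.1, t₀ z.1, (Fin.cons (t₀ z.1) z.2.1 : Fin (m + 1) → ℝ) (Fin.last m)),
    fun i => (Fin.cons (t₀ z.1) z.2.1 : Fin (m + 1) → ℝ) i - t₀ z.1)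

open Classical in
/-- The density of a configuration `(r, t, u)`, where `t` is the part of a row which is
resampled and `u` is the part of the next row above it. -/
noncomputable def resamplingDensity (v : 𝒳 → Fin (m + 2) → ℝ) (t₀ : 𝒳 → ℝ) (H : 𝒳 → ℝ → ENNReal)
    (z : 𝒳 × (Fin m → ℝ) × (Fin m → ℝ)) : ENNReal :=
  H z.1 ((Fin.cons (t₀ z.1) z.2.1 : Fin (m + 1) → ℝ) (Fin.last m)) *
    (if boundaryWalk v t₀ z ∈ aboveSet m then 1 else 0) *
    ENNReal.ofReal (Real.exp (∑ i, z.2.1 i)) *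
    ∏ i : Fin m, ENNReal.ofReal
      (if max ((Fin.cons (t₀ z.1) z.2.1 : Fin (m + 1) → ℝ) i.castSucc)
        ((Fin.cons (t₀ z.1) z.2.1 : Fin (m + 1) → ℝ) i.succ) ≤ z.2.2 i
        then Real.exp (-z.2.2 i) else 0)

variable {v : 𝒳 → Fin (m + 2) → ℝ} {t₀ : 𝒳 → ℝ} {H : 𝒳 → ℝ → ENNReal}

theorem measurable_cons_apply (ht₀ : Measurable t₀) (i : Fin (m + 1)) :
    Measurable fun z : 𝒳 × (Fin m → ℝ) × (Fin m → ℝ) =>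
      (Fin.cons (t₀ z.1) z.2.1 : Fin (m + 1) → ℝ) i := by
  refine Fin.cases ?_ (fun i => ?_) i
  · simp only [Fin.cons_zero]
    fun_prop
  · simp only [Fin.cons_succ]
    fun_prop

theorem measurable_boundaryWalk (hv : Measurable v) (ht₀ : Measurable t₀) :
    Measurable (boundaryWalk v t₀) :=
  ((hv.comp measurable_fst).prodMk ((ht₀.comp measurable_fst).prodMk
    (measurable_cons_apply ht₀ _))).prodMk (measurable_pi_lambda _ fun i =>
      (measurable_cons_apply ht₀ i).sub (ht₀.comp measurable_fst))

theorem measurable_resamplingDensity (hv : Measurable v) (ht₀ : Measurable t₀)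
    (hH : Measurable (Function.uncurry H)) : Measurable (resamplingDensity v t₀ H) := by
  have h1 : Measurable fun z : 𝒳 × (Fin m → ℝ) × (Fin m → ℝ) =>
      H z.1 ((Fin.cons (t₀ z.1) z.2.1 : Fin (m + 1) → ℝ) (Fin.last m)) :=
    hH.comp (measurable_fst.prodMk (measurable_cons_apply ht₀ (Fin.last m)))
  have h2 : Measurable fun z : 𝒳 × (Fin m → ℝ) × (Fin m → ℝ) =>
      ENNReal.ofReal (Real.exp (∑ i, z.2.1 i)) := by fun_prop
  unfold resamplingDensity
  refine ((h1.mul (Measurable.ite (measurable_boundaryWalk hv ht₀ (measurableSet_aboveSet m))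
    measurable_const measurable_const)).mul h2).mul ?_
  refine Finset.measurable_fun_prod _ fun i _ => Measurable.ennreal_ofReal ?_
  exact measurable_exp_neg_ite.comp (((measurable_cons_apply ht₀ _).max
    (measurable_cons_apply ht₀ _)).prodMk (by fun_prop : Measurable fun z : 𝒳 ×
      (Fin m → ℝ) × (Fin m → ℝ) => z.2.2 i))

/-- Integrating out `u` leaves the exponentials of the negative maxima. In terms of increments the
row then has the law of the walk up to a factor in the end point, and the walk is disintegrated over
its end point. -/
theorem lintegral_resamplingDensity (hH : Measurable (Function.uncurry H))
    {B : Set (((Fin (m + 2) → ℝ) × ℝ × ℝ) × (Fin (m + 1) → ℝ))} (hB : MeasurableSet B) (r : 𝒳)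
    (hm : Measurable (resamplingDensity v t₀ H ))
    (hm' : Measurable (boundaryWalk v t₀)) :
    ∫⁻ z : (Fin m → ℝ) × (Fin m → ℝ), B.indicator (fun _ => (1 : ENNReal)) (boundaryWalk v t₀ (r, z)) *
        resamplingDensity v t₀ H (r, z) =
      ∫⁻ z, H r (t₀ r + z) * ENNReal.ofReal (4 ^ m * Real.exp (z / 2)) *
        walkBridge m z (Prod.mk (v r, t₀ r, t₀ r + z) ⁻¹' (B ∩ aboveSet m))
          ∂(walkLaw m).map fun s => s (Fin.last m) := by
  set S := B ∩ aboveSet m with hS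
  have hSm : MeasurableSet S := hB.inter (measurableSet_aboveSet m)
  have hcons : ∀ i, Measurable fun t : Fin m → ℝ => (Fin.cons (t₀ r) t : Fin (m + 1) → ℝ) i := by
    refine Fin.cases ?_ fun i => ?_
    · simp only [Fin.cons_zero, measurable_const]
    · simp only [Fin.cons_succ]
      fun_prop
  have hW : Measurable fun t : Fin m → ℝ => boundaryWalk v t₀ (r, t, 0) :=
    hm'.comp (by fun_prop)
  have hH' : Measurable (H r) := hH.comp measurable_prodMk_left
  have hcons_walk : ∀ x : Fin m → ℝ,
      (Fin.cons (t₀ r) fun i : Fin m => t₀ r + walkPath m x i.succ : Fin (m + 1) → ℝ) =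
        fun i => t₀ r + walkPath m x i := fun x => by
    funext i
    refine Fin.cases ?_ (fun i => ?_) i
    · rw [Fin.cons_zero, walkPath_zero, add_zero]
    · rw [Fin.cons_succ]
  have hu : ∀ t : Fin m → ℝ, ∫⁻ u : Fin m → ℝ, B.indicator (fun _ => (1 : ENNReal)) (boundaryWalk v t₀ (r, t, u)) *
      resamplingDensity v t₀ H (r, t, u) =
        S.indicator (fun _ => (1 : ENNReal)) (boundaryWalk v t₀ (r, t, 0)) *
          H r ((Fin.cons (t₀ r) t : Fin (m + 1) → ℝ) (Fin.last m)) *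
          ENNReal.ofReal (Real.exp (∑ i, t i) * ∏ i : Fin m,
            Real.exp (-max ((Fin.cons (t₀ r) t : Fin (m + 1) → ℝ) i.castSucc)
              ((Fin.cons (t₀ r) t : Fin (m + 1) → ℝ) i.succ))) := fun t => by
    have h : ∀ u : Fin m → ℝ, B.indicator (fun _ => (1 : ENNReal)) (boundaryWalk v t₀ (r, t, u)) *
        resamplingDensity v t₀ H (r, t, u) = S.indicator (fun _ => (1 : ENNReal)) (boundaryWalk v t₀ (r, t, 0)) *
          H r ((Fin.cons (t₀ r) t : Fin (m + 1) → ℝ) (Fin.last m)) *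
          ENNReal.ofReal (Real.exp (∑ i, t i)) * ∏ i : Fin m, ENNReal.ofReal
            (if max ((Fin.cons (t₀ r) t : Fin (m + 1) → ℝ) i.castSucc)
              ((Fin.cons (t₀ r) t : Fin (m + 1) → ℝ) i.succ) ≤ u i
              then Real.exp (-u i) else 0) := fun u => by
      have e : boundaryWalk v t₀ (r, t, u) = boundaryWalk v t₀ (r, t, 0) := rfl
      rw [resamplingDensity, e]
      by_cases h1 : boundaryWalk v t₀ (r, t, 0) ∈ B <;>
        by_cases h2 : boundaryWalk v t₀ (r, t, 0) ∈ aboveSet m <;> simp [hS, h1, h2]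
    have hg : Measurable fun u : Fin m → ℝ => ∏ i : Fin m, ENNReal.ofReal
        (if max ((Fin.cons (t₀ r) t : Fin (m + 1) → ℝ) i.castSucc)
          ((Fin.cons (t₀ r) t : Fin (m + 1) → ℝ) i.succ) ≤ u i then Real.exp (-u i) else 0) :=
      Finset.measurable_fun_prod _ fun i _ => Measurable.ennreal_ofReal
        (measurable_exp_neg_ite.comp (measurable_const.prodMk (measurable_pi_apply i)))
    simp only [h]
    rw [lintegral_const_mul _ hg, volume_pi,
      lintegral_pi_prod_ofReal _ (g := fun (i : Fin m) (u : ℝ) => if max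
        ((Fin.cons (t₀ r) t : Fin (m + 1) → ℝ) i.castSucc)
          ((Fin.cons (t₀ r) t : Fin (m + 1) → ℝ) i.succ) ≤ u then Real.exp (-u) else 0)
        (fun i u => by positivity) fun i => integrable_exp_neg_ite _]
    simp only [lintegral_exp_neg_ite]
    rw [← ENNReal.ofReal_prod_of_nonneg fun i _ => (Real.exp_pos _).le, mul_assoc,
      ← ENNReal.ofReal_mul (Real.exp_pos _).le]
  have hi : Measurable fun z : (Fin m → ℝ) × (Fin m → ℝ) =>
      B.indicator (fun _ => (1 : ENNReal)) (boundaryWalk v t₀ (r, z)) * resamplingDensity v t₀ H (r, z) :=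
    (((measurable_const.indicator hB).comp hm').mul hm).comp measurable_prodMk_left
  rw [Measure.volume_eq_prod, lintegral_prod _ hi.aemeasurable]
  -- The row started at `t₀ r` is replaced by its increments, a change of variables without
  -- Jacobian.
  rw [lintegral_congr hu, ← (measurePreserving_walkPath m (t₀ r)).lintegral_comp]
  · simp only [boundaryWalk, hcons_walk, add_sub_cancel_left, exp_sum_mul_prod_exp]
    have hF : Measurable fun z : ℝ × (Fin (m + 1) → ℝ) =>
        S.indicator (fun _ => (1 : ENNReal)) ((v r, t₀ r, t₀ r + z.1), z.2) *
          (H r (t₀ r + z.1) * ENNReal.ofReal (4 ^ m * Real.exp (z.1 / 2))) := by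
      have h1 : Measurable fun z : ℝ × (Fin (m + 1) → ℝ) =>
          ((v r, t₀ r, t₀ r + z.1), z.2) := by fun_prop
      have h2 : Measurable fun z : ℝ × (Fin (m + 1) → ℝ) => H r (t₀ r + z.1) :=
        hH'.comp (by fun_prop)
      exact ((measurable_const.indicator hSm).comp h1).mul (h2.mul (by fun_prop))
    have hb := lintegral_walkBridge m (F := fun z s =>
      S.indicator (fun _ => (1 : ENNReal)) ((v r, t₀ r, t₀ r + z), s) *
          (H r (t₀ r + z) * ENNReal.ofReal (4 ^ m * Real.exp (z / 2)))) hF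
    have hF' : Measurable fun s : Fin (m + 1) → ℝ =>
        S.indicator (fun _ => (1 : ENNReal)) ((v r, t₀ r, t₀ r + s (Fin.last m)), s) *
          (H r (t₀ r + s (Fin.last m)) *
            ENNReal.ofReal (4 ^ m * Real.exp (s (Fin.last m) / 2))) :=
      hF.comp (by fun_prop : Measurable fun s : Fin (m + 1) → ℝ => (s (Fin.last m), s))
    rw [lintegral_walkLaw m hF'] at hb
    refine Eq.trans (lintegral_congr fun x => ?_) (hb.trans (lintegral_congr fun z => ?_))
    · rw [ENNReal.ofReal_mul (by positivity),
        ENNReal.ofReal_prod_of_nonneg fun i _ => by positivity]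
      ring
    · have h1 : Measurable fun s => S.indicator (fun _ => (1 : ENNReal)) ((v r, t₀ r, t₀ r + z), s) :=
        (measurable_const.indicator hSm).comp measurable_prodMk_left
      rw [lintegral_mul_const _ h1, mul_comm]
      congr 1
      exact lintegral_indicator_one (measurable_prodMk_left hSm)
  · refine (((measurable_const.indicator hSm).comp hW).mul (hH'.comp (hcons _))).mul
      (Measurable.ennreal_ofReal ((by fun_prop : Measurable fun t : Fin m → ℝ =>
        Real.exp (∑ i, t i)).mul (Finset.measurable_fun_prod _ fun i _ =>
          ((hcons _).max (hcons _)).neg.exp)))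

/-- The remaining factors depend only on the rest of the configuration and on the end point, so they
enter `ν`. What is left is the bridge between the two ends, restricted to `aboveSet m`. -/
theorem exists_map_resamplingDensity_eq (ρ : Measure 𝒳) [SFinite ρ] (hv : Measurable v)
    (ht₀ : Measurable t₀) (hH : Measurable (Function.uncurry H)) :
    ∃ ν : Measure ((Fin (m + 2) → ℝ) × ℝ × ℝ), SFinite ν ∧
      ((ρ.prod volume).withDensity (resamplingDensity v t₀ H)).map (boundaryWalk v t₀) =
        (ν ⊗ₘ bridgeKernel m).restrict (aboveSet m) := by
  have hG := measurable_resamplingDensity hv ht₀ hH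
  have hW := measurable_boundaryWalk hv ht₀
  have hg : Measurable fun z : 𝒳 × ℝ => (v z.1, t₀ z.1, t₀ z.1 + z.2) := by fun_prop
  have hd : Measurable fun z : 𝒳 × ℝ =>
      H z.1 (t₀ z.1 + z.2) * ENNReal.ofReal (4 ^ m * Real.exp (z.2 / 2)) := by
    refine (hH.comp (by fun_prop : Measurable fun z : 𝒳 × ℝ => (z.1, t₀ z.1 + z.2))).mul ?_
    fun_prop
  refine ⟨((ρ.prod ((walkLaw m).map fun s => s (Fin.last m))).withDensity fun z =>
    H z.1 (t₀ z.1 + z.2) * ENNReal.ofReal (4 ^ m * Real.exp (z.2 / 2))).map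
      (fun z => (v z.1, t₀ z.1, t₀ z.1 + z.2)), inferInstance, ?_⟩
  ext B hB
  have hBA := hB.inter (measurableSet_aboveSet m)
  have hk : Measurable fun y => bridgeKernel m y (Prod.mk y ⁻¹' (B ∩ aboveSet m)) :=
    Kernel.measurable_kernel_prodMk_left hBA
  have hkg : Measurable fun z : 𝒳 × ℝ => bridgeKernel m (v z.1, t₀ z.1, t₀ z.1 + z.2)
      (Prod.mk (v z.1, t₀ z.1, t₀ z.1 + z.2) ⁻¹' (B ∩ aboveSet m)) := hk.comp hg
  have hi : Measurable fun z => B.indicator (fun _ => (1 : ENNReal)) (boundaryWalk v t₀ z) :=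
    (measurable_const.indicator hB).comp hW
  have h1 : ((ρ.prod volume).withDensity (resamplingDensity v t₀ H)).map (boundaryWalk v t₀) B =
      ∫⁻ z, B.indicator (fun _ => (1 : ENNReal)) (boundaryWalk v t₀ z) * resamplingDensity v t₀ H z ∂ρ.prod volume := by
    rw [Measure.map_apply hW hB, withDensity_apply _ (hW hB), ← lintegral_indicator (hW hB)]
    refine lintegral_congr fun z => ?_
    by_cases hz : boundaryWalk v t₀ z ∈ B <;> simp [hz]
  have hiG : Measurable fun z => B.indicator (fun _ => (1 : ENNReal)) (boundaryWalk v t₀ z) *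
      resamplingDensity v t₀ H z := hi.mul hG
  rw [h1, lintegral_prod _ hiG.aemeasurable, Measure.restrict_apply hB,
    Measure.compProd_apply hBA, lintegral_map hk hg,
    lintegral_withDensity_eq_lintegral_mul _ hd hkg,
    lintegral_prod _ (hd.mul hkg).aemeasurable]
  refine lintegral_congr fun r => ?_
  rw [lintegral_resamplingDensity hH hB r hG hW]
  refine lintegral_congr fun z => ?_
  simp [bridgeKernel, Kernel.comap_apply]

end Resampling

end LPP


/-! ### Passage times as first increments -/

namespace LPP

section PassageTime

theorem isChain_append_tail {s t : List (ℕ × ℕ)} {w : ℕ × ℕ} (hs : s.IsChain Step)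
    (ht : t.IsChain Step) (h1 : s.getLast? = some w) (h2 : t.head? = some w) :
    (s ++ t.tail).IsChain Step ∧ (s ++ t.tail).head? = s.head? ∧
      (s ++ t.tail).getLast? = t.getLast? ∧ ∀ x, x ∈ s ++ t.tail ↔ x ∈ s ∨ x ∈ t := by
  obtain ⟨t', rfl⟩ : ∃ t', t = w :: t' := by
    rcases t with _ | ⟨a, t'⟩
    · simp at h2
    · simp at h2
      exact ⟨t', by rw [h2]⟩
  have hw : w ∈ s := List.mem_of_getLast? h1
  have hne : s ≠ [] := List.ne_nil_of_mem hw
  rw [List.isChain_cons] at ht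
  refine ⟨?_, ?_, ?_, fun x => ?_⟩
  · rw [List.isChain_append]
    refine ⟨hs, ht.2, fun a ha b hb => ?_⟩
    rw [h1] at ha
    simp only [Option.mem_def, Option.some.injEq] at ha
    subst ha
    exact ht.1 b hb
  · rw [List.head?_append_of_ne_nil _ hne]
  · rcases t' with _ | ⟨b, t'⟩
    · simp [h1]
    · simp [List.getLast?_append, List.getLast?_cons]
  · simp only [List.tail_cons, List.mem_append, List.mem_cons]
    constructor
    · rintro (h | h)
      · exact Or.inl h
      · exact Or.inr (Or.inr h)
    · rintro (h | rfl | h)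
      · exact Or.inl h
      · exact Or.inl hw
      · exact Or.inr h

theorem mem_pathsFromTo {u v : ℕ × ℕ} {γ : Finset (ℕ × ℕ)} :
    γ ∈ pathsFromTo u v ↔ γ ⊆ Finset.Icc u v ∧ IsPathFromTo u v γ := by
  simp only [pathsFromTo, Finset.mem_filter, Finset.mem_powerset]

theorem mem_disjointPaths {k : ℕ} {u v : ℕ × ℕ} {γ : Fin k → Finset (ℕ × ℕ)} :
    γ ∈ disjointPaths k u v ↔ (∀ i, γ i ⊆ Finset.Icc u v) ∧ (∀ i, IsPath (γ i)) ∧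
      Pairwise fun i j => Disjoint (γ i) (γ j) := by
  simp only [disjointPaths, Finset.mem_filter, Fintype.mem_piFinset, Finset.mem_powerset]

theorem IsPath.exists_subset_pathsFromTo {γ : Finset (ℕ × ℕ)} (hγ : IsPath γ) {u v : ℕ × ℕ}
    (huv : u ≤ v) (h : γ ⊆ Finset.Icc u v) : ∃ γ' ∈ pathsFromTo u v, γ ⊆ γ' := by
  obtain ⟨s, hs, rfl⟩ := hγ
  rcases s with _ | ⟨a, s⟩
  · obtain ⟨γ', h'⟩ := pathsFromTo_nonempty huv
    exact ⟨γ', h', by simp⟩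
  set s' := a :: s with hs'
  have hmem : ∀ w ∈ s', u ≤ w ∧ w ≤ v := fun w hw => Finset.mem_Icc.1 (h (List.mem_toFinset.2 hw))
  have hlast : s'.getLast? = some (s'.getLast (List.cons_ne_nil a s)) :=
    List.getLast?_eq_some_getLast _
  obtain ⟨p, hp1, hp2, hp3, hp4⟩ := exists_path (hmem a (List.mem_cons_self)).1
  obtain ⟨q, hq1, hq2, hq3, hq4⟩ := exists_path (hmem _ (List.mem_of_getLast? hlast)).2
  obtain ⟨h1, h2, h3, h4⟩ := isChain_append_tail hp1 hs hp3 (by rw [hs', List.head?_cons])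
  rw [hlast] at h3
  obtain ⟨g1, g2, g3, g4⟩ := isChain_append_tail h1 hq1 h3 hq2
  refine ⟨_, mem_pathsFromTo.2 ⟨fun w hw => ?_, _, g1, ?_, ?_, rfl⟩, ?_⟩
  · rw [List.mem_toFinset, g4, h4] at hw
    rw [Finset.mem_Icc]
    rcases hw with (hw | hw) | hw
    · exact ⟨(hp4 w hw).1, (hp4 w hw).2.trans (hmem a List.mem_cons_self).2⟩
    · exact hmem w hw
    · exact ⟨(hmem _ (List.mem_of_getLast? hlast)).1.trans (hq4 w hw).1, (hq4 w hw).2⟩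
  · rw [g2, h2, hp2]
  · rw [g3, hq3]
  · intro w hw
    rw [List.mem_toFinset] at hw ⊢
    rw [g4, h4]
    exact Or.inl (Or.inr hw)

variable {R : Type*} [AddCommGroup R] [LinearOrder R] [IsOrderedAddMonoid R]

/-- A path in the rectangle extends to one between the opposite corners, which does not lower its
weight. -/
theorem passageTime_eq_increment {x : ℕ × ℕ → R} (hx : ∀ v, 0 ≤ x v) (v : ℕ × ℕ) (h : 0 ≤ v) :
    passageTime x 0 v h = increment x 1 v := by
  have h0 : maxWeight x 0 0 v = 0 := by simp [maxWeight]
  rw [increment, h0, sub_zero, maxWeight, passageTime]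
  refine le_antisymm (Finset.sup'_le _ _ fun γ hγ => ?_) (Finset.sup'_le _ _ fun γ hγ => ?_)
  · obtain ⟨hγ1, s, hs, -, -, hs'⟩ := mem_pathsFromTo.1 hγ
    have h1 : (fun _ : Fin 1 => γ) ∈ disjointPaths 1 0 v := mem_disjointPaths.2
      ⟨fun _ => hγ1, fun _ => ⟨s, hs, hs'⟩, fun i j hij => absurd (Subsingleton.elim i j) hij⟩
    refine Finset.le_sup'_of_le _ h1 ?_
    rw [Fin.sum_univ_one]
  · obtain ⟨hγ1, hγ2, -⟩ := mem_disjointPaths.1 hγ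
    obtain ⟨γ', hγ', hsub⟩ := (hγ2 0).exists_subset_pathsFromTo h (hγ1 0)
    rw [Fin.sum_univ_one]
    exact (Finset.sum_le_sum_of_subset_of_nonneg hsub fun w _ _ => hx w).trans
      (Finset.le_sup' (pathWeight x) hγ')

end PassageTime

end LPP


/-! ### Factorization of the Gibbs weight along the first row -/

namespace LPP

section NullSets

variable {ι : Type*} [Fintype ι]

theorem ae_apply_ne_zero (i : ι) : ∀ᵐ p : ι → ℝ, p i ≠ 0 := by
  rw [ae_iff]
  simp only [not_not]
  exact Measure.pi_hyperplane (fun _ : ι => (volume : Measure ℝ)) i 0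

theorem ae_apply_ne_apply {i j : ι} (hij : i ≠ j) : ∀ᵐ p : ι → ℝ, p i ≠ p j := by
  classical
  have h := Measure.addHaar_submodule (volume : Measure (ι → ℝ))
    (LinearMap.ker ((LinearMap.proj i : (ι → ℝ) →ₗ[ℝ] ℝ) - LinearMap.proj j)) fun h => by
      have h1 : Pi.single i (1 : ℝ) ∈ LinearMap.ker
          ((LinearMap.proj i : (ι → ℝ) →ₗ[ℝ] ℝ) - LinearMap.proj j) := h ▸ Submodule.mem_top
      rw [LinearMap.mem_ker] at h1
      simp [hij.symm] at h1
  rw [ae_iff]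
  convert h using 2
  ext p
  simp [sub_eq_zero]

end NullSets

section Blocks

variable {n l m : ℕ}

/-- `Below i j` means that interlacing requires `p i ≤ p j`. -/
def Below (i j : Idx n) : Prop :=
  (Step i.1.1 j.1.1 ∧ j.1.2 = i.1.2) ∨ (Step j.1.1 i.1.1 ∧ i.1.2 = j.1.2 + 1)

theorem interlacing_iff {p : Idx n → ℝ} :
    Interlacing n p ↔ (∀ i, 0 ≤ p i) ∧ ∀ i j, Below i j → p i ≤ p j := by
  constructor
  · rintro ⟨h0, h⟩
    refine ⟨h0, fun i j hij => ?_⟩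
    rcases hij with hij | hij
    · exact (h i j hij.1).1 hij.2
    · exact (h j i hij.1).2 hij.2
  · rintro ⟨h0, h⟩
    exact ⟨h0, fun i j hij => ⟨fun e => h i j (Or.inl ⟨hij, e⟩), fun e => h j i (Or.inr ⟨hij, e⟩)⟩⟩

theorem below_mk {a b k c d k' : ℕ} {h : ((a, b), k) ∈ idx n ∪ idx (n + 1)}
    {h' : ((c, d), k') ∈ idx n ∪ idx (n + 1)} : Below ⟨((a, b), k), h⟩ ⟨((c, d), k'), h'⟩ ↔
      ((c = a + 1 ∧ d = b ∨ c = a ∧ d = b + 1) ∧ k' = k) ∨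
        ((a = c + 1 ∧ b = d ∨ a = c ∧ b = d + 1) ∧ k = k' + 1) := by
  simp [Below, Step]

theorem mem_idx_union {a b k : ℕ} : ((a, b), k) ∈ idx n ∪ idx (n + 1) ↔
    (a + b = n ∨ a + b = n + 1) ∧ 1 ≤ k ∧ k ≤ 1 + min a b := by
  rw [Finset.mem_union, mem_idx, mem_idx]
  omega

/-- The index of the first row at `(l + i, n - (l + i))`. -/
def lowerIdx (n l i : ℕ) (h : l + i ≤ n) : Idx n :=
  ⟨((l + i, n - (l + i)), 1), mem_idx_union.2 (by omega)⟩

/-- The index of the first row at `(l + i, n + 1 - (l + i))`. -/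
def upperIdx (n l i : ℕ) (h : l + i ≤ n) : Idx n :=
  ⟨((l + i, n + 1 - (l + i)), 1), mem_idx_union.2 (by omega)⟩

/-- The second row at `(l + j, n + 1 - (l + j))`, zero if it is not an entry. -/
noncomputable def secondRow (p : Idx n → ℝ) (l j : ℕ) : ℝ :=
  if h : ((l + j, n + 1 - (l + j)), 2) ∈ idx n ∪ idx (n + 1) then p ⟨_, h⟩ else 0

/-- The indices outside the first rows at the abscissae `l + 1, …, l + m`. -/
abbrev RestIdx (n l m : ℕ) : Type :=
  {c : Idx n // ¬(c.1.2 = 1 ∧ l < c.1.1.1 ∧ c.1.1.1 ≤ l + m)}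

theorem bijective_blocks (hlm : l + m ≤ n) : Function.Bijective
    (Sum.elim (Subtype.val : RestIdx n l m → Idx n) (Sum.elim
      (fun i : Fin m => lowerIdx n l (i + 1) (by omega))
      (fun i : Fin m => upperIdx n l (i + 1) (by omega)))) := by
  constructor
  · rintro (⟨⟨⟨⟨a, b⟩, k⟩, h⟩, hr⟩ | i | i) (⟨⟨⟨⟨a', b'⟩, k'⟩, h'⟩, hr'⟩ | i' | i') e <;>
      simp only [Sum.elim_inl, Sum.elim_inr, lowerIdx, upperIdx, Subtype.mk.injEq, Prod.mk.injEq,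
        Sum.inl.injEq, Sum.inr.injEq, reduceCtorEq, Fin.ext_iff] at e ⊢ <;>
      (try simp only at hr) <;> (try simp only at hr') <;> omega
  · rintro ⟨⟨⟨a, b⟩, k⟩, h⟩
    have h' := mem_idx_union.1 h
    by_cases hr : k = 1 ∧ l < a ∧ a ≤ l + m
    · obtain ⟨rfl, h1, h2⟩ := hr
      obtain ⟨i, rfl⟩ := Nat.exists_eq_add_of_lt h1
      rcases h'.1 with hb | hb
      · obtain rfl : b = n - (l + (i + 1)) := by omega
        exact ⟨Sum.inr (Sum.inl ⟨i, by omega⟩), rfl⟩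
      · obtain rfl : b = n + 1 - (l + (i + 1)) := by omega
        exact ⟨Sum.inr (Sum.inr ⟨i, by omega⟩), rfl⟩
    · exact ⟨Sum.inl ⟨_, hr⟩, rfl⟩

/-- The decomposition of an array into the resampled part of the first row, the part of the
first row above it, and the rest. -/
def splitArray (hlm : l + m ≤ n) (p : Idx n → ℝ) :
    (RestIdx n l m → ℝ) × (Fin m → ℝ) × (Fin m → ℝ) :=
  (fun c => p c.1, fun i => p (lowerIdx n l (i + 1) (by omega)),
    fun i => p (upperIdx n l (i + 1) (by omega)))

theorem measurePreserving_splitArray (hlm : l + m ≤ n) :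
    MeasurePreserving (splitArray hlm) := by
  have h := measurePreserving_pi_split (bijective_blocks hlm)
  have h2 := measurePreserving_pi_split (f := (Sum.inl : Fin m → Fin m ⊕ Fin m))
    (g := (Sum.inr : Fin m → Fin m ⊕ Fin m))
    (by rw [Sum.elim_inl_inr]; exact Function.bijective_id)
  exact ((MeasurePreserving.id volume).prod h2).comp h

/-- The second row as a function of the rest of the array. -/
noncomputable def restSecondRow (r : RestIdx n l m → ℝ) (j : Fin (m + 2)) : ℝ :=
  if h : ((l + j.1, n + 1 - (l + j.1)), 2) ∈ idx n ∪ idx (n + 1) then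
    r ⟨⟨_, h⟩, by simp⟩ else 0

/-- The left end of the resampled row. -/
def restStart (hlm : l + m ≤ n) (r : RestIdx n l m → ℝ) : ℝ :=
  r ⟨lowerIdx n l 0 (by omega), by simp [lowerIdx]⟩

/-- The sign of an entry in the energy. -/
noncomputable def energySign (i : Idx n) : ℝ :=
  (if i.1 ∈ idx (n + 1) then 1 else 0) - (if i.1 ∈ idx n then 1 else 0)

theorem energy_eq_sum_energySign (p : Idx n → ℝ) : energy n p = ∑ i, energySign i * p i := by
  simp [energy, energySign, Finset.sum_filter, sub_mul, Finset.sum_sub_distrib]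

/-- The interlacing conditions which involve only the rest of the array and the right end `z` of
the resampled row. -/
def RestInterlacing (hlm : l + m ≤ n) (r : RestIdx n l m → ℝ) (z : ℝ) : Prop :=
  (∀ c, 0 ≤ r c) ∧ (∀ c d : RestIdx n l m, Below c.1 d.1 → r c ≤ r d) ∧
    ∀ c : RestIdx n l m, Below (lowerIdx n l m hlm) c.1 → z ≤ r c

open Classical in
/-- The factor of the Gibbs weight which involves only the rest of the array and the right end of
the resampled row. -/
noncomputable def restWeight (hlm : l + m ≤ n) (r : RestIdx n l m → ℝ) (z : ℝ) : ENNReal :=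
  if RestInterlacing hlm r z then ENNReal.ofReal (Real.exp (-∑ c, energySign c.1 * r c)) else 0

theorem measurable_restWeight (hlm : l + m ≤ n) :
    Measurable (Function.uncurry (restWeight hlm)) := by
  have h : MeasurableSet {z : (RestIdx n l m → ℝ) × ℝ | RestInterlacing hlm z.1 z.2} := by
    unfold RestInterlacing
    measurability
  exact Measurable.ite h (by fun_prop) measurable_const

theorem measurable_restSecondRow : Measurable (restSecondRow (n := n) (l := l) (m := m)) := by
  refine measurable_pi_lambda _ fun j => ?_
  unfold restSecondRow
  split_ifs
  · fun_prop
  · fun_prop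

theorem measurable_restStart (hlm : l + m ≤ n) : Measurable (restStart hlm) := by
  unfold restStart
  fun_prop

theorem cons_splitArray (hlm : l + m ≤ n) (p : Idx n → ℝ) (i : Fin (m + 1)) :
    (Fin.cons (restStart hlm (splitArray hlm p).1) (splitArray hlm p).2.1 : Fin (m + 1) → ℝ) i =
      p (lowerIdx n l i (by omega)) := by
  refine Fin.cases ?_ (fun i => ?_) i
  · rw [Fin.cons_zero]
    rfl
  · rw [Fin.cons_succ]
    rfl

/-- An entry of the resampled stretch is bounded below by two second-row entries and above by two
first-row entries of the next level; an entry of the upper block is bounded only by two consecutive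
entries below it. Missing second-row entries read as zero, so the lower bounds imply non-negativity.
Only the last resampled entry has an upper neighbour in the rest. -/
theorem interlacing_iff_restInterlacing (hlm : l + m ≤ n) (p : Idx n → ℝ) : Interlacing n p ↔
    RestInterlacing hlm (splitArray hlm p).1 (p (lowerIdx n l m hlm)) ∧
      (∀ i (hi : i ≤ m), max (secondRow p l i) (secondRow p l (i + 1)) ≤
        p (lowerIdx n l i (by omega))) ∧
      ∀ i (hi : i < m), max (p (lowerIdx n l i (by omega))) (p (lowerIdx n l (i + 1) (by omega))) ≤
        p (upperIdx n l (i + 1) (by omega)) := by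
  rw [interlacing_iff]
  constructor
  · rintro ⟨h0, h⟩
    refine ⟨⟨fun c => h0 _, fun c d hcd => h _ _ hcd, fun c hc => h _ _ hc⟩, fun i hi => ?_,
      fun i hi => ?_⟩
    · refine max_le ?_ ?_
      all_goals
        rw [secondRow]
        split_ifs with hv
        · refine h _ _ (below_mk.2 ?_)
          rw [mem_idx_union] at hv
          omega
        · exact h0 _
    · refine max_le (h _ _ (below_mk.2 ?_)) (h _ _ (below_mk.2 ?_)) <;> omega
  · rintro ⟨⟨h0, h1, h2⟩, h3, h4⟩
    have hv0 : ∀ j, 0 ≤ secondRow p l j := fun j => by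
      rw [secondRow]
      split_ifs with hv
      · exact h0 ⟨⟨_, hv⟩, by simp⟩
      · exact le_rfl
    have ht0 : ∀ i (hi : i ≤ m), 0 ≤ p (lowerIdx n l i (by omega)) := fun i hi =>
      ((hv0 i).trans (le_max_left _ _)).trans (h3 i hi)
    refine ⟨fun c => ?_, ?_⟩
    · obtain ⟨c | i | i, rfl⟩ := (bijective_blocks hlm).2 c
      · exact h0 c
      · exact ht0 _ (by omega)
      · exact ((ht0 i (by omega)).trans (le_max_left _ _)).trans (h4 i i.2)
    rintro ⟨⟨⟨a, b⟩, k⟩, hi⟩ ⟨⟨⟨c, d⟩, k'⟩, hj⟩ hij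
    have hb := below_mk.1 hij
    have hi' := mem_idx_union.1 hi
    have hj' := mem_idx_union.1 hj
    by_cases hJ : k' = 1 ∧ l < c ∧ c ≤ l + m
    · obtain ⟨rfl, hc1, hc2⟩ := hJ
      obtain ⟨j, rfl⟩ := Nat.exists_eq_add_of_le hc1.le
      rcases hj'.1 with hd | hd
      · obtain rfl : d = n - (l + j) := by omega
        obtain rfl : k = 2 := by omega
        refine le_trans ?_ (h3 j (by omega))
        rcases (show a = l + j ∨ a = l + (j + 1) by omega) with rfl | rfl
        · obtain rfl : b = n + 1 - (l + j) := by omega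
          refine le_trans (le_of_eq ?_) (le_max_left _ _)
          rw [secondRow, dif_pos hi]
        · obtain rfl : b = n + 1 - (l + (j + 1)) := by omega
          refine le_trans (le_of_eq ?_) (le_max_right _ _)
          rw [secondRow, dif_pos hi]
      · obtain ⟨j, rfl⟩ := Nat.exists_eq_add_one.2 (show 0 < j by omega)
        obtain rfl : d = n + 1 - (l + (j + 1)) := by omega
        obtain rfl : k = 1 := by omega
        refine le_trans ?_ (h4 j (by omega))
        rcases (show a = l + j ∨ a = l + (j + 1) by omega) with rfl | rfl
        · obtain rfl : b = n - (l + j) := by omega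
          exact le_max_left _ _
        · obtain rfl : b = n - (l + (j + 1)) := by omega
          exact le_max_right _ _
    · by_cases hI : k = 1 ∧ l < a ∧ a ≤ l + m
      · obtain ⟨rfl, ha1, ha2⟩ := hI
        obtain rfl : a = l + m := by omega
        obtain rfl : b = n - (l + m) := by omega
        exact h2 ⟨⟨((c, d), k'), hj⟩, hJ⟩ hij
      · exact h1 ⟨⟨((a, b), k), hi⟩, hI⟩ ⟨⟨((c, d), k'), hj⟩, hJ⟩ hij

theorem neg_energy_eq (hlm : l + m ≤ n) (p : Idx n → ℝ) : -energy n p =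
    -∑ c : RestIdx n l m, energySign c.1 * p c.1 +
      ∑ i : Fin m, p (lowerIdx n l (i + 1) (by omega)) +
        ∑ i : Fin m, -p (upperIdx n l (i + 1) (by omega)) := by
  have h1 : ∀ i (hi : l + i ≤ n), energySign (lowerIdx n l i hi) = -1 := fun i hi => by
    rw [energySign, lowerIdx, if_neg, if_pos, zero_sub] <;> rw [mem_idx] <;> omega
  have h2 : ∀ i (hi : l + i ≤ n), energySign (upperIdx n l i hi) = 1 := fun i hi => by
    rw [energySign, upperIdx, if_pos, if_neg, sub_zero] <;> rw [mem_idx] <;> omega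
  rw [energy_eq_sum_energySign, ← (bijective_blocks hlm).sum_comp, Fintype.sum_sum_type,
    Fintype.sum_sum_type]
  simp only [Sum.elim_inl, Sum.elim_inr, h1, h2, Finset.sum_neg_distrib, neg_mul, one_mul]
  ring

/-- Interlacing is a weak inequality and `aboveSet` a strict one. They differ only where two
distinct entries coincide or an entry is zero, which is a null set. -/
theorem gibbsWeight_ae_eq (hlm : l + m ≤ n) : gibbsWeight n =ᵐ[volume] fun p =>
    resamplingDensity restSecondRow (restStart hlm) (restWeight hlm) (splitArray hlm p) := by
  have hne : ∀ᵐ p : Idx n → ℝ, ∀ i : Fin (m + 1), ∀ j : Fin (m + 2),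
      secondRow p l j ≠ p (lowerIdx n l i (by omega)) := by
    refine ae_all_iff.2 fun i => ae_all_iff.2 fun j => ?_
    by_cases hv : ((l + j.1, n + 1 - (l + j.1)), 2) ∈ idx n ∪ idx (n + 1)
    · simp only [secondRow, dif_pos hv]
      refine ae_apply_ne_apply fun h => ?_
      simp [lowerIdx] at h
    · simp only [secondRow, dif_neg hv]
      filter_upwards [ae_apply_ne_zero (lowerIdx n l i (by omega))] with p hp
      exact hp.symm
  filter_upwards [hne] with p hp
  have hA : boundaryWalk restSecondRow (restStart hlm) (splitArray hlm p) ∈ aboveSet m ↔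
      ∀ i (hi : i ≤ m), max (secondRow p l i) (secondRow p l (i + 1)) ≤
        p (lowerIdx n l i (by omega)) := by
    have h : ∀ i : Fin (m + 1), max (secondRow p l i) (secondRow p l (i + 1)) ≤
        p (lowerIdx n l i (by omega)) ↔ max (secondRow p l i) (secondRow p l (i + 1)) <
        p (lowerIdx n l i (by omega)) := fun i => by
      have h1 : secondRow p l i ≠ p (lowerIdx n l i (by omega)) := hp i i.castSucc
      have h2 : secondRow p l (i + 1) ≠ p (lowerIdx n l i (by omega)) := hp i i.succ
      rw [max_le_iff, max_lt_iff, h1.le_iff_lt, h2.le_iff_lt]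
    simp only [aboveSet, boundaryWalk, cons_splitArray, Set.mem_ofPred_eq, sub_lt_sub_iff_right]
    exact ⟨fun H i hi => (h ⟨i, by omega⟩).2 (H ⟨i, by omega⟩),
      fun H i => (h i).1 (H i (by omega))⟩
  rw [resamplingDensity]
  simp only [cons_splitArray, Fin.val_last, Fin.val_castSucc, Fin.val_succ]
  by_cases hI : Interlacing n p
  · obtain ⟨h1, h2, h3⟩ := (interlacing_iff_restInterlacing hlm p).1 hI
    rw [gibbsWeight, if_pos hI, if_pos (hA.2 h2), restWeight, if_pos h1,
      Finset.prod_congr rfl fun i _ => by rw [if_pos]; exact h3 i i.2,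
      ← ENNReal.ofReal_prod_of_nonneg fun i _ => (Real.exp_pos _).le, ← Real.exp_sum, mul_one,
      ← ENNReal.ofReal_mul (Real.exp_pos _).le, ← ENNReal.ofReal_mul (by positivity),
      ← Real.exp_add, ← Real.exp_add, neg_energy_eq hlm]
    rfl
  · rw [gibbsWeight, if_neg hI]
    rw [interlacing_iff_restInterlacing hlm, not_and_or, not_and_or] at hI
    rcases hI with h | h | h
    · have : restWeight hlm (splitArray hlm p).1 (p (lowerIdx n l m hlm)) = 0 := if_neg h
      simp [this]
    · rw [if_neg (fun h' => h (hA.1 h'))]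
      simp
    · push Not at h
      obtain ⟨i, hi, h⟩ := h
      rw [Finset.prod_eq_zero (Finset.mem_univ (⟨i, hi⟩ : Fin m)), mul_zero]
      rw [if_neg, ENNReal.ofReal_zero]
      exact not_le.2 h

end Blocks

end LPP


/-! ### The conditional law of the first row, and the theorem -/

namespace LPP

section ConditionalLaw

variable {n l m : ℕ} {Ω : Type*} [MeasurableSpace Ω] {μ : Measure Ω} [IsProbabilityMeasure μ]
  {ξ : ℕ × ℕ → Ω → ℝ}

theorem boundaryWalk_incrementArray (hlm : l + m ≤ n) {x : ℕ × ℕ → ℝ} (hx : ∀ v, 0 ≤ x v) :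
    boundaryWalk restSecondRow (restStart hlm) (splitArray hlm (incrementArray n x)) =
      ((fun j : Fin (m + 2) => increment x 2 (l + j.1, n + 1 - (l + j.1)),
          passageTime x 0 (l, n - l) zero_le, passageTime x 0 (l + m, n - (l + m)) zero_le),
        fun i : Fin (m + 1) => passageTime x 0 (l + i.1, n - (l + i.1)) zero_le -
          passageTime x 0 (l, n - l) zero_le) := by
  have hT : ∀ v h, passageTime x 0 v h = increment x 1 v := passageTime_eq_increment hx
  simp only [boundaryWalk, cons_splitArray, hT]
  refine Prod.ext (Prod.ext (funext fun j => ?_) rfl) rfl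
  simp only [restSecondRow, splitArray]
  split_ifs with h
  · rfl
  -- On the sides of the quadrant there is no second-row entry; there `W^2` is zero, in agreement
  -- with the default value of `restSecondRow`.
  · rw [increment_eq_shape hx 1, shape_eq_zero]
    have := j.2
    rw [mem_idx_union] at h
    omega

/-- The joint law of boundary data and row is a restricted composition product, hence the marginal
composed with the conditioned bridge; almost sure uniqueness of conditional distributions concludes.
-/
theorem condDistrib_row_eq (hξ : iIndepFun ξ μ) (hlaw : ∀ v, HasLaw (ξ v) (expMeasure 1) μ)
    (hlm : l + m ≤ n) {Y : Ω → (Fin (m + 2) → ℝ) × ℝ × ℝ} {D : Ω → Fin (m + 1) → ℝ}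
    (hYD : ∀ᵐ ω ∂μ, (Y ω, D ω) = boundaryWalk restSecondRow (restStart hlm)
      (splitArray hlm (incrementArray n fun v => ξ v ω))) :
    ∀ᵐ y ∂μ.map Y, condDistrib D Y μ y = ProbabilityTheory.cond (walkBridge m (y.2.2 - y.2.1))
      {s | ∀ i : Fin (m + 1), max (y.1 i.castSucc) (y.1 i.succ) - y.2.1 < s i} := by
  have hW := hasLaw_incrementArray_of_exponential n hξ hlaw
  have hS := measurePreserving_splitArray hlm
  have hv := measurable_restSecondRow (n := n) (l := l) (m := m)
  have ht := measurable_restStart hlm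
  have hH := measurable_restWeight hlm
  have hB := measurable_boundaryWalk hv ht
  have hm : AEMeasurable (fun ω => (Y ω, D ω)) μ :=
    ((hB.comp hS.measurable).comp_aemeasurable hW.aemeasurable).congr
      (hYD.mono fun ω h => h.symm)
  have hY : AEMeasurable Y μ := measurable_fst.comp_aemeasurable hm
  have hD : AEMeasurable D μ := measurable_snd.comp_aemeasurable hm
  obtain ⟨ν, hν, hmap⟩ := exists_map_resamplingDensity_eq volume hv ht hH
  have hjoint : μ.map (fun ω => (Y ω, D ω)) = (ν ⊗ₘ bridgeKernel m).restrict (aboveSet m) := by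
    rw [Measure.map_congr hYD, ← hmap]
    have h1 : (volume.withDensity (gibbsWeight n)).map (splitArray hlm) =
        (volume.prod volume).withDensity
          (resamplingDensity restSecondRow (restStart hlm) (restWeight hlm)) := by
      rw [withDensity_congr_ae (gibbsWeight_ae_eq hlm)]
      exact MeasurePreserving.map_withDensity hS (measurable_resamplingDensity hv ht hH)
    rw [← h1, ← hW.map_eq, AEMeasurable.map_map_of_aemeasurable hS.measurable.aemeasurable
      hW.aemeasurable, AEMeasurable.map_map_of_aemeasurable hB.aemeasurable
        (hS.measurable.comp_aemeasurable hW.aemeasurable)]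
    rfl
  have hfst : μ.map Y = ((ν ⊗ₘ bridgeKernel m).restrict (aboveSet m)).fst := by
    rw [← hjoint, Measure.fst_map_prodMk₀ hD]
  have h := condDistrib_ae_eq_of_measure_eq_compProd (μ := μ) Y hD
    (κ := condKernelOn (bridgeKernel m) (measurableSet_aboveSet m)) (by
      rw [hjoint, hfst]
      exact restrict_compProd_eq _ _ _)
  filter_upwards [h] with y hy
  rw [hy]
  rfl

end ConditionalLaw

end LPP

theorem mainTheorem8 (n : ℕ) :
    -- the RSK bijection
    (Set.BijOn (LPP.rskMap n) {t | ∀ v, 0 ≤ t v} {p | LPP.Interlacing n p}) ∧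
    -- the joint law of the increments for geometric weights
    (∀ (β : ℝ) (h0 : 0 < β) (h1 : β < 1) {Ω : Type*} [MeasurableSpace Ω] (μ : Measure Ω)
      [IsProbabilityMeasure μ] (ξ : ℕ × ℕ → Ω → ℕ), iIndepFun ξ μ →
      (∀ v, HasLaw (ξ v)
        (geometricMeasure ⟨1 - β, sub_nonneg.2 h1.le, sub_le_self 1 h0.le⟩) μ) →
      ∀ p : LPP.Idx n → ℤ, LPP.Interlacing n p →
        μ.real {ω | LPP.incrementArray n (fun v => (ξ v ω : ℤ)) = p} =
          (1 - β) ^ ((n + 2) * (n + 3) / 2) * β ^ LPP.energy n p) ∧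
    -- the joint law of the increments, and the Gibbs property, for exponential weights
    (∀ {Ω : Type*} [MeasurableSpace Ω] (μ : Measure Ω) [IsProbabilityMeasure μ]
      (ξ : ℕ × ℕ → Ω → ℝ), iIndepFun ξ μ → (∀ v, HasLaw (ξ v) (expMeasure 1) μ) →
      (LPP.partitionFunction n ≠ 0 ∧ LPP.partitionFunction n ≠ ⊤ ∧
        HasLaw (fun ω => LPP.incrementArray n fun v => ξ v ω)
          (volume.withDensity fun p => (LPP.partitionFunction n)⁻¹ * LPP.gibbsWeight n p) μ) ∧
      ∀ l m : ℕ, 0 < m → l + m ≤ n →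
        let T : ℕ → Ω → ℝ := fun a ω =>
          LPP.passageTime (fun v => ξ v ω) 0 (a, n - a) zero_le
        let Y : Ω → (Fin (m + 2) → ℝ) × ℝ × ℝ := fun ω =>
          (fun j => LPP.increment (fun v => ξ v ω) 2 (l + j, n + 1 - (l + j)),
            T l ω, T (l + m) ω)
        let D : Ω → Fin (m + 1) → ℝ := fun ω i => T (l + i) ω - T l ω
        ∀ᵐ y ∂(μ.map Y), condDistrib D Y μ y =
          ProbabilityTheory.cond (LPP.walkBridge m (y.2.2 - y.2.1))
            {s | ∀ i : Fin (m + 1), max (y.1 i.castSucc) (y.1 i.succ) - y.2.1 < s i}) := by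
  refine ⟨LPP.rskMap_bijOn n, fun β h0 h1 Ω _ μ _ ξ hξ hlaw p hp =>
    LPP.measureReal_incrementArray_eq_of_geometric n h0 h1 μ ξ hξ hlaw hp,
    fun μ _ ξ hξ hlaw => ⟨⟨?_, ?_, ?_⟩, fun l m hm hlm => ?_⟩⟩
  · rw [LPP.partitionFunction_eq_one]
    exact one_ne_zero
  · rw [LPP.partitionFunction_eq_one]
    exact ENNReal.one_ne_top
  · simp only [LPP.partitionFunction_eq_one, inv_one, one_mul]
    exact LPP.hasLaw_incrementArray_of_exponential n hξ hlaw
  · intro T Y D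
    refine LPP.condDistrib_row_eq hξ hlaw hlm ?_
    filter_upwards [LPP.ae_nonneg_of_exponential hlaw] with ω hω
    exact (LPP.boundaryWalk_incrementArray hlm hω).symm
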